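/- **Notation.** $\mathbb T=\mathbb R/\mathbb Z$ with Haar probability measure $m_{\mathbb T}$, $\mathbb S^1$ is the complex unit circle, $e(t)=e^{2\pi i t}$, $\mathbb N=\{1,2,\dots\}$, $\mathbb Z_+=\{0,1,2,\dots\}$, $[N]=\{1,\dots,N\}$. For functions of $t\to+\infty$ write $f\prec g$ if $f=o(g)$, and $f\sim g$ if $f/g$ has a finite non-zero limit. A *Hardy field* is a subfield of the ring of germs at $+\infty$ of real functions that is closed under differentiation; all Hardy fields are assumed to be closed under the translations $t\mapsto t+h$, $h\in\mathbb R$. A *Hardy field function* is a function whose germ lies in such a field. A function $a$ has *at most polynomial growth* if $a(t)\prec t^d$ for some $d\in\mathbb N$. Let $Y$ be a compact metric space, let $b\colon\mathbb N\to Y$ be extended arbitrarily to $\mathbb Z$, and let $T$ be the shift on $Y^{\mathbb Z}$. A *Furstenberg system* of $b$ is a system $(Y^{\mathbb Z},\mu,T)$, where $\mu$ is a weak-star limit $\lim_{k\to\infty}\frac1{M_k}\sum_{m\in[M_k]}\delta_{T^mb}$ for some strictly increasing sequence $(M_k)$ of positive integers. The Furstenberg system is *unique* if the weak-star limit $\lim_{N\to\infty}\frac1N\sum_{m\in[N]}\delta_{T^mb}$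 exists. Isomorphism of systems is measure-theoretic isomorphism (modulo null sets). For $d\in\mathbb Z_+$ and a Borel probability measure $\lambda$ on $\mathbb T$, let $\mathbf X_{d,\lambda}=(\mathbb T^{d+1},\lambda\times m_{\mathbb T^d},S_d)$, where $S_d(y_0,\dots,y_d)=(y_0,y_1+y_0,\dots,y_d+y_{d-1})$. **Theorem.** Let $a\colon\mathbb R_+\to\mathbb R$ be a Hardy field function of at most polynomial growth. Let $b\colon\mathbb N\to\mathbb T$ be $b(n)=a(n)\bmod 1$, or let $b\colon\mathbb N\to\mathbb S^1$ be $b(n)=e(a(n))$. 1. If $t^d\log t\prec a(t)\prec t^{d+1}$ for some $d\in\mathbb Z_+$, then $b$ has a unique Furstenberg system, and it is isomorphic to $\mathbf X_{d,m_{\mathbb T}}$. 2. If $a(t)\sim t^d\log t$ for some $d\in\mathbb Z_+$, then $b$ does not have a unique Furstenberg system, and every Furstenberg system of $b$ is isomorphic to $\mathbf X_{d,\lambda}$ for some probability measure $\lambda\ll m_{\mathbb T}$. 3. If $t^d\prec a(t)\prec t^d\log t$ for some $d\in\mathbb Z_+$, then $b$ does not have a unique Furstenberg system, every Furstenberg system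 of $b$ is isomorphic to $\mathbf X_{d,\delta_t}$ for some $t\in\mathbb T$, and for every $t\in\mathbb T$ some Furstenberg system of $b$ is isomorphic to $\mathbf X_{d,\delta_t}$. 4. If $a(t)=\alpha t^d+\tilde a(t)$ with $d\in\mathbb Z_+$, $\alpha\in\mathbb R$, $\tilde a(t)\prec t^d$, and $\alpha$ is irrational or $d=0$, then $b$ has a unique Furstenberg system, and it is isomorphic to $\mathbf X_{d,\delta_{d!\,\alpha}}$; in particular, it is isomorphic to a totally ergodic affine transformation of $\mathbb T^d$ with the Haar measure. 5. If none of the cases 1–4 applies to $a$, then $a(t)=p(t)+\epsilon(t)+\tilde a(t)$, where $p\in\mathbb Q[t]$, $\epsilon(t)\to0$ as $t\to+\infty$, and $\tilde a$ is a Hardy field function of at most polynomial growth to which one of the cases 1–4 applies. Moreover, there is $r\in\mathbb N$ such that for each $k=0,\dots,r-1$ the sequence $n\mapsto b(rn+k)$, $n\in\mathbb N$, is covered by cases 1–4: there is a Hardy field function $a_k$ of at most polynomial growth to which one of the cases 1–4 applies, with $b(rn+k)=a_k(n)\bmod1$ (respectively $b(rn+k)=e(a_k(n))$) for all $n\in\mathbb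 N$. -/

import Mathlib

open Filter Topology MeasureTheory Asymptotics

/-! ### Hardy fields -/

/-- A translation invariant Hardy field: a subfield of the ring of germs at `+∞` of real valued
functions which is closed under differentiation and under the translations `t ↦ t + h`. -/
structure IsHardyField (H : Subring (Germ (atTop : Filter ℝ) ℝ)) : Prop where
  isField : IsField H
  eventually_differentiable : ∀ f : ℝ → ℝ, (f : Germ (atTop : Filter ℝ) ℝ) ∈ H →
    ∀ᶠ t in atTop, DifferentiableAt ℝ f t
  deriv_mem : ∀ f : ℝ → ℝ, (f : Germ (atTop : Filter ℝ) ℝ) ∈ H →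
    ((deriv f : ℝ → ℝ) : Germ (atTop : Filter ℝ) ℝ) ∈ H
  translate_mem : ∀ f : ℝ → ℝ, (f : Germ (atTop : Filter ℝ) ℝ) ∈ H → ∀ h : ℝ,
    ((fun t => f (t + h) : ℝ → ℝ) : Germ (atTop : Filter ℝ) ℝ) ∈ H

/-- A Hardy field function. Only the values for large `t` matter. -/
def IsHardyFieldFunction (a : ℝ → ℝ) : Prop :=
  ∃ H : Subring (Germ (atTop : Filter ℝ) ℝ),
    IsHardyField H ∧ (a : Germ (atTop : Filter ℝ) ℝ) ∈ H

/-- At most polynomial growth: `a(t) ≺ t ^ d` for some `d`. -/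
def AtMostPolynomialGrowth (a : ℝ → ℝ) : Prop :=
  ∃ d : ℕ, a =o[atTop] (fun t : ℝ => t ^ d)

/-! ### The growth regimes

`f ≺ g` is `f =o[atTop] g`. -/

/-- `t ^ d log t ≺ a(t) ≺ t ^ (d + 1)`. -/
def GrowthAboveLog (d : ℕ) (a : ℝ → ℝ) : Prop :=
  (fun t : ℝ => t ^ d * Real.log t) =o[atTop] a ∧ a =o[atTop] (fun t : ℝ => t ^ (d + 1))

/-- `a(t) ∼ t ^ d log t`: the quotient has a finite non-zero limit. -/
def GrowthLog (d : ℕ) (a : ℝ → ℝ) : Prop :=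
  ∃ c : ℝ, c ≠ 0 ∧ Tendsto (fun t : ℝ => a t / (t ^ d * Real.log t)) atTop (𝓝 c)

/-- `t ^ d ≺ a(t) ≺ t ^ d log t`. -/
def GrowthBelowLog (d : ℕ) (a : ℝ → ℝ) : Prop :=
  (fun t : ℝ => t ^ d) =o[atTop] a ∧ a =o[atTop] (fun t : ℝ => t ^ d * Real.log t)

/-- `a(t) = α t ^ d + o(t ^ d)`, where `α` is irrational or `d = 0`. -/
def GrowthPolynomial (d : ℕ) (α : ℝ) (a : ℝ → ℝ) : Prop :=
  (Irrational α ∨ d = 0) ∧ (fun t : ℝ => a t - α * t ^ d) =o[atTop] (fun t : ℝ => t ^ d)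

/-- One of the four growth regimes applies to `a`. -/
def IsCovered (a : ℝ → ℝ) : Prop :=
  ∃ d : ℕ, GrowthAboveLog d a ∨ GrowthLog d a ∨ GrowthBelowLog d a ∨
    ∃ α : ℝ, GrowthPolynomial d α a

/-! ### Furstenberg systems -/

/-- The unit circle of `ℂ` carries its Borel `σ`-algebra. -/
noncomputable instance instMeasurableSpaceCircle : MeasurableSpace Circle := borel Circle

instance instBorelSpaceCircle : BorelSpace Circle := ⟨rfl⟩

/-- The shift `(T x)(n) = x (n + 1)` on `Y ^ ℤ`. -/
def seqShift {Y : Type*} (x : ℤ → Y) : ℤ → Y := fun n => x (n + 1)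

/-- The probability measure `μ` on `Y ^ ℤ` is the weak-star limit, as `k → ∞`, of
`𝔼_{m ∈ [M k]} δ_{T ^ m b}`, where `[N] = {1, …, N}`. For a compact metric space `Y`, the limit
exists if and only if `b` admits correlations on the intervals `[M k]`, and then
`(Y ^ ℤ, μ, seqShift)` is the Furstenberg system of `b` on these intervals. -/
def IsFurstenbergLimit {Y : Type*} [TopologicalSpace Y] [MeasurableSpace Y]
    (b : ℤ → Y) (M : ℕ → ℕ) (μ : Measure (ℤ → Y)) : Prop :=
  IsProbabilityMeasure μ ∧ ∀ f : C(ℤ → Y, ℝ),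
    Tendsto (fun k : ℕ => (∑ m ∈ Finset.Icc 1 (M k), f (seqShift^[m] b)) / (M k : ℝ)) atTop
      (𝓝 (∫ x, f x ∂μ))

/-- `(Y ^ ℤ, μ, seqShift)` is a Furstenberg system of `b`. -/
def IsFurstenbergSystem {Y : Type*} [TopologicalSpace Y] [MeasurableSpace Y]
    (b : ℤ → Y) (μ : Measure (ℤ → Y)) : Prop :=
  ∃ M : ℕ → ℕ, StrictMono M ∧ (∀ k, 0 < M k) ∧ IsFurstenbergLimit b M μ

/-- `b` has a unique Furstenberg system: the weak-star limit of `𝔼_{m ∈ [N]} δ_{T ^ m b}` as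
`N → ∞` exists. -/
def HasUniqueFurstenbergSystem {Y : Type*} [TopologicalSpace Y] [MeasurableSpace Y]
    (b : ℤ → Y) : Prop :=
  ∃ μ : Measure (ℤ → Y), IsFurstenbergLimit b (fun N => N) μ

/-! ### Measure preserving systems -/

/-- Measure theoretic isomorphism of the measure preserving systems `(X, μ, T)` and
`(X', μ', T')`: measure preserving maps in both directions that are inverse to each other up to
null sets and intertwine the transformations almost everywhere. -/
def SystemsIsomorphic {X X' : Type*} [MeasurableSpace X] [MeasurableSpace X']
    (μ : Measure X) (T : X → X) (μ' : Measure X') (T' : X' → X') : Prop :=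
  MeasurePreserving T μ μ ∧ MeasurePreserving T' μ' μ' ∧
    ∃ (Φ : X → X') (Ψ : X' → X), MeasurePreserving Φ μ μ' ∧ MeasurePreserving Ψ μ' μ ∧
      (∀ᵐ x ∂μ, Ψ (Φ x) = x) ∧ (∀ᵐ y ∂μ', Φ (Ψ y) = y) ∧ ∀ᵐ x ∂μ, Φ (T x) = T' (Φ x)

/-- The unipotent map `S_d (y₀, …, y_d) = (y₀, y₁ + y₀, …, y_d + y_{d-1})` of `𝕋 ^ (d + 1)`. -/
noncomputable def unipotentMap (d : ℕ) (y : Fin (d + 1) → UnitAddCircle) :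
    Fin (d + 1) → UnitAddCircle :=
  Fin.cases (y 0) (fun j : Fin d => y j.succ + y j.castSucc)

/-- The measure `lam × m_{𝕋 ^ d}` on `𝕋 ^ (d + 1)`; `volume` on `UnitAddCircle` is the Haar
probability measure. -/
noncomputable def unipotentMeasure (d : ℕ) (lam : Measure UnitAddCircle) :
    Measure (Fin (d + 1) → UnitAddCircle) :=
  Measure.pi (Fin.cases lam (fun _ : Fin d => volume))

/-- The system `(Y ^ ℤ, μ, seqShift)` is isomorphic to
`X_d = (𝕋 ^ (d + 1), lam × m_{𝕋 ^ d}, S_d)`. -/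
def IsoToUnipotent {Y : Type*} [MeasurableSpace Y] (μ : Measure (ℤ → Y)) (d : ℕ)
    (lam : Measure UnitAddCircle) : Prop :=
  SystemsIsomorphic μ seqShift (unipotentMeasure d lam) (unipotentMap d)

/-- An affine transformation of `𝕋 ^ d`: a continuous automorphism followed by a translation. -/
def IsTorusAffine {d : ℕ} (R : (Fin d → UnitAddCircle) → (Fin d → UnitAddCircle)) : Prop :=
  ∃ (A : (Fin d → UnitAddCircle) ≃ₜ+ (Fin d → UnitAddCircle)) (β : Fin d → UnitAddCircle),
    ∀ x, R x = A x + β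

/-- Every power `T ^ n`, `n ≥ 1`, is ergodic. -/
def TotallyErgodic {X : Type*} [MeasurableSpace X] (μ : Measure X) (T : X → X) : Prop :=
  ∀ n : ℕ, 0 < n → Ergodic (T^[n]) μ

/-! ### The description of the Furstenberg systems -/

/-- The description of the Furstenberg systems of a sequence `b` whose values at the positive
integers are `b(n) = φ (a(n))`, where `φ : ℝ → Y` is reduction modulo one or `t ↦ e(t)`. -/
structure FurstenbergDescription {Y : Type*} [TopologicalSpace Y] [MeasurableSpace Y]
    (φ : ℝ → Y) (a : ℝ → ℝ) (b : ℤ → Y) : Prop where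
  above_log : ∀ d : ℕ, GrowthAboveLog d a →
    HasUniqueFurstenbergSystem b ∧
    ∀ μ, IsFurstenbergSystem b μ → IsoToUnipotent μ d volume
  log : ∀ d : ℕ, GrowthLog d a →
    ¬ HasUniqueFurstenbergSystem b ∧
    ∀ μ, IsFurstenbergSystem b μ → ∃ lam : Measure UnitAddCircle,
      IsProbabilityMeasure lam ∧ lam ≪ volume ∧ IsoToUnipotent μ d lam
  below_log : ∀ d : ℕ, GrowthBelowLog d a →
    ¬ HasUniqueFurstenbergSystem b ∧
    (∀ μ, IsFurstenbergSystem b μ →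
      ∃ t : UnitAddCircle, IsoToUnipotent μ d (Measure.dirac t)) ∧
    ∀ t : UnitAddCircle, ∃ μ, IsFurstenbergSystem b μ ∧ IsoToUnipotent μ d (Measure.dirac t)
  polynomial : ∀ (d : ℕ) (α : ℝ), GrowthPolynomial d α a →
    HasUniqueFurstenbergSystem b ∧
    ∀ μ, IsFurstenbergSystem b μ →
      IsoToUnipotent μ d (Measure.dirac (((d.factorial : ℝ) * α : ℝ) : UnitAddCircle)) ∧
      ∃ R : (Fin d → UnitAddCircle) → (Fin d → UnitAddCircle),
        IsTorusAffine R ∧ TotallyErgodic volume R ∧ SystemsIsomorphic μ seqShift volume R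
  remaining : ¬ IsCovered a →
    (∃ (p : Polynomial ℚ) (ε a' : ℝ → ℝ),
      (∀ t : ℝ, 0 ≤ t → a t = Polynomial.aeval t p + ε t + a' t) ∧
      Tendsto ε atTop (𝓝 0) ∧
      IsHardyFieldFunction a' ∧ AtMostPolynomialGrowth a' ∧ IsCovered a') ∧
    -- each `n ↦ b (r n + k)` is again a sequence of the form `φ (a_k(n))` with `a_k` covered
    ∃ r : ℕ, 0 < r ∧ ∀ k : ℕ, k < r → ∃ ak : ℝ → ℝ,
      IsHardyFieldFunction ak ∧ AtMostPolynomialGrowth ak ∧ IsCovered ak ∧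
      ∀ n : ℕ, 0 < n → b ((r : ℤ) * n + k) = φ (ak n)

/-! Write x(n) = a(n) mod 1 and let Δ be the forward difference. Suppose Δ^(d+1) x(n) → 0. Then the
point P(n) = (Δ^d x(n), …, Δ x(n), x(n)) of the torus satisfies P(n+1) = S_d P(n) + o(1), so that on
every finite window the sequence m ↦ b(n+m) is close to the last coordinates of the S_d-orbit of
P(n). The coding map that sends y to this orbit of last coordinates has a continuous left inverse,
namely taking differences at 0. Hence a Furstenberg system of b along (M_k) is the image under the
coding of the limit distribution of P(n), n ≤ M_k, and is isomorphic to S_d with that distribution.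

By Weyl's criterion the distribution is read off from characters of the torus. If J ≥ 1 is the last
index with k_J ≠ 0, the phase c(n) of the character k satisfies Δ^J c = k_J Δ^d x + o(1). When Δ^d a
→ ±∞, van der Corput's inequality lowers J to 1, and there a second derivative test, itself based on
the Kuzmin–Landau inequality, gives cancellation; when Δ^d a converges to an irrational number,
Weyl's argument does. So the limit is λ × Haar, where λ is the limit distribution of u = Δ^d a mod 1
along (M_k).

The regimes are distinguished by nΔu(n). If it tends to ±∞, Fejér's theorem gives λ = Haar. If it
tends to a finite c, summation by parts shows that the averages of e(l u(n)) up to N are asymptotic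
to e(l u(N)) / (1 + 2πi l c). These are the Fourier coefficients of the law of θ - cE mod 1 with E
exponentially distributed and θ the limit of u(M_k). This law is absolutely continuous if c ≠ 0 and
is a point mass if c = 0. Since u → ±∞ with steps tending to zero, every θ occurs, and the system is
not unique. In the polynomial regime u converges and λ is a point mass.

The passage from the growth of a to its differences is a discrete l'Hôpital rule along the scales
n^j and n^j log n. It can be inverted because sequences coming from a Hardy field have eventually
constant sign, hence limits in [-∞, ∞]. Comparison of a with log requires enlarging the Hardy field,
by Zorn's lemma and adjunction of antiderivatives. If no regime applies, rational leading terms are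
removed one after another; the resulting polynomial is constant modulo one on suitable arithmetic
progressions. -/

/-! ### Germs with derivatives, and Hardy fields without translation invariance -/

/-- Germs at `+∞` of real functions. -/
abbrev RealGerm := Germ (atTop : Filter ℝ) ℝ

theorem eventually_eventually_nhds_of_atTop {P : ℝ → Prop} (h : ∀ᶠ t in atTop, P t) :
    ∀ᶠ t in atTop, ∀ᶠ s in 𝓝 t, P s := by
  obtain ⟨a, ha⟩ := eventually_atTop.1 h
  filter_upwards [eventually_gt_atTop a] with t ht
  filter_upwards [lt_mem_nhds ht] with s hs using ha s hs.le

/-- The germ `x'` is the derivative of the germ `x`. -/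
def HasGermDeriv (x x' : RealGerm) : Prop :=
  ∃ f f' : ℝ → ℝ, x = f ∧ x' = f' ∧ ∀ᶠ t in atTop, HasDerivAt f (f' t) t

theorem hasGermDeriv_coe {f f' : ℝ → ℝ} :
    HasGermDeriv f f' ↔ ∀ᶠ t in atTop, HasDerivAt f (f' t) t := by
  constructor
  · rintro ⟨g, g', hg, hg', h⟩
    have hg : f =ᶠ[atTop] g := Germ.coe_eq.1 hg
    have hg' : f' =ᶠ[atTop] g' := Germ.coe_eq.1 hg'
    filter_upwards [h, hg', eventually_eventually_nhds_of_atTop hg] with t h1 h2 h3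
    rw [h2]
    exact h1.congr_of_eventuallyEq h3
  · intro h
    exact ⟨f, f', rfl, rfl, h⟩

namespace HasGermDeriv

variable {x x' y y' : RealGerm}

theorem add (hx : HasGermDeriv x x') (hy : HasGermDeriv y y') :
    HasGermDeriv (x + y) (x' + y') := by
  obtain ⟨f, f', rfl, rfl, hf⟩ := hx
  obtain ⟨g, g', rfl, rfl, hg⟩ := hy
  refine ⟨f + g, f' + g', rfl, rfl, ?_⟩
  filter_upwards [hf, hg] with t h1 h2 using h1.add h2

theorem neg (hx : HasGermDeriv x x') : HasGermDeriv (-x) (-x') := by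
  obtain ⟨f, f', rfl, rfl, hf⟩ := hx
  refine ⟨-f, -f', rfl, rfl, ?_⟩
  filter_upwards [hf] with t h1 using h1.neg

theorem mul (hx : HasGermDeriv x x') (hy : HasGermDeriv y y') :
    HasGermDeriv (x * y) (x' * y + x * y') := by
  obtain ⟨f, f', rfl, rfl, hf⟩ := hx
  obtain ⟨g, g', rfl, rfl, hg⟩ := hy
  refine ⟨f * g, f' * g + f * g', rfl, rfl, ?_⟩
  filter_upwards [hf, hg] with t h1 h2 using h1.mul h2

theorem const (c : ℝ) : HasGermDeriv (((fun _ => c : ℝ → ℝ) : RealGerm)) 0 :=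
  ⟨fun _ => c, 0, rfl, rfl, Eventually.of_forall fun t => hasDerivAt_const t c⟩

theorem zero : HasGermDeriv 0 0 := const 0

theorem one : HasGermDeriv 1 0 := const 1

theorem pow (hx : HasGermDeriv x x') (n : ℕ) :
    HasGermDeriv (x ^ (n + 1)) ((n + 1 : ℕ) • (x' * x ^ n)) := by
  induction n with
  | zero => simpa using hx
  | succ n ih =>
    have := ih.mul hx
    rw [pow_succ x (n + 1)]
    convert this using 1
    simp only [nsmul_eq_mul, Nat.cast_add, Nat.cast_one]
    ring

/-- If `x q = p` with `q` eventually non-zero then `x` is differentiable. -/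
theorem of_mul {q q' p p' : RealGerm} (hq : HasGermDeriv q q') (hp : HasGermDeriv p p')
    (h0 : q.LiftPred (· ≠ 0)) (h : x * q = p) :
    ∃ x', HasGermDeriv x x' ∧ x' * q ^ 2 = p' * q - p * q' := by
  obtain ⟨g, g', rfl, rfl, hg⟩ := hq
  obtain ⟨f, f', rfl, rfl, hf⟩ := hp
  induction x using Germ.inductionOn with | h u => ?_
  have h : u * g =ᶠ[atTop] f := Germ.coe_eq.1 h
  have h0 : ∀ᶠ t in atTop, g t ≠ 0 := h0
  have hu : ∀ᶠ t in atTop, u t = f t / g t := by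
    filter_upwards [h, h0] with t h1 h2
    rw [eq_div_iff h2]; exact h1
  refine ⟨((fun t => (f' t * g t - f t * g' t) / g t ^ 2 : ℝ → ℝ) : RealGerm),
    ⟨u, _, rfl, rfl, ?_⟩, ?_⟩
  · filter_upwards [hf, hg, h0, eventually_eventually_nhds_of_atTop hu] with t h1 h2 h3 h4
    exact (h1.div h2 h3).congr_of_eventuallyEq h4
  · refine Germ.coe_eq.2 ?_
    filter_upwards [h, h0] with t h2 h3
    change (f' t * g t - f t * g' t) / g t ^ 2 * g t ^ 2 = f' t * g t - f t * g' t
    field_simp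

end HasGermDeriv

/-- A germ which is eventually positive, eventually zero, or eventually negative. -/
def IsSigned (x : RealGerm) : Prop :=
  x.LiftPred (0 < ·) ∨ x = 0 ∨ x.LiftPred (· < 0)

theorem isSigned_coe {f : ℝ → ℝ} : IsSigned (f : RealGerm) ↔
    (∀ᶠ t in atTop, 0 < f t) ∨ (∀ᶠ t in atTop, f t = 0) ∨ ∀ᶠ t in atTop, f t < 0 := by
  refine or_congr Iff.rfl (or_congr ?_ Iff.rfl)
  exact Germ.coe_eq (g := (0 : ℝ → ℝ))

theorem IsSigned.ne_zero {x : RealGerm} (h : IsSigned x) (h0 : x ≠ 0) : x.LiftPred (· ≠ 0) := by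
  induction x using Germ.inductionOn with | h u => ?_
  rcases h with h | h | h
  · exact Eventually.mono h fun t ht => ne_of_gt ht
  · exact absurd h h0
  · exact Eventually.mono h fun t ht => ne_of_lt ht

theorem IsSigned.mul {x y : RealGerm} (hx : IsSigned x) (hy : IsSigned y) : IsSigned (x * y) := by
  induction x using Germ.inductionOn with | h u => ?_
  induction y using Germ.inductionOn with | h v => ?_
  have : ((u : RealGerm) * (v : RealGerm)) = ((u * v : ℝ → ℝ) : RealGerm) := rfl
  rw [this, isSigned_coe]
  rw [isSigned_coe] at hx hy
  simp only [Pi.mul_apply]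
  rcases hx with hx | hx | hx <;> rcases hy with hy | hy | hy
  · left; filter_upwards [hx, hy] with t h1 h2 using mul_pos h1 h2
  · right; left; filter_upwards [hx, hy] with t h1 h2; simp [h2]
  · right; right; filter_upwards [hx, hy] with t h1 h2 using mul_neg_of_pos_of_neg h1 h2
  · right; left; filter_upwards [hx, hy] with t h1 h2; simp [h1]
  · right; left; filter_upwards [hx, hy] with t h1 h2; simp [h1]
  · right; left; filter_upwards [hx, hy] with t h1 h2; simp [h1]
  · right; right; filter_upwards [hx, hy] with t h1 h2 using mul_neg_of_neg_of_pos h1 h2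
  · right; left; filter_upwards [hx, hy] with t h1 h2; simp [h2]
  · left; filter_upwards [hx, hy] with t h1 h2 using mul_pos_of_neg_of_neg h1 h2

/-- By the intermediate value theorem, the image of a half-line under a continuous function is an
interval; if it misses 0 it lies on one side of it. -/
theorem isSigned_of_eventually_ne {f f' : ℝ → ℝ} (h : ∀ᶠ t in atTop, HasDerivAt f (f' t) t)
    (h0 : ∀ᶠ t in atTop, f t ≠ 0) : IsSigned (f : RealGerm) := by
  obtain ⟨a, ha⟩ := eventually_atTop.1 (h.and h0)
  have hc : ContinuousOn f (Set.Ici a) := fun t ht => (ha t ht).1.continuousAt.continuousWithinAt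
  have key : ∀ s t, a ≤ s → a ≤ t → 0 < f s → 0 < f t := by
    intro s t hs ht hfs
    by_contra hft
    have hft' : f t < 0 := lt_of_le_of_ne (not_lt.1 hft) (ha t ht).2
    have : (0 : ℝ) ∈ f '' Set.Ici a :=
      (isPreconnected_Ici.image f hc).ordConnected.out ⟨t, ht, rfl⟩ ⟨s, hs, rfl⟩
        ⟨hft'.le, hfs.le⟩
    obtain ⟨u, hu, hu0⟩ := this
    exact (ha u hu).2 hu0
  rw [isSigned_coe]
  rcases lt_or_gt_of_ne (ha a le_rfl).2 with h1 | h1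
  · right; right
    filter_upwards [eventually_ge_atTop a] with t ht
    rcases lt_or_gt_of_ne (ha t ht).2 with h2 | h2
    · exact h2
    · exact absurd (key t a ht le_rfl h2) (not_lt.2 h1.le)
  · left
    filter_upwards [eventually_ge_atTop a] with t ht using key a t le_rfl ht h1

/-- An increasing function either becomes positive and stays so, or reaches zero and stays there, or
remains negative. -/
theorem isSigned_of_monotoneOn {f : ℝ → ℝ} {a : ℝ} (h : MonotoneOn f (Set.Ici a)) :
    IsSigned (f : RealGerm) := by
  rw [isSigned_coe]
  by_cases h1 : ∃ s ≥ a, 0 < f s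
  · obtain ⟨s, hs, h1⟩ := h1
    left
    filter_upwards [eventually_ge_atTop s] with t ht
    exact h1.trans_le (h hs (hs.le.trans ht) ht)
  · push Not at h1
    by_cases h2 : ∃ s ≥ a, f s = 0
    · obtain ⟨s, hs, h2⟩ := h2
      right; left
      filter_upwards [eventually_ge_atTop s] with t ht
      exact le_antisymm (h1 t (hs.le.trans ht)) (h2 ▸ h hs (hs.le.trans ht) ht)
    · push Not at h2
      right; right
      filter_upwards [eventually_ge_atTop a] with t ht
      exact lt_of_le_of_ne (h1 t ht) (h2 t ht)

theorem IsSigned.neg {x : RealGerm} (h : IsSigned x) : IsSigned (-x) := by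
  induction x using Germ.inductionOn with | h u => ?_
  have : -(u : RealGerm) = ((-u : ℝ → ℝ) : RealGerm) := rfl
  rw [this, isSigned_coe]
  rw [isSigned_coe] at h
  simp only [Pi.neg_apply, Left.neg_pos_iff, neg_eq_zero, Left.neg_neg_iff]
  tauto

theorem monotoneOn_of_eventually_deriv_nonneg {f f' : ℝ → ℝ}
    (h : ∀ᶠ t in atTop, HasDerivAt f (f' t) t) (h0 : ∀ᶠ t in atTop, 0 ≤ f' t) :
    ∃ a, MonotoneOn f (Set.Ici a) := by
  obtain ⟨a, ha⟩ := eventually_atTop.1 (h.and h0)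
  refine ⟨a, monotoneOn_of_deriv_nonneg (convex_Ici a)
    (fun t ht => (ha t ht).1.continuousAt.continuousWithinAt) ?_ ?_⟩
  · intro t ht
    rw [interior_Ici] at ht
    exact (ha t (le_of_lt ht)).1.differentiableAt.differentiableWithinAt
  · intro t ht
    rw [interior_Ici] at ht
    rw [(ha t (le_of_lt ht)).1.deriv]
    exact (ha t (le_of_lt ht)).2

/-- A differentiable germ whose derivative has constant sign has constant sign. -/
theorem IsSigned.of_deriv {x x' : RealGerm} (hx : HasGermDeriv x x') (h : IsSigned x') :
    IsSigned x := by
  have pos : ∀ {x x' : RealGerm}, HasGermDeriv x x' → (∀ f' : ℝ → ℝ, x' = f' →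
      ∀ᶠ t in atTop, 0 ≤ f' t) → IsSigned x := by
    rintro _ _ ⟨f, f', rfl, rfl, hf⟩ h
    obtain ⟨a, ha⟩ := monotoneOn_of_eventually_deriv_nonneg hf (h f' rfl)
    exact isSigned_of_monotoneOn ha
  rcases h with h | h | h
  · refine pos hx ?_
    rintro f' rfl
    exact Eventually.mono h fun t ht => le_of_lt ht
  · refine pos hx ?_
    rintro f' rfl
    exact Eventually.mono (Germ.coe_eq.1 h) fun t ht => ht.ge
  · have h2 : IsSigned (-x) := by
      refine pos hx.neg ?_
      rintro f' hf'
      obtain rfl : x' = ((-f' : ℝ → ℝ) : RealGerm) := by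
        rw [← neg_neg x', hf']; rfl
      refine Eventually.mono h fun t ht => ?_
      simp only [Pi.neg_apply] at ht
      linarith
    simpa using h2.neg

/-- A Hardy field, without translation invariance. -/
structure IsPreHardyField (K : Subring RealGerm) : Prop where
  exists_inv : ∀ x ∈ K, x ≠ 0 → ∃ y ∈ K, x * y = 1
  exists_deriv : ∀ x ∈ K, ∃ x' ∈ K, HasGermDeriv x x'

/-- An inverse germ v with f v = 1 forces f to have no zeros eventually, and f is differentiable,
hence continuous, so it keeps its sign. -/
theorem IsPreHardyField.isSigned {K : Subring RealGerm} (hK : IsPreHardyField K) {x : RealGerm}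
    (hx : x ∈ K) : IsSigned x := by
  by_cases h0 : x = 0
  · exact Or.inr (Or.inl h0)
  · obtain ⟨y, -, hxy⟩ := hK.exists_inv x hx h0
    obtain ⟨x', -, f, f', rfl, rfl, hf⟩ := hK.exists_deriv x hx
    refine isSigned_of_eventually_ne hf ?_
    induction y using Germ.inductionOn with | h v => ?_
    have : f * v =ᶠ[atTop] 1 := Germ.coe_eq.1 hxy
    filter_upwards [this] with t ht h
    simp [h] at ht

/-- The ring of quotients, inside the ring of germs, of a ring of germs of constant sign. -/
def quotientSubring (P : Subring RealGerm) : Subring RealGerm where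
  carrier := {x | ∃ q ∈ P, q.LiftPred (· ≠ 0) ∧ x * q ∈ P}
  mul_mem' := by
    rintro x y ⟨p, hp, hp0, hxp⟩ ⟨q, hq, hq0, hyq⟩
    refine ⟨p * q, P.mul_mem hp hq, ?_, ?_⟩
    · induction p using Germ.inductionOn with | h u => ?_
      induction q using Germ.inductionOn with | h v => ?_
      exact (Eventually.and hp0 hq0).mono fun t ht => mul_ne_zero ht.1 ht.2
    · rw [show x * y * (p * q) = (x * p) * (y * q) by ring]
      exact P.mul_mem hxp hyq
  one_mem' := ⟨1, P.one_mem, Eventually.of_forall fun _ => one_ne_zero, by simp [P.one_mem]⟩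
  add_mem' := by
    rintro x y ⟨p, hp, hp0, hxp⟩ ⟨q, hq, hq0, hyq⟩
    refine ⟨p * q, P.mul_mem hp hq, ?_, ?_⟩
    · induction p using Germ.inductionOn with | h u => ?_
      induction q using Germ.inductionOn with | h v => ?_
      exact (Eventually.and hp0 hq0).mono fun t ht => mul_ne_zero ht.1 ht.2
    · rw [show (x + y) * (p * q) = (x * p) * q + p * (y * q) by ring]
      exact P.add_mem (P.mul_mem hxp hq) (P.mul_mem hp hyq)
  zero_mem' := ⟨1, P.one_mem, Eventually.of_forall fun _ => one_ne_zero, by simp [P.zero_mem]⟩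
  neg_mem' := by
    rintro x ⟨p, hp, hp0, hxp⟩
    exact ⟨p, hp, hp0, by rw [neg_mul]; exact P.neg_mem hxp⟩

theorem le_quotientSubring (P : Subring RealGerm) :
    P ≤ quotientSubring P := fun x hx =>
  ⟨1, P.one_mem, Eventually.of_forall fun _ => one_ne_zero, by simpa using hx⟩

theorem realGerm_inv_mul_cancel {p : RealGerm} (h : p.LiftPred (· ≠ 0)) : p⁻¹ * p = 1 := by
  induction p using Germ.inductionOn with | h u => ?_
  refine Germ.coe_eq.2 ?_
  exact Eventually.mono h fun t ht => inv_mul_cancel₀ ht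

/-- Constancy of sign turns a non-zero element into an eventually non-vanishing one, which is an
admissible denominator. The quotient rule keeps derivatives inside, with denominator `q ^ 2`. -/
theorem isPreHardyField_quotientSubring (P : Subring RealGerm) (hs : ∀ x ∈ P, IsSigned x)
    (hd : ∀ x ∈ P, ∃ x' ∈ P, HasGermDeriv x x') : IsPreHardyField (quotientSubring P) where
  exists_inv := by
    rintro x ⟨q, hq, hq0, hxq⟩ hx
    have hqi := realGerm_inv_mul_cancel hq0
    have hp : x * q ≠ 0 := by
      intro h
      apply hx
      calc x = x * q * q⁻¹ := by rw [mul_assoc, mul_comm q, hqi, mul_one]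
        _ = 0 := by rw [h, zero_mul]
    have hp0 := (hs _ hxq).ne_zero hp
    have hpi := realGerm_inv_mul_cancel hp0
    refine ⟨q * (x * q)⁻¹, ⟨x * q, hxq, hp0, ?_⟩, ?_⟩
    · rw [mul_assoc, hpi, mul_one]; exact hq
    · rw [← mul_assoc, mul_comm, hpi]
  exists_deriv := by
    rintro x ⟨q, hq, hq0, hxq⟩
    obtain ⟨q', hq', hdq⟩ := hd q hq
    obtain ⟨p', hp', hdp⟩ := hd _ hxq
    obtain ⟨x', hx', h⟩ := hdq.of_mul hdp hq0 rfl
    refine ⟨x', ⟨q ^ 2, P.pow_mem hq 2, ?_, ?_⟩, hx'⟩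
    · induction q using Germ.inductionOn with | h u => ?_
      exact Eventually.mono hq0 fun t ht => pow_ne_zero 2 ht
    · rw [h]
      exact P.sub_mem (P.mul_mem hp' hq) (P.mul_mem hxq hq')

/-! ### Adjoining an antiderivative -/

section Adjoin

variable {K : Subring RealGerm} {y y' : RealGerm}

/-- The derivative of a polynomial in y of degree below n is again one: (y^i)' = i y' y^(i-1) with
y' in K, and differentiating a coefficient does not change the degree. -/
theorem exists_deriv_mem_span (hK : IsPreHardyField K) (hy : HasGermDeriv y y') (hy' : y' ∈ K)
    (n : ℕ) {x : RealGerm} (hx : x ∈ Submodule.span K ((fun i : ℕ => y ^ i) '' Set.Iio n)) :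
    ∃ x' ∈ Submodule.span K ((fun i : ℕ => y ^ i) '' Set.Iio n), HasGermDeriv x x' := by
  induction hx using Submodule.span_induction with
  | mem x hx =>
    obtain ⟨i, hi, rfl⟩ := hx
    rcases i with _ | i
    · exact ⟨0, Submodule.zero_mem _, by simpa using HasGermDeriv.one⟩
    · refine ⟨_, ?_, hy.pow i⟩
      refine Submodule.smul_of_tower_mem _ _ ?_
      exact Submodule.smul_mem _ (⟨y', hy'⟩ : K)
        (Submodule.subset_span ⟨i, lt_trans (Nat.lt_succ_self i) hi, rfl⟩)
  | zero => exact ⟨0, Submodule.zero_mem _, HasGermDeriv.zero⟩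
  | add x z _ _ h1 h2 =>
    obtain ⟨x', hx', h1⟩ := h1
    obtain ⟨z', hz', h2⟩ := h2
    exact ⟨x' + z', Submodule.add_mem _ hx' hz', h1.add h2⟩
  | smul c x hx h =>
    obtain ⟨x', hx', h⟩ := h
    obtain ⟨c', hc', hc⟩ := hK.exists_deriv c c.2
    refine ⟨c' * x + c * x', Submodule.add_mem _ ?_ ?_, hc.mul h⟩
    · exact Submodule.smul_mem _ (⟨c', hc'⟩ : K) hx
    · exact Submodule.smul_mem _ c hx'

/-- Induction on the degree. After division by its leading coefficient, the polynomial is monic in y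
and its derivative has lower degree. That derivative has constant sign by induction, so the
polynomial is eventually monotone. -/
theorem isSigned_of_mem_span (hK : IsPreHardyField K) (hy : HasGermDeriv y y') (hy' : y' ∈ K)
    (n : ℕ) {x : RealGerm} (hx : x ∈ Submodule.span K ((fun i : ℕ => y ^ i) '' Set.Iio n)) :
    IsSigned x := by
  induction n generalizing x with
  | zero =>
    have : x = 0 := by simpa using hx
    exact Or.inr (Or.inl this)
  | succ n ih =>
    have hI : Set.Iio (n + 1) = insert n (Set.Iio n) := by
      ext i; simp only [Set.mem_Iio, Set.mem_insert_iff]; omega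
    rw [hI, Set.image_insert_eq, Submodule.mem_span_insert] at hx
    obtain ⟨c, z, hz, rfl⟩ := hx
    by_cases hc : (c : RealGerm) = 0
    · have : c • y ^ n = 0 := by
        change (c : RealGerm) * y ^ n = 0
        rw [hc, zero_mul]
      rw [this, zero_add]
      exact ih hz
    · obtain ⟨d, hd, hcd⟩ := hK.exists_inv c c.2 hc
      have hz2 : d * z ∈ Submodule.span K ((fun i : ℕ => y ^ i) '' Set.Iio n) :=
        Submodule.smul_mem _ (⟨d, hd⟩ : K) hz
      have hfac : c • y ^ n + z = c * (y ^ n + d * z) := by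
        change (c : RealGerm) * y ^ n + z = _
        rw [mul_add, ← mul_assoc (c : RealGerm) d z, hcd, one_mul]
      rw [hfac]
      refine (hK.isSigned c.2).mul ?_
      obtain ⟨w, hw, hdw⟩ := exists_deriv_mem_span hK hy hy' n hz2
      rcases n with _ | n
      · have : d * z = 0 := by simpa using hz2
        rw [this, pow_zero, add_zero]
        exact Or.inl (Eventually.of_forall fun t => one_pos)
      · refine IsSigned.of_deriv ((hy.pow n).add hdw) (ih (Submodule.add_mem _ ?_ hw))
        refine Submodule.smul_of_tower_mem _ _ ?_
        exact Submodule.smul_mem _ (⟨y', hy'⟩ : K)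
          (Submodule.subset_span ⟨n, Nat.lt_succ_self n, rfl⟩)

theorem exists_mem_span_of_mem_adjoin {x : RealGerm} (hx : x ∈ Algebra.adjoin K {y}) :
    ∃ n, x ∈ Submodule.span K ((fun i : ℕ => y ^ i) '' Set.Iio n) := by
  rw [Algebra.adjoin_singleton_eq_range_aeval] at hx
  obtain ⟨p, rfl⟩ := hx
  refine ⟨p.natDegree + 1, ?_⟩
  simp only [AlgHom.toRingHom_eq_coe, RingHom.coe_coe]
  rw [Polynomial.aeval_eq_sum_range]
  refine Submodule.sum_mem _ fun i hi => Submodule.smul_mem _ _ (Submodule.subset_span ⟨i, ?_, rfl⟩)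
  simpa using hi

/-- The ring K[y] is closed under derivatives and all its elements have constant sign, so its
quotients inside the germs form a Hardy field. No algebraic independence of y is needed. -/
theorem IsPreHardyField.exists_adjoin (hK : IsPreHardyField K) (hy : HasGermDeriv y y')
    (hy' : y' ∈ K) : ∃ L, IsPreHardyField L ∧ K ≤ L ∧ y ∈ L := by
  set P : Subring RealGerm := (Algebra.adjoin K {y}).toSubring with hP
  have hs : ∀ x ∈ P, IsSigned x := by
    intro x hx
    obtain ⟨n, hn⟩ := exists_mem_span_of_mem_adjoin hx
    exact isSigned_of_mem_span hK hy hy' n hn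
  have hle : ∀ n, ∀ x ∈ Submodule.span K ((fun i : ℕ => y ^ i) '' Set.Iio n), x ∈ P := by
    intro n x hx
    have : Submodule.span K ((fun i : ℕ => y ^ i) '' Set.Iio n) ≤
        Subalgebra.toSubmodule (Algebra.adjoin K {y}) := by
      rw [Submodule.span_le]
      rintro _ ⟨i, -, rfl⟩
      exact pow_mem (Algebra.subset_adjoin (R := K) (Set.mem_singleton y)) i
    exact this hx
  refine ⟨quotientSubring P, isPreHardyField_quotientSubring P hs ?_, ?_, ?_⟩
  · intro x hx
    obtain ⟨n, hn⟩ := exists_mem_span_of_mem_adjoin hx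
    obtain ⟨x', hx', h⟩ := exists_deriv_mem_span hK hy hy' n hn
    exact ⟨x', hle n x' hx', h⟩
  · refine le_trans ?_ (le_quotientSubring P)
    intro x hx
    exact (Algebra.adjoin K {y}).algebraMap_mem (⟨x, hx⟩ : K)
  · exact le_quotientSubring P (Algebra.subset_adjoin (R := K) (Set.mem_singleton y))

end Adjoin

/-- Maximality is used only through closure under antiderivatives, which yields the constants, the
identity and the logarithm in turn. -/
theorem IsPreHardyField.exists_maximal {K : Subring RealGerm} (hK : IsPreHardyField K) :
    ∃ M, K ≤ M ∧ IsPreHardyField M ∧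
      ∀ y y', HasGermDeriv y y' → y' ∈ M → y ∈ M := by
  obtain ⟨M, hKM, hM⟩ := zorn_le_nonempty₀ {L : Subring RealGerm | IsPreHardyField L} (by
    intro c hc hchain y hy
    have hdir : DirectedOn (· ≤ ·) c := hchain.directedOn
    refine ⟨sSup c, ⟨?_, ?_⟩, fun z hz => le_sSup hz⟩
    · intro x hx h0
      obtain ⟨s, hs, hxs⟩ := (Subring.mem_sSup_of_directedOn ⟨y, hy⟩ hdir).1 hx
      obtain ⟨z, hz, h⟩ := (hc hs).exists_inv x hxs h0
      exact ⟨z, le_sSup hs hz, h⟩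
    · intro x hx
      obtain ⟨s, hs, hxs⟩ := (Subring.mem_sSup_of_directedOn ⟨y, hy⟩ hdir).1 hx
      obtain ⟨z, hz, h⟩ := (hc hs).exists_deriv x hxs
      exact ⟨z, le_sSup hs hz, h⟩) K hK
  refine ⟨M, hKM, hM.prop, fun y y' h hy' => ?_⟩
  obtain ⟨L, hL, hML, hyL⟩ := hM.prop.exists_adjoin h hy'
  exact hM.le_of_ge hL hML hyL

/-! ### Translation invariance, and adjoining the constants, the identity and the logarithm -/

theorem IsHardyField.isPreHardyField {H : Subring RealGerm} (hH : IsHardyField H) :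
    IsPreHardyField H where
  exists_inv := by
    intro x hx h0
    obtain ⟨y, hy⟩ := hH.isField.mul_inv_cancel (a := ⟨x, hx⟩) (by
      intro h; exact h0 (congrArg Subtype.val h))
    exact ⟨y, y.2, congrArg Subtype.val hy⟩
  exists_deriv := by
    intro x hx
    induction x using Germ.inductionOn with | h f => ?_
    refine ⟨_, hH.deriv_mem f hx, hasGermDeriv_coe.2 ?_⟩
    filter_upwards [hH.eventually_differentiable f hx] with t ht using ht.hasDerivAt

/-- Translation `t ↦ t + h` on germs. -/
def germTranslate (h : ℝ) : RealGerm →+* RealGerm where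
  toFun x := x.compTendsto (fun t => t + h) (tendsto_atTop_add_const_right _ h tendsto_id)
  map_one' := rfl
  map_zero' := rfl
  map_mul' x y := by
    induction x using Germ.inductionOn with | h u => ?_
    induction y using Germ.inductionOn with | h v => ?_
    rfl
  map_add' x y := by
    induction x using Germ.inductionOn with | h u => ?_
    induction y using Germ.inductionOn with | h v => ?_
    rfl

theorem isHardyField_of_isPreHardyField {K : Subring RealGerm} (hK : IsPreHardyField K)
    (ht : ∀ x ∈ K, ∀ h, germTranslate h x ∈ K) : IsHardyField K where
  isField :=
    { exists_pair_ne := ⟨0, 1, by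
        intro h
        have h1 : (0 : RealGerm) = 1 := congrArg Subtype.val h
        exact zero_ne_one h1⟩
      mul_comm := mul_comm
      mul_inv_cancel := by
        rintro ⟨x, hx⟩ h0
        obtain ⟨y, hy, h⟩ := hK.exists_inv x hx (fun h => h0 (Subtype.ext h))
        exact ⟨⟨y, hy⟩, Subtype.ext h⟩ }
  eventually_differentiable := by
    intro f hf
    obtain ⟨x', -, h⟩ := hK.exists_deriv _ hf
    induction x' using Germ.inductionOn with | h f' => ?_
    filter_upwards [hasGermDeriv_coe.1 h] with t ht using ht.differentiableAt
  deriv_mem := by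
    intro f hf
    obtain ⟨x', hx', h⟩ := hK.exists_deriv _ hf
    induction x' using Germ.inductionOn with | h f' => ?_
    convert hx' using 1
    refine Germ.coe_eq.2 ?_
    filter_upwards [hasGermDeriv_coe.1 h] with t ht using ht.deriv
  translate_mem := fun f hf h => ht _ hf h

/-- The germ of the identity. -/
def idGerm : RealGerm := ((fun t => t : ℝ → ℝ) : RealGerm)

theorem hasGermDeriv_idGerm : HasGermDeriv idGerm 1 :=
  ⟨fun t => t, 1, rfl, rfl, Eventually.of_forall fun t => hasDerivAt_id t⟩

theorem hasGermDeriv_log : HasGermDeriv ((Real.log : ℝ → ℝ) : RealGerm)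
    ((fun t => t⁻¹ : ℝ → ℝ) : RealGerm) := by
  refine ⟨_, _, rfl, rfl, ?_⟩
  filter_upwards [eventually_gt_atTop 0] with t ht using Real.hasDerivAt_log ht.ne'

/-- Every Hardy field function lies in a Hardy field which contains the constants and the
identity, and which is contained in a Hardy field (without translation invariance) which contains
the logarithm. -/
theorem IsHardyFieldFunction.exists_extension {a : ℝ → ℝ} (ha : IsHardyFieldFunction a) :
    ∃ K M : Subring RealGerm, IsHardyField K ∧ IsPreHardyField M ∧ K ≤ M ∧
      (a : RealGerm) ∈ K ∧ (∀ c : ℝ, ((fun _ => c : ℝ → ℝ) : RealGerm) ∈ K) ∧ idGerm ∈ K ∧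
      ((Real.log : ℝ → ℝ) : RealGerm) ∈ M := by
  obtain ⟨H, hH, haH⟩ := ha
  obtain ⟨M, hHM, hM, hmax⟩ := hH.isPreHardyField.exists_maximal
  have hcM : ∀ c : ℝ, ((fun _ => c : ℝ → ℝ) : RealGerm) ∈ M := fun c =>
    hmax _ _ (HasGermDeriv.const c) M.zero_mem
  have hidM : idGerm ∈ M := hmax _ _ hasGermDeriv_idGerm M.one_mem
  have hlogM : ((Real.log : ℝ → ℝ) : RealGerm) ∈ M := by
    -- The logarithm is an antiderivative of 1/t, which is the inverse of the identity in M.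
    refine hmax _ _ hasGermDeriv_log ?_
    obtain ⟨y, hy, h⟩ := hM.exists_inv idGerm hidM (by
      intro h
      have h : (fun t : ℝ => t) =ᶠ[atTop] 0 := Germ.coe_eq.1 h
      obtain ⟨t, h1, h2⟩ := (h.and (eventually_gt_atTop 0)).exists
      exact h2.ne' h1)
    induction y using Germ.inductionOn with | h f => ?_
    convert hy using 1
    refine Germ.coe_eq.2 ?_
    have h : (fun t : ℝ => t) * f =ᶠ[atTop] 1 := Germ.coe_eq.1 h
    filter_upwards [h] with t ht
    exact inv_eq_of_mul_eq_one_right ht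
  -- The field M from Zorn's lemma need not be translation invariant. The field K is therefore
  -- generated inside M by H, the constants and the identity, a set whose translates stay in the
  -- ring they generate. Lying in M gives its elements constant sign.
  set S : Set RealGerm := (H : Set RealGerm) ∪
    (Set.range fun c : ℝ => ((fun _ => c : ℝ → ℝ) : RealGerm)) ∪ {idGerm} with hS
  set P := Subring.closure S with hP
  have hSM : S ⊆ M := by
    rintro x ((hx | ⟨c, rfl⟩) | rfl)
    · exact hHM hx
    · exact hcM c
    · exact hidM
  have hPM : P ≤ M := Subring.closure_le.2 hSM
  have hs : ∀ x ∈ P, IsSigned x := fun x hx => hM.isSigned (hPM hx)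
  have hHS : ∀ x ∈ H, x ∈ P := fun x hx => Subring.subset_closure (Or.inl (Or.inl hx))
  have hcS : ∀ c : ℝ, ((fun _ => c : ℝ → ℝ) : RealGerm) ∈ P :=
    fun c => Subring.subset_closure (Or.inl (Or.inr ⟨c, rfl⟩))
  have hidS : idGerm ∈ P := Subring.subset_closure (Or.inr rfl)
  have hd : ∀ x ∈ P, ∃ x' ∈ P, HasGermDeriv x x' := by
    intro x hx
    induction hx using Subring.closure_induction with
    | mem x hx =>
      rcases hx with (hx | ⟨c, rfl⟩) | rfl
      · obtain ⟨x', hx', h⟩ := hH.isPreHardyField.exists_deriv x hx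
        exact ⟨x', hHS _ hx', h⟩
      · exact ⟨0, P.zero_mem, HasGermDeriv.const c⟩
      · exact ⟨1, P.one_mem, hasGermDeriv_idGerm⟩
    | zero => exact ⟨0, P.zero_mem, HasGermDeriv.zero⟩
    | one => exact ⟨0, P.zero_mem, HasGermDeriv.one⟩
    | add x y _ _ h1 h2 =>
      obtain ⟨x', hx', h1⟩ := h1
      obtain ⟨y', hy', h2⟩ := h2
      exact ⟨_, P.add_mem hx' hy', h1.add h2⟩
    | neg x _ h1 =>
      obtain ⟨x', hx', h1⟩ := h1
      exact ⟨_, P.neg_mem hx', h1.neg⟩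
    | mul x y hx hy h1 h2 =>
      obtain ⟨x', hx', h1⟩ := h1
      obtain ⟨y', hy', h2⟩ := h2
      exact ⟨_, P.add_mem (P.mul_mem hx' hy) (P.mul_mem hx hy'), h1.mul h2⟩
  have htr : ∀ x ∈ P, ∀ h, germTranslate h x ∈ P := by
    intro x hx h
    induction hx using Subring.closure_induction with
    | mem x hx =>
      rcases hx with (hx | ⟨c, rfl⟩) | rfl
      · induction x using Germ.inductionOn with | h f => ?_
        exact hHS _ (hH.translate_mem f hx h)
      · exact hcS c
      · exact P.add_mem hidS (hcS h)
    | zero => rw [map_zero]; exact P.zero_mem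
    | one => rw [map_one]; exact P.one_mem
    | add x y _ _ h1 h2 => rw [map_add]; exact P.add_mem h1 h2
    | neg x _ h1 => rw [map_neg]; exact P.neg_mem h1
    | mul x y hx hy h1 h2 => rw [map_mul]; exact P.mul_mem h1 h2
  have hpre := isPreHardyField_quotientSubring P hs hd
  have hle := le_quotientSubring P
  refine ⟨quotientSubring P, M, isHardyField_of_isPreHardyField hpre ?_, hM, ?_,
    hle (hHS _ haH), fun c => hle (hcS c), hle hidS, hlogM⟩
  · rintro x ⟨q, hq, hq0, hxq⟩ h
    refine ⟨germTranslate h q, htr q hq h, ?_, ?_⟩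
    · induction q using Germ.inductionOn with | h g => ?_
      exact (tendsto_atTop_add_const_right _ h tendsto_id).eventually hq0
    · rw [← map_mul]; exact htr _ hxq h
  · rintro x ⟨q, hq, hq0, hxq⟩
    have hq0' : q ≠ 0 := by
      rintro rfl
      obtain ⟨t, ht⟩ := Eventually.exists (f := (atTop : Filter ℝ)) hq0
      exact ht rfl
    obtain ⟨y, hy, h⟩ := hM.exists_inv q (hPM hq) hq0'
    have : x = x * q * y := by rw [mul_assoc, h, mul_one]
    rw [this]
    exact M.mul_mem (hPM hxq) hy

/-! ### Growth of Hardy field functions -/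

/-- A function that eventually stays on one side of every level cannot oscillate: infinitely many
crossings of (a, b) would contradict the alternative at the midpoint. -/
theorem tendsto_of_eventually_le_or_ge {α : Type*} {l : Filter α} [NeBot l] {u : α → ℝ}
    (h : ∀ q : ℝ, (∀ᶠ x in l, u x ≤ q) ∨ ∀ᶠ x in l, q ≤ u x) :
    (∃ L, Tendsto u l (𝓝 L)) ∨ Tendsto u l atTop ∨ Tendsto u l atBot := by
  by_cases h1 : ∀ q : ℝ, ∀ᶠ x in l, q ≤ u x
  · exact Or.inr (Or.inl (tendsto_atTop.2 h1))
  by_cases h2 : ∀ q : ℝ, ∀ᶠ x in l, u x ≤ q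
  · exact Or.inr (Or.inr (tendsto_atBot.2 h2))
  left
  push Not at h1 h2
  obtain ⟨q1, hq1⟩ := h1
  obtain ⟨q2, hq2⟩ := h2
  have hq1 := (h q1).resolve_right (not_eventually.2 (hq1.mono fun x hx => not_le.2 hx))
  have hq2 := (h q2).resolve_left (not_eventually.2 (hq2.mono fun x hx => not_le.2 hx))
  refine tendsto_of_no_upcrossings dense_univ ?_ ⟨q1, hq1⟩ ⟨q2, hq2⟩
  rintro a - b - hab ⟨ha, hb⟩
  rcases h ((a + b) / 2) with h | h
  · obtain ⟨x, h1, h2⟩ := (hb.and_eventually h).exists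
    linarith
  · obtain ⟨x, h1, h2⟩ := (ha.and_eventually h).exists
    linarith

/-- The quotient f/w stays on one side of q because f - q w has constant sign; so it has a limit,
and an infinite one means that f dominates w. -/
theorem IsPreHardyField.tendsto_div {M : Subring RealGerm} (hM : IsPreHardyField M)
    (hc : ∀ c : ℝ, ((fun _ => c : ℝ → ℝ) : RealGerm) ∈ M) {f w : ℝ → ℝ}
    (hf : (f : RealGerm) ∈ M) (hw : (w : RealGerm) ∈ M) (hw0 : ∀ᶠ t in atTop, 0 < w t) :
    (∃ L, Tendsto (fun t => f t / w t) atTop (𝓝 L)) ∨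
      (w =o[atTop] f) := by
  have key : ∀ q : ℝ, (∀ᶠ x in atTop, f x / w x ≤ q) ∨ ∀ᶠ x in atTop, q ≤ f x / w x := by
    intro q
    have hmem : ((fun t => f t - q * w t : ℝ → ℝ) : RealGerm) ∈ M :=
      M.sub_mem hf (M.mul_mem (hc q) hw)
    rcases isSigned_coe.1 (hM.isSigned hmem) with h | h | h
    · right
      filter_upwards [h, hw0] with t h1 h2
      rw [le_div_iff₀ h2]; linarith
    · right
      filter_upwards [h, hw0] with t h1 h2
      rw [le_div_iff₀ h2]; linarith
    · left
      filter_upwards [h, hw0] with t h1 h2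
      rw [div_le_iff₀ h2]; linarith
  have inf : Tendsto (fun t => ‖f t / w t‖) atTop atTop → w =o[atTop] f := by
    intro h
    have h2 : Tendsto (fun t => w t / f t) atTop (𝓝 0) := by
      have := tendsto_inv₀_cobounded.comp (tendsto_norm_atTop_iff_cobounded.1 h)
      refine this.congr fun t => ?_
      simp
    refine (isLittleO_iff_tendsto' ?_).2 h2
    filter_upwards [h.eventually_gt_atTop 0] with t ht h0
    simp [h0] at ht
  rcases tendsto_of_eventually_le_or_ge key with h | h | h
  · exact Or.inl h
  · exact Or.inr (inf (tendsto_norm_atTop_atTop.comp h))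
  · exact Or.inr (inf (tendsto_abs_atBot_atTop.comp h))

theorem eventually_pow_mul_log_pos (d : ℕ) : ∀ᶠ t : ℝ in atTop, 0 < t ^ d * Real.log t := by
  filter_upwards [eventually_gt_atTop 1] with t ht
  exact mul_pos (pow_pos (by linarith) d) (Real.log_pos ht)

theorem idGerm_pow (d : ℕ) : idGerm ^ d = ((fun t => t ^ d : ℝ → ℝ) : RealGerm) := rfl

/-- Descent on the degree. If a/t^d is unbounded, comparison with t^d log t, carried out in M,
selects one of the first three regimes. If it has a limit that is irrational, or if d = 0, the
fourth applies. Otherwise the limit is a rational q, and a - q t^d is o(t^d), so one can continue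
with it. -/
theorem exists_polynomial_isCovered_sub {K M : Subring RealGerm} (hM : IsPreHardyField M)
    (hKM : K ≤ M) (hc : ∀ c : ℝ, ((fun _ => c : ℝ → ℝ) : RealGerm) ∈ K) (hid : idGerm ∈ K)
    (hlog : ((Real.log : ℝ → ℝ) : RealGerm) ∈ M) (d : ℕ) {a : ℝ → ℝ} (ha : (a : RealGerm) ∈ K)
    (had : a =o[atTop] (fun t : ℝ => t ^ d)) :
    ∃ p : Polynomial ℚ, IsCovered (fun t => a t - Polynomial.aeval t p) := by
  induction d generalizing a with
  | zero =>
    -- A function tending to zero belongs to the polynomial regime with d = 0 and α = 0.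
    refine ⟨0, 0, Or.inr (Or.inr (Or.inr ⟨0, Or.inr rfl, ?_⟩))⟩
    simpa using had
  | succ d ih =>
    have hpos : ∀ᶠ t : ℝ in atTop, 0 < t ^ d := by
      filter_upwards [eventually_gt_atTop 0] with t ht using pow_pos ht d
    have hpow : ((fun t => t ^ d : ℝ → ℝ) : RealGerm) ∈ K := by
      rw [← idGerm_pow]; exact K.pow_mem hid d
    rcases hM.tendsto_div (fun c => hKM (hc c)) (hKM ha) (hKM hpow) hpos with ⟨L, hL⟩ | h
    · have hsub : (fun t => a t - L * t ^ d) =o[atTop] (fun t : ℝ => t ^ d) := by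
        refine (isLittleO_iff_tendsto' ?_).2 ?_
        · filter_upwards [hpos] with t ht h0 using absurd h0 ht.ne'
        · have h1 : Tendsto (fun t => a t / t ^ d - L) atTop (𝓝 0) := by
            simpa using hL.sub_const L
          refine h1.congr' ?_
          filter_upwards [hpos] with t ht
          field_simp
      by_cases hLd : Irrational L ∨ d = 0
      · refine ⟨0, d, Or.inr (Or.inr (Or.inr ⟨L, hLd, ?_⟩))⟩
        simpa using hsub
      · have hrat : ∃ q : ℚ, (q : ℝ) = L := by
          by_contra hcon
          exact hLd (Or.inl hcon)
        obtain ⟨q, rfl⟩ := hrat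
        obtain ⟨p, hp⟩ := ih (a := fun t => a t - (q : ℝ) * t ^ d)
          (K.sub_mem ha (K.mul_mem (hc q) hpow)) hsub
        refine ⟨Polynomial.C q * Polynomial.X ^ d + p, ?_⟩
        convert hp using 2 with t
        simp [sub_sub]
    · have hlp : ((fun t => t ^ d * Real.log t : ℝ → ℝ) : RealGerm) ∈ M :=
        M.mul_mem (hKM hpow) hlog
      refine ⟨0, d, ?_⟩
      simp only [map_zero, sub_zero]
      rcases hM.tendsto_div (fun c => hKM (hc c)) (hKM ha) hlp
        (eventually_pow_mul_log_pos d) with ⟨L, hL⟩ | h2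
      · by_cases hL0 : L = 0
        · refine Or.inr (Or.inr (Or.inl ⟨h, ?_⟩))
          refine (isLittleO_iff_tendsto' ?_).2 (hL0 ▸ hL)
          filter_upwards [eventually_pow_mul_log_pos d] with t ht h0 using absurd h0 ht.ne'
        · exact Or.inr (Or.inl ⟨L, hL0, hL⟩)
      · exact Or.inl ⟨h2, had⟩

theorem isBigO_pow_mul_log_of_tendsto {d : ℕ} {a : ℝ → ℝ} {c : ℝ}
    (h : Tendsto (fun t : ℝ => a t / (t ^ d * Real.log t)) atTop (𝓝 c)) :
    a =O[atTop] (fun t : ℝ => t ^ d * Real.log t) := by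
  refine isBigO_of_div_tendsto_nhds ?_ c h
  filter_upwards [eventually_pow_mul_log_pos d] with t ht h0 using absurd h0 ht.ne'

theorem pow_mul_log_isLittleO (d : ℕ) :
    (fun t : ℝ => t ^ d * Real.log t) =o[atTop] (fun t : ℝ => t ^ (d + 1)) := by
  have := (isBigO_refl (fun t : ℝ => t ^ d) atTop).mul_isLittleO Real.isLittleO_log_id_atTop
  simpa [pow_succ] using this

theorem IsCovered.atMostPolynomialGrowth {a : ℝ → ℝ} (h : IsCovered a) :
    AtMostPolynomialGrowth a := by
  obtain ⟨d, h | ⟨c, -, h⟩ | h | ⟨α, -, h⟩⟩ := h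
  · exact ⟨d + 1, h.2⟩
  · exact ⟨d + 1, (isBigO_pow_mul_log_of_tendsto h).trans_isLittleO (pow_mul_log_isLittleO d)⟩
  · exact ⟨d + 1, h.2.trans (pow_mul_log_isLittleO d)⟩
  · refine ⟨d + 1, ?_⟩
    have h1 : (fun t : ℝ => t ^ d) =o[atTop] (fun t : ℝ => t ^ (d + 1)) :=
      isLittleO_pow_pow_atTop_of_lt (Nat.lt_succ_self d)
    have h2 := (h.trans h1).add (h1.const_mul_left α)
    simpa using h2

theorem const_isLittleO_pow {d : ℕ} (hd : d ≠ 0) (c : ℝ) :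
    (fun _ => c) =o[atTop] (fun t : ℝ => t ^ d) :=
  isLittleO_const_left.2 (Or.inr (tendsto_norm_atTop_atTop.comp (tendsto_pow_atTop hd)))

theorem tendsto_pow_mul_log (d : ℕ) : Tendsto (fun t : ℝ => t ^ d * Real.log t) atTop atTop := by
  refine tendsto_atTop_mono' _ ?_ Real.tendsto_log_atTop
  filter_upwards [eventually_ge_atTop 1] with t ht
  exact le_mul_of_one_le_left (Real.log_nonneg ht) (one_le_pow₀ ht)

theorem const_isLittleO_pow_mul_log (d : ℕ) (c : ℝ) :
    (fun _ => c) =o[atTop] (fun t : ℝ => t ^ d * Real.log t) :=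
  isLittleO_const_left.2 (Or.inr (tendsto_norm_atTop_atTop.comp (tendsto_pow_mul_log d)))

theorem const_isBigO_pow (d : ℕ) (c : ℝ) : (fun _ => c) =O[atTop] (fun t : ℝ => t ^ d) := by
  rcases eq_or_ne d 0 with rfl | hd
  · simpa using isBigO_const_const c (one_ne_zero (α := ℝ)) (atTop : Filter ℝ)
  · exact (const_isLittleO_pow hd c).isBigO

/-- Needed because the removed rational polynomial leaves its value at k behind on the progression r
n + k. Only in the polynomial regime with d = 0 is the constant visible, and there it is absorbed
into α. -/
theorem IsCovered.add_const {a : ℝ → ℝ} (h : IsCovered a) (c : ℝ) :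
    IsCovered (fun t => a t + c) := by
  have key : (fun _ : ℝ => c) =o[atTop] a → a =Θ[atTop] (fun t => a t + c) := fun h =>
    (h.right_isTheta_add').trans (isTheta_refl _ _)
  obtain ⟨d, h | ⟨c', hc', h⟩ | h | ⟨α, hα, h⟩⟩ := h
  · refine ⟨d, Or.inl ⟨?_, h.2.add (const_isLittleO_pow (Nat.succ_ne_zero d) c)⟩⟩
    exact h.1.trans_isTheta (key ((const_isLittleO_pow_mul_log d c).trans h.1))
  · refine ⟨d, Or.inr (Or.inl ⟨c', hc', ?_⟩)⟩
    have h2 : Tendsto (fun t : ℝ => c / (t ^ d * Real.log t)) atTop (𝓝 0) :=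
      (tendsto_pow_mul_log d).const_div_atTop c
    simpa [add_div] using h.add h2
  · refine ⟨d, Or.inr (Or.inr (Or.inl ⟨?_, h.2.add (const_isLittleO_pow_mul_log d c)⟩))⟩
    exact h.1.trans_isTheta (key ((const_isBigO_pow d c).trans_isLittleO h.1))
  · rcases eq_or_ne d 0 with rfl | hd
    · refine ⟨0, Or.inr (Or.inr (Or.inr ⟨α + c, Or.inr rfl, ?_⟩))⟩
      simpa using h
    · refine ⟨d, Or.inr (Or.inr (Or.inr ⟨α, hα, ?_⟩))⟩
      refine (h.add (const_isLittleO_pow hd c)).congr_left fun t => ?_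
      ring

/-! ### Restriction to arithmetic progressions -/

section Affine

variable {r k : ℝ}

theorem tendsto_affine (hr : 0 < r) : Tendsto (fun t : ℝ => r * t + k) atTop atTop :=
  tendsto_atTop_add_const_right _ k (tendsto_id.const_mul_atTop hr)

theorem tendsto_affine_div : Tendsto (fun t : ℝ => (r * t + k) / t) atTop (𝓝 r) := by
  have h : Tendsto (fun t : ℝ => r + k / t) atTop (𝓝 (r + 0)) :=
    tendsto_const_nhds.add (tendsto_id.const_div_atTop k)
  rw [add_zero] at h
  refine h.congr' ?_
  filter_upwards [eventually_gt_atTop 0] with t ht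
  field_simp

theorem tendsto_affine_pow_div (d : ℕ) :
    Tendsto (fun t : ℝ => (r * t + k) ^ d / t ^ d) atTop (𝓝 (r ^ d)) := by
  simpa [div_pow] using (tendsto_affine_div (r := r) (k := k)).pow d

theorem tendsto_log_affine_div (hr : 0 < r) :
    Tendsto (fun t : ℝ => Real.log (r * t + k) / Real.log t) atTop (𝓝 1) := by
  have h1 : Tendsto (fun t : ℝ => Real.log ((r * t + k) / t)) atTop (𝓝 (Real.log r)) :=
    ((Real.continuousAt_log hr.ne').tendsto).comp tendsto_affine_div
  have h2 : Tendsto (fun t : ℝ => Real.log ((r * t + k) / t) / Real.log t + 1) atTop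
      (𝓝 (0 + 1)) := (h1.div_atTop Real.tendsto_log_atTop).add_const 1
  rw [zero_add] at h2
  refine h2.congr' ?_
  filter_upwards [eventually_gt_atTop 1, (tendsto_affine (k := k) hr).eventually_gt_atTop 0]
    with t ht ht2
  have := Real.log_pos ht
  rw [Real.log_div ht2.ne' (by linarith)]
  field_simp
  ring

theorem tendsto_affine_pow_mul_log_div (hr : 0 < r) (d : ℕ) :
    Tendsto (fun t : ℝ => ((r * t + k) ^ d * Real.log (r * t + k)) / (t ^ d * Real.log t)) atTop
      (𝓝 (r ^ d)) := by
  have := (tendsto_affine_pow_div (r := r) (k := k) d).mul (tendsto_log_affine_div (k := k) hr)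
  rw [mul_one] at this
  refine this.congr fun t => ?_
  rw [div_mul_div_comm]

theorem isTheta_of_tendsto_div {f g : ℝ → ℝ} {c : ℝ} (hc : c ≠ 0)
    (h : Tendsto (fun t => f t / g t) atTop (𝓝 c)) : f =Θ[atTop] g := by
  have hne := h.eventually_ne hc
  have hg : ∀ᶠ t in atTop, g t ≠ 0 ∧ f t ≠ 0 := by
    filter_upwards [hne] with t ht
    constructor
    · rintro h0; simp [h0] at ht
    · rintro h0; simp [h0] at ht
  refine ⟨isBigO_of_div_tendsto_nhds ?_ c h, isBigO_of_div_tendsto_nhds ?_ c⁻¹ ?_⟩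
  · filter_upwards [hg] with t ht h0 using absurd h0 ht.1
  · filter_upwards [hg] with t ht h0 using absurd h0 ht.2
  · refine (h.inv₀ hc).congr fun t => ?_
    simp

/-- The substitution multiplies t^d by r^d and leaves log t unchanged to leading order. In the
polynomial regime α becomes α r^d, which stays irrational because r is a positive integer. -/
theorem IsCovered.comp_affine {a : ℝ → ℝ} (h : IsCovered a) {r : ℕ} (hr : 0 < r) (k : ℝ) :
    IsCovered (fun t => a (r * t + k)) := by
  have hr' : (0 : ℝ) < r := Nat.cast_pos.2 hr
  have hσ := tendsto_affine (k := k) hr'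
  have hp : ∀ d : ℕ, (fun t : ℝ => (r * t + k) ^ d) =Θ[atTop] (fun t => t ^ d) := fun d =>
    isTheta_of_tendsto_div (pow_pos hr' d).ne' (tendsto_affine_pow_div d)
  have hl : ∀ d : ℕ, (fun t : ℝ => (r * t + k) ^ d * Real.log (r * t + k)) =Θ[atTop]
      (fun t => t ^ d * Real.log t) := fun d =>
    isTheta_of_tendsto_div (pow_pos hr' d).ne' (tendsto_affine_pow_mul_log_div hr' d)
  obtain ⟨d, h | ⟨c', hc', h⟩ | h | ⟨α, hα, h⟩⟩ := h
  · exact ⟨d, Or.inl ⟨(hl d).symm.trans_isLittleO (h.1.comp_tendsto hσ),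
      (h.2.comp_tendsto hσ).trans_isTheta (hp (d + 1))⟩⟩
  · refine ⟨d, Or.inr (Or.inl ⟨c' * r ^ d, mul_ne_zero hc' (pow_pos hr' d).ne', ?_⟩)⟩
    refine ((h.comp hσ).mul (tendsto_affine_pow_mul_log_div (k := k) hr' d)).congr' ?_
    filter_upwards [hσ.eventually (eventually_pow_mul_log_pos d)] with t ht
    simp only [Function.comp]
    rw [div_mul_div_cancel₀ ht.ne']
  · exact ⟨d, Or.inr (Or.inr (Or.inl ⟨(hp d).symm.trans_isLittleO (h.1.comp_tendsto hσ),
      (h.2.comp_tendsto hσ).trans_isTheta (hl d)⟩))⟩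
  · refine ⟨d, Or.inr (Or.inr (Or.inr ⟨α * r ^ d, ?_, ?_⟩))⟩
    · rcases hα with hα | hα
      · left
        have := hα.mul_natCast (m := r ^ d) (pow_pos hr d).ne'
        simpa using this
      · exact Or.inr hα
    · have h1 := (h.comp_tendsto hσ).trans_isTheta (hp d)
      have h2 : (fun t : ℝ => α * ((r * t + k) ^ d - r ^ d * t ^ d)) =o[atTop]
          (fun t => t ^ d) := by
        refine IsLittleO.const_mul_left ?_ α
        refine (isLittleO_iff_tendsto' ?_).2 ?_
        · filter_upwards [eventually_gt_atTop 0] with t ht h0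
          exact absurd h0 (pow_pos ht d).ne'
        · have h3 : Tendsto (fun t : ℝ => (r * t + k) ^ d / t ^ d - (r : ℝ) ^ d) atTop (𝓝 0) := by
            simpa using (tendsto_affine_pow_div (r := (r : ℝ)) (k := k) d).sub_const ((r : ℝ) ^ d)
          refine h3.congr' ?_
          filter_upwards [eventually_gt_atTop 0] with t ht
          field_simp
      refine (h1.add h2).congr_left fun t => ?_
      simp only [Function.comp]
      ring

end Affine

/-- Composition of germs with `t ↦ r t + k`. -/
def germAffine (r : ℝ) (hr : 0 < r) (k : ℝ) : RealGerm →+* RealGerm where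
  toFun x := x.compTendsto (fun t => r * t + k) (tendsto_affine hr)
  map_one' := rfl
  map_zero' := rfl
  map_mul' x y := by
    induction x using Germ.inductionOn with | h u => ?_
    induction y using Germ.inductionOn with | h v => ?_
    rfl
  map_add' x y := by
    induction x using Germ.inductionOn with | h u => ?_
    induction y using Germ.inductionOn with | h v => ?_
    rfl

/-- The image of the whole Hardy field under the substitution is a Hardy field: differentiation
produces a factor r, which the field contains, and a translation by h comes from the translation by
r h. -/
theorem IsHardyFieldFunction.comp_affine {a : ℝ → ℝ} (h : IsHardyFieldFunction a) {r : ℕ}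
    (hr : 0 < r) (k : ℝ) : IsHardyFieldFunction (fun t => a (r * t + k)) := by
  obtain ⟨H, hH, ha⟩ := h
  have hr' : (0 : ℝ) < r := Nat.cast_pos.2 hr
  refine ⟨H.map (germAffine r hr' k), isHardyField_of_isPreHardyField ⟨?_, ?_⟩ ?_,
    ⟨a, ha, rfl⟩⟩
  · rintro _ ⟨x, hx, rfl⟩ h0
    obtain ⟨y, hy, hxy⟩ := hH.isPreHardyField.exists_inv x hx (by
      rintro rfl; exact h0 (map_zero _))
    exact ⟨_, ⟨y, hy, rfl⟩, by rw [← map_mul, hxy, map_one]⟩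
  · rintro _ ⟨x, hx, rfl⟩
    obtain ⟨x', hx', f, f', rfl, rfl, hf⟩ := hH.isPreHardyField.exists_deriv x hx
    refine ⟨_, ⟨(r : RealGerm) * (f' : RealGerm), H.mul_mem (natCast_mem H r) hx', rfl⟩, ?_⟩
    rw [map_mul, map_natCast]
    refine ⟨fun t => f (r * t + k), fun t => r * f' (r * t + k), rfl, rfl, ?_⟩
    filter_upwards [(tendsto_affine (k := k) hr').eventually hf] with t ht
    have h1 : HasDerivAt (fun t : ℝ => (r : ℝ) * t + k) r t := by
      simpa using ((hasDerivAt_id t).const_mul (r : ℝ)).add_const k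
    have := ht.comp t h1
    rw [mul_comm]
    exact this
  · rintro _ ⟨x, hx, rfl⟩ h
    induction x using Germ.inductionOn with | h f => ?_
    refine ⟨_, hH.translate_mem f hx (r * h), ?_⟩
    refine Germ.coe_eq.2 (Eventually.of_forall fun t => ?_)
    simp only [Function.comp]
    congr 1
    ring

/-- For a monomial c t^m the denominator of c works, since it divides (r n + k)^m - k^m whenever it
divides r. For a sum, the product of the two moduli works. -/
theorem exists_forall_aeval_sub_eq_intCast (p : Polynomial ℚ) :
    ∃ r : ℕ, 0 < r ∧ ∀ n k : ℕ, ∃ z : ℤ,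
      p.eval ((r : ℚ) * n + k) - p.eval (k : ℚ) = z := by
  induction p using Polynomial.induction_on' with
  | add p q hp hq =>
    obtain ⟨r, hr, h1⟩ := hp
    obtain ⟨s, hs, h2⟩ := hq
    refine ⟨r * s, Nat.mul_pos hr hs, fun n k => ?_⟩
    obtain ⟨z, hz⟩ := h1 (s * n) k
    obtain ⟨w, hw⟩ := h2 (r * n) k
    refine ⟨z + w, ?_⟩
    push_cast at hz hw ⊢
    rw [← hz, ← hw, Polynomial.eval_add, Polynomial.eval_add]
    rw [show (r : ℚ) * (s * n) = r * s * n by ring, show (s : ℚ) * (r * n) = r * s * n by ring]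
    ring
  | monomial m c =>
    refine ⟨c.den, c.den_pos, fun n k => ?_⟩
    have : (c.den : ℤ) ∣ ((c.den : ℤ) * n + k) ^ m - (k : ℤ) ^ m := by
      refine dvd_trans ?_ (sub_dvd_pow_sub_pow _ _ m)
      exact ⟨n, by ring⟩
    obtain ⟨w, hw⟩ := this
    refine ⟨c.num * w, ?_⟩
    have hw' : ((c.den : ℚ) * n + k) ^ m - (k : ℚ) ^ m = c.den * w := by exact_mod_cast hw
    simp only [Polynomial.eval_monomial]
    rw [← mul_sub, hw', ← mul_assoc, Rat.mul_den_eq_num]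
    push_cast
    ring

theorem IsHardyFieldFunction.sub_polynomial {a : ℝ → ℝ} (h : IsHardyFieldFunction a)
    (p : Polynomial ℚ) : IsHardyFieldFunction (fun t => a t - Polynomial.aeval t p) := by
  obtain ⟨K, M, hK, -, -, ha, hc, hid, -⟩ := h.exists_extension
  suffices h : ((fun t => Polynomial.aeval t p : ℝ → ℝ) : RealGerm) ∈ K from
    ⟨K, hK, K.sub_mem ha h⟩
  induction p using Polynomial.induction_on' with
  | add p q hp hq =>
    have := K.add_mem hp hq
    convert this using 1
    refine Germ.coe_eq.2 (Eventually.of_forall fun t => ?_)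
    simp
  | monomial m c =>
    have := K.mul_mem (hc c) (K.pow_mem hid m)
    convert this using 1
    refine Germ.coe_eq.2 (Eventually.of_forall fun t => ?_)
    simp [Polynomial.aeval_monomial]

theorem IsHardyFieldFunction.add_const {a : ℝ → ℝ} (h : IsHardyFieldFunction a) (c : ℝ) :
    IsHardyFieldFunction (fun t => a t + c) := by
  obtain ⟨K, M, hK, -, -, ha, hc, -, -⟩ := h.exists_extension
  exact ⟨K, hK, K.add_mem ha (hc c)⟩

/-- Every Hardy field function of at most polynomial growth is covered up to a rational
polynomial, and along suitable arithmetic progressions it is covered modulo one. -/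
theorem exists_polynomial_sub_isCovered {a : ℝ → ℝ} (ha : IsHardyFieldFunction a)
    (hpoly : AtMostPolynomialGrowth a) :
    ∃ p : Polynomial ℚ, IsHardyFieldFunction (fun t => a t - Polynomial.aeval t p) ∧
      IsCovered (fun t => a t - Polynomial.aeval t p) := by
  obtain ⟨K, M, hK, hM, hKM, haK, hc, hid, hlog⟩ := ha.exists_extension
  obtain ⟨d, hd⟩ := hpoly
  obtain ⟨p, hp⟩ := exists_polynomial_isCovered_sub hM hKM hc hid hlog d haK hd
  exact ⟨p, ha.sub_polynomial p, hp⟩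

/-- With p the removed polynomial, p(rn + k) ≡ p(k) modulo one for suitable r, so a(rn + k) may be
replaced by (a - p)(rn + k) + p(k), which is covered. The error ε can be taken to be zero, since a -
p is itself covered. -/
theorem exists_covered_subsequences {Y : Type*} (φ : ℝ → Y) (hφ : ∀ x (z : ℤ), φ (x + z) = φ x)
    {a : ℝ → ℝ} (ha : IsHardyFieldFunction a) (hpoly : AtMostPolynomialGrowth a) {b : ℤ → Y}
    (hb : ∀ n : ℕ, 0 < n → b n = φ (a n)) :
    (∃ (p : Polynomial ℚ) (ε a' : ℝ → ℝ),
      (∀ t : ℝ, 0 ≤ t → a t = Polynomial.aeval t p + ε t + a' t) ∧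
      Tendsto ε atTop (𝓝 0) ∧
      IsHardyFieldFunction a' ∧ AtMostPolynomialGrowth a' ∧ IsCovered a') ∧
    ∃ r : ℕ, 0 < r ∧ ∀ k : ℕ, k < r → ∃ ak : ℝ → ℝ,
      IsHardyFieldFunction ak ∧ AtMostPolynomialGrowth ak ∧ IsCovered ak ∧
      ∀ n : ℕ, 0 < n → b ((r : ℤ) * n + k) = φ (ak n) := by
  obtain ⟨p, hp, hcov⟩ := exists_polynomial_sub_isCovered ha hpoly
  refine ⟨⟨p, fun _ => 0, _, fun t _ => by simp, tendsto_const_nhds, hp,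
    hcov.atMostPolynomialGrowth, hcov⟩, ?_⟩
  obtain ⟨r, hr, hz⟩ := exists_forall_aeval_sub_eq_intCast p
  refine ⟨r, hr, fun k _ => ?_⟩
  have hcov' := (hcov.comp_affine hr (k : ℝ)).add_const (Polynomial.aeval (k : ℝ) p)
  refine ⟨_, (hp.comp_affine hr (k : ℝ)).add_const (Polynomial.aeval (k : ℝ) p),
    hcov'.atMostPolynomialGrowth, hcov', fun n hn => ?_⟩
  have h1 := hb (r * n + k) (by positivity)
  push_cast at h1
  obtain ⟨z, hz⟩ := hz n k
  have haev : ∀ x : ℚ, Polynomial.aeval (x : ℝ) p = ((p.eval x : ℚ) : ℝ) := by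
    intro x
    rw [← eq_ratCast (algebraMap ℚ ℝ) x, Polynomial.aeval_algebraMap_apply]
    simp
  have h2 : Polynomial.aeval ((r : ℝ) * n + k) p - Polynomial.aeval (k : ℝ) p = z := by
    have e1 := haev ((r : ℚ) * n + k)
    have e2 := haev k
    push_cast at e1 e2
    rw [e1, e2, ← Rat.cast_sub, hz, Rat.cast_intCast]
  rw [h1, ← hφ (a ((r : ℝ) * n + k) - Polynomial.aeval ((r : ℝ) * n + k) p +
    Polynomial.aeval (k : ℝ) p) z, ← h2]
  congr 1
  ring

/-! ### Rings of sequences coming from Hardy fields -/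

/-- A shift invariant ring of sequences of eventually constant sign, which contains the constants
and the identity. -/
structure IsHardySequenceRing (R : Subring (ℕ → ℝ)) : Prop where
  shift_mem : ∀ f ∈ R, (fun n => f (n + 1)) ∈ R
  natCast_mem : (fun n : ℕ => (n : ℝ)) ∈ R
  const_mem : ∀ c : ℝ, (fun _ => c) ∈ R
  eventually_sign : ∀ f ∈ R, (∀ᶠ n in atTop, 0 < f n) ∨ (∀ᶠ n in atTop, f n = 0) ∨
    ∀ᶠ n in atTop, f n < 0

/-- The restrictions to `ℕ` of the functions whose germ belongs to `K`. -/
def sequenceRing (K : Subring RealGerm) : Subring (ℕ → ℝ) where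
  carrier := {s | ∃ f : ℝ → ℝ, (f : RealGerm) ∈ K ∧ ∀ n : ℕ, s n = f n}
  mul_mem' := by
    rintro s t ⟨f, hf, hs⟩ ⟨g, hg, ht⟩
    exact ⟨f * g, K.mul_mem hf hg, fun n => by simp [hs, ht]⟩
  one_mem' := ⟨1, K.one_mem, fun n => rfl⟩
  add_mem' := by
    rintro s t ⟨f, hf, hs⟩ ⟨g, hg, ht⟩
    exact ⟨f + g, K.add_mem hf hg, fun n => by simp [hs, ht]⟩
  zero_mem' := ⟨0, K.zero_mem, fun n => rfl⟩
  neg_mem' := by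
    rintro s ⟨f, hf, hs⟩
    exact ⟨-f, K.neg_mem hf, fun n => by simp [hs]⟩

theorem IsHardyFieldFunction.exists_sequenceRing {a : ℝ → ℝ} (ha : IsHardyFieldFunction a) :
    ∃ R : Subring (ℕ → ℝ), IsHardySequenceRing R ∧ (fun n : ℕ => a n) ∈ R := by
  obtain ⟨K, -, hK, -, -, haK, hc, hid, -⟩ := ha.exists_extension
  refine ⟨sequenceRing K, ⟨?_, ⟨_, hid, fun n => rfl⟩, fun c => ⟨_, hc c, fun n => rfl⟩, ?_⟩,
    ⟨a, haK, fun n => rfl⟩⟩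
  · rintro s ⟨f, hf, hs⟩
    exact ⟨_, hK.translate_mem f hf 1, fun n => by simp [hs]⟩
  · rintro s ⟨f, hf, hs⟩
    have hcast := tendsto_natCast_atTop_atTop (R := ℝ)
    simp only [hs]
    rcases isSigned_coe.1 (hK.isPreHardyField.isSigned hf) with h | h | h
    · exact Or.inl (hcast.eventually h)
    · exact Or.inr (Or.inl (hcast.eventually h))
    · exact Or.inr (Or.inr (hcast.eventually h))

namespace IsHardySequenceRing

variable {R : Subring (ℕ → ℝ)} {f : ℕ → ℝ}

theorem fwdDiff_mem (hR : IsHardySequenceRing R) (hf : f ∈ R) : fwdDiff 1 f ∈ R :=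
  R.sub_mem (hR.shift_mem f hf) hf

theorem fwdDiff_iter_mem (hR : IsHardySequenceRing R) (hf : f ∈ R) (k : ℕ) :
    (fwdDiff 1)^[k] f ∈ R := by
  induction k with
  | zero => exact hf
  | succ k ih => rw [Function.iterate_succ_apply']; exact hR.fwdDiff_mem ih

theorem const_mul_mem (hR : IsHardySequenceRing R) (hf : f ∈ R) (c : ℝ) :
    (fun n => c * f n) ∈ R :=
  R.mul_mem (hR.const_mem c) hf

theorem natCast_mul_mem (hR : IsHardySequenceRing R) (hf : f ∈ R) :
    (fun n : ℕ => n * f n) ∈ R :=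
  R.mul_mem hR.natCast_mem hf

theorem nonneg_or_nonpos (hR : IsHardySequenceRing R) (hf : f ∈ R) :
    (∀ᶠ n in atTop, 0 ≤ f n) ∨ ∀ᶠ n in atTop, f n ≤ 0 := by
  rcases hR.eventually_sign f hf with h | h | h
  · exact Or.inl (h.mono fun n hn => hn.le)
  · exact Or.inl (h.mono fun n hn => hn.ge)
  · exact Or.inr (h.mono fun n hn => hn.le)

theorem tendsto (hR : IsHardySequenceRing R) (hf : f ∈ R) :
    (∃ L, Tendsto f atTop (𝓝 L)) ∨ Tendsto f atTop atTop ∨ Tendsto f atTop atBot := by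
  refine tendsto_of_eventually_le_or_ge fun q => ?_
  rcases hR.nonneg_or_nonpos (R.sub_mem hf (hR.const_mem q)) with h | h
  · exact Or.inr (h.mono fun n hn => sub_nonneg.1 hn)
  · exact Or.inl (h.mono fun n hn => sub_nonpos.1 hn)

end IsHardySequenceRing

/-! ### Comparison of sequences through their differences -/

theorem fwdDiff_one_apply {G : Type*} [AddCommGroup G] (f : ℕ → G) (n : ℕ) :
    fwdDiff 1 f n = f (n + 1) - f n := rfl

/-- Discrete l'Hôpital rule: the inequality between differences telescopes from a fixed N, and the
contributions of N are absorbed because W → ∞. -/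
theorem isBigO_of_fwdDiff {f W : ℕ → ℝ} (hW : Tendsto W atTop atTop)
    (hW0 : ∀ᶠ n in atTop, 0 ≤ fwdDiff 1 W n) (h : fwdDiff 1 f =O[atTop] fwdDiff 1 W) :
    f =O[atTop] W := by
  obtain ⟨C, hC0, hC⟩ := h.exists_pos
  obtain ⟨N, hN⟩ := eventually_atTop.1 (hW0.and hC.bound)
  have key : ∀ n ≥ N, |f n - f N| ≤ C * (W n - W N) := by
    intro n hn
    induction n, hn using Nat.le_induction with
    | base => simp
    | succ n hn ih =>
      obtain ⟨h1, h2⟩ := hN n hn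
      rw [Real.norm_eq_abs, Real.norm_eq_abs, abs_of_nonneg h1] at h2
      simp only [fwdDiff_one_apply] at h1 h2
      calc |f (n + 1) - f N| = |(f (n + 1) - f n) + (f n - f N)| := by ring_nf
        _ ≤ |f (n + 1) - f n| + |f n - f N| := abs_add_le _ _
        _ ≤ C * (W (n + 1) - W n) + C * (W n - W N) := add_le_add h2 ih
        _ = C * (W (n + 1) - W N) := by ring
  refine IsBigO.of_bound (C + 1) ?_
  filter_upwards [eventually_ge_atTop N, hW.eventually_ge_atTop (|f N| + C * |W N|),
    hW.eventually_ge_atTop 0] with n hn h1 h2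
  rw [Real.norm_eq_abs, Real.norm_eq_abs, abs_of_nonneg h2]
  have h3 := key n hn
  have h4 : |f n| ≤ |f n - f N| + |f N| := by
    calc |f n| = |(f n - f N) + f N| := by ring_nf
      _ ≤ _ := abs_add_le _ _
  have h5 : -(C * W N) ≤ C * |W N| := by
    rw [← mul_neg]; exact mul_le_mul_of_nonneg_left (neg_le_abs _) hC0.le
  nlinarith

theorem isLittleO_of_fwdDiff {f W : ℕ → ℝ} (hW : Tendsto W atTop atTop)
    (hW0 : ∀ᶠ n in atTop, 0 ≤ fwdDiff 1 W n) (h : fwdDiff 1 f =o[atTop] fwdDiff 1 W) :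
    f =o[atTop] W := by
  rw [isLittleO_iff]
  intro ε hε
  obtain ⟨N, hN⟩ := eventually_atTop.1 (hW0.and (isLittleO_iff.1 h (half_pos hε)))
  have key : ∀ n ≥ N, |f n - f N| ≤ ε / 2 * (W n - W N) := by
    intro n hn
    induction n, hn using Nat.le_induction with
    | base => simp
    | succ n hn ih =>
      obtain ⟨h1, h2⟩ := hN n hn
      rw [Real.norm_eq_abs, Real.norm_eq_abs, abs_of_nonneg h1] at h2
      simp only [fwdDiff_one_apply] at h1 h2
      calc |f (n + 1) - f N| = |(f (n + 1) - f n) + (f n - f N)| := by ring_nf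
        _ ≤ |f (n + 1) - f n| + |f n - f N| := abs_add_le _ _
        _ ≤ ε / 2 * (W (n + 1) - W n) + ε / 2 * (W n - W N) := add_le_add h2 ih
        _ = ε / 2 * (W (n + 1) - W N) := by ring
  filter_upwards [eventually_ge_atTop N,
    hW.eventually_ge_atTop ((|f N| + ε / 2 * |W N|) / (ε / 2)),
    hW.eventually_ge_atTop 0] with n hn h1 h2
  rw [Real.norm_eq_abs, Real.norm_eq_abs, abs_of_nonneg h2]
  rw [div_le_iff₀ (half_pos hε)] at h1
  have h3 := key n hn
  have h4 : |f n| ≤ |f n - f N| + |f N| := by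
    calc |f n| = |(f n - f N) + f N| := by ring_nf
      _ ≤ _ := abs_add_le _ _
  have h5 : -(ε / 2 * W N) ≤ ε / 2 * |W N| := by
    rw [← mul_neg]; exact mul_le_mul_of_nonneg_left (neg_le_abs _) (half_pos hε).le
  nlinarith

/-- Provides the divergence needed in order to exchange the roles of f and W in the discrete
l'Hôpital rule. -/
theorem tendsto_atTop_of_fwdDiff {f W : ℕ → ℝ} (hW : Tendsto W atTop atTop)
    (hf : ∀ᶠ n in atTop, 0 ≤ fwdDiff 1 f n) (h : fwdDiff 1 W =O[atTop] fwdDiff 1 f) :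
    Tendsto f atTop atTop := by
  obtain ⟨C, hC0, hC⟩ := h.exists_pos
  obtain ⟨N, hN⟩ := eventually_atTop.1 (hf.and hC.bound)
  have key : ∀ n ≥ N, W n - W N ≤ C * (f n - f N) := by
    intro n hn
    induction n, hn using Nat.le_induction with
    | base => simp
    | succ n hn ih =>
      obtain ⟨h1, h2⟩ := hN n hn
      rw [Real.norm_eq_abs, Real.norm_eq_abs, abs_of_nonneg h1] at h2
      have h3 := (le_abs_self _).trans h2
      simp only [fwdDiff_one_apply] at h3
      linarith
  have h1 : Tendsto (fun n => C⁻¹ * (W n - W N) + f N) atTop atTop :=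
    tendsto_atTop_add_const_right _ _ ((tendsto_atTop_add_const_right _ (-W N) hW).const_mul_atTop
      (inv_pos.2 hC0))
  refine tendsto_atTop_mono' _ ?_ h1
  filter_upwards [eventually_ge_atTop N] with n hn
  have := mul_le_mul_of_nonneg_left (key n hn) (inv_pos.2 hC0).le
  rw [← mul_assoc, inv_mul_cancel₀ hC0.ne', one_mul] at this
  linarith

theorem fwdDiff_neg_fun {G : Type*} [AddCommGroup G] (f : ℕ → G) :
    fwdDiff 1 (-f) = -fwdDiff 1 f := by
  ext n; simp [fwdDiff_one_apply]; abel

/-- Lower bounds for differences also sum up, but only if f is eventually monotone, so that no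
cancellation occurs; hence the sign hypothesis, which holds in Hardy rings. The decreasing case
follows by passing to -f. -/
theorem isBigO_of_fwdDiff_right {f W : ℕ → ℝ} (hW : Tendsto W atTop atTop)
    (hf : (∀ᶠ n in atTop, 0 ≤ fwdDiff 1 f n) ∨ ∀ᶠ n in atTop, fwdDiff 1 f n ≤ 0)
    (h : fwdDiff 1 W =O[atTop] fwdDiff 1 f) : W =O[atTop] f := by
  rcases hf with hf | hf
  · exact isBigO_of_fwdDiff (tendsto_atTop_of_fwdDiff hW hf h) hf h
  · have hf' : ∀ᶠ n in atTop, 0 ≤ fwdDiff 1 (-f) n := by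
      filter_upwards [hf] with n hn
      rw [fwdDiff_neg_fun]; simpa using hn
    have h' : fwdDiff 1 W =O[atTop] fwdDiff 1 (-f) := by
      rw [fwdDiff_neg_fun]; exact h.neg_right
    exact (isBigO_of_fwdDiff (tendsto_atTop_of_fwdDiff hW hf' h') hf' h').of_neg_right

theorem isLittleO_of_fwdDiff_right {f W : ℕ → ℝ} (hW : Tendsto W atTop atTop)
    (hf : (∀ᶠ n in atTop, 0 ≤ fwdDiff 1 f n) ∨ ∀ᶠ n in atTop, fwdDiff 1 f n ≤ 0)
    (h : fwdDiff 1 W =o[atTop] fwdDiff 1 f) : W =o[atTop] f := by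
  rcases hf with hf | hf
  · exact isLittleO_of_fwdDiff (tendsto_atTop_of_fwdDiff hW hf h.isBigO) hf h
  · have hf' : ∀ᶠ n in atTop, 0 ≤ fwdDiff 1 (-f) n := by
      filter_upwards [hf] with n hn
      rw [fwdDiff_neg_fun]; simpa using hn
    have h' : fwdDiff 1 W =o[atTop] fwdDiff 1 (-f) := by
      rw [fwdDiff_neg_fun]; exact h.neg_right
    exact (isLittleO_of_fwdDiff (tendsto_atTop_of_fwdDiff hW hf' h'.isBigO) hf' h').of_neg_right

/-! ### The scales of powers and of powers times the logarithm -/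

/-- A scale of sequences, each of which has differences comparable to the preceding one. -/
structure IsGrowthScale (W : ℕ → ℕ → ℝ) : Prop where
  tendsto : ∀ j, Tendsto (W (j + 1)) atTop atTop
  isTheta : ∀ j, fwdDiff 1 (W (j + 1)) =Θ[atTop] W j
  nonneg : ∀ j, ∀ᶠ n in atTop, 0 ≤ fwdDiff 1 (W (j + 1)) n

namespace IsGrowthScale

variable {W : ℕ → ℕ → ℝ} {R : Subring (ℕ → ℝ)} {f : ℕ → ℝ}

/-- The discrete l'Hôpital rule, applied k times, moves k steps up the scale. -/
theorem isBigO (hW : IsGrowthScale W) (k j : ℕ) (h : (fwdDiff 1)^[k] f =O[atTop] W j) :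
    f =O[atTop] W (j + k) := by
  induction k generalizing f with
  | zero => exact h
  | succ k ih =>
    exact isBigO_of_fwdDiff (hW.tendsto _) (hW.nonneg _)
      ((ih (f := fwdDiff 1 f) h).trans (hW.isTheta _).2)

theorem isLittleO (hW : IsGrowthScale W) (k j : ℕ) (h : (fwdDiff 1)^[k] f =o[atTop] W j) :
    f =o[atTop] W (j + k) := by
  induction k generalizing f with
  | zero => exact h
  | succ k ih =>
    exact isLittleO_of_fwdDiff (hW.tendsto _) (hW.nonneg _)
      ((ih (f := fwdDiff 1 f) h).trans_isBigO (hW.isTheta _).2)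

theorem isBigO_right (hW : IsGrowthScale W) (hR : IsHardySequenceRing R) (hf : f ∈ R) (k j : ℕ)
    (h : W j =O[atTop] (fwdDiff 1)^[k] f) : W (j + k) =O[atTop] f := by
  induction k generalizing f with
  | zero => exact h
  | succ k ih =>
    exact isBigO_of_fwdDiff_right (hW.tendsto _) (hR.nonneg_or_nonpos (hR.fwdDiff_mem hf))
      ((hW.isTheta _).1.trans (ih (hR.fwdDiff_mem hf) h))

theorem isLittleO_right (hW : IsGrowthScale W) (hR : IsHardySequenceRing R) (hf : f ∈ R)
    (k j : ℕ) (h : W j =o[atTop] (fwdDiff 1)^[k] f) : W (j + k) =o[atTop] f := by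
  induction k generalizing f with
  | zero => exact h
  | succ k ih =>
    exact isLittleO_of_fwdDiff_right (hW.tendsto _) (hR.nonneg_or_nonpos (hR.fwdDiff_mem hf))
      ((hW.isTheta _).1.trans_isLittleO (ih (hR.fwdDiff_mem hf) h))

theorem not_isLittleO_self (hW : IsGrowthScale W) (j : ℕ) : ¬ W (j + 1) =o[atTop] W (j + 1) := by
  refine isLittleO_irrefl ?_
  exact ((hW.tendsto j).eventually_ne_atTop 0).frequently

end IsGrowthScale

/-- The scale of the powers. -/
def powScale (j n : ℕ) : ℝ := (n : ℝ) ^ j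

/-- The scale `1 / n, log n, n log n, n ^ 2 log n, …`. -/
noncomputable def logScale : ℕ → ℕ → ℝ
  | 0, n => (n : ℝ)⁻¹
  | j + 1, n => (n : ℝ) ^ j * Real.log n

theorem pow_le_fwdDiff_pow (j n : ℕ) : (n : ℝ) ^ j ≤ ((n : ℝ) + 1) ^ (j + 1) - (n : ℝ) ^ (j + 1) := by
  have h : (n : ℝ) ^ j ≤ ((n : ℝ) + 1) ^ j := pow_le_pow_left₀ (Nat.cast_nonneg n) (by linarith) j
  have h1 : (0 : ℝ) ≤ n := Nat.cast_nonneg n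
  rw [pow_succ, pow_succ]
  nlinarith

theorem fwdDiff_pow_le (j : ℕ) {n : ℕ} (hn : 1 ≤ n) :
    ((n : ℝ) + 1) ^ (j + 1) - (n : ℝ) ^ (j + 1) ≤ 2 ^ (j + 1) * (n : ℝ) ^ j := by
  have h1 : (1 : ℝ) ≤ n := Nat.one_le_cast.2 hn
  induction j with
  | zero => simp
  | succ j ih =>
    have h2 : ((n : ℝ) + 1) ^ (j + 1) ≤ (2 * n) ^ (j + 1) :=
      pow_le_pow_left₀ (by linarith) (by linarith) _
    rw [mul_pow] at h2
    calc ((n : ℝ) + 1) ^ (j + 1 + 1) - (n : ℝ) ^ (j + 1 + 1)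
        = (((n : ℝ) + 1) ^ (j + 1) - (n : ℝ) ^ (j + 1)) * n + ((n : ℝ) + 1) ^ (j + 1) := by ring
      _ ≤ 2 ^ (j + 1) * (n : ℝ) ^ j * n + 2 ^ (j + 1) * (n : ℝ) ^ (j + 1) := by
          gcongr
      _ = 2 ^ (j + 1 + 1) * (n : ℝ) ^ (j + 1) := by ring

theorem isGrowthScale_powScale : IsGrowthScale powScale where
  tendsto j := (tendsto_pow_atTop (Nat.succ_ne_zero j)).comp tendsto_natCast_atTop_atTop
  isTheta j := by
    constructor
    · refine IsBigO.of_bound (2 ^ (j + 1)) ?_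
      filter_upwards [eventually_ge_atTop 1] with n hn
      simp only [fwdDiff_one_apply, powScale, Nat.cast_add, Nat.cast_one, Real.norm_eq_abs]
      rw [abs_of_nonneg ((pow_nonneg (Nat.cast_nonneg n) j).trans (pow_le_fwdDiff_pow j n)),
        abs_of_nonneg (pow_nonneg (Nat.cast_nonneg n) j)]
      exact fwdDiff_pow_le j hn
    · refine IsBigO.of_bound 1 (Eventually.of_forall fun n => ?_)
      simp only [fwdDiff_one_apply, powScale, Nat.cast_add, Nat.cast_one, Real.norm_eq_abs]
      rw [one_mul, abs_of_nonneg (pow_nonneg (Nat.cast_nonneg n) j)]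
      exact (pow_le_fwdDiff_pow j n).trans (le_abs_self _)
  nonneg j := Eventually.of_forall fun n => by
    simp only [fwdDiff_one_apply, powScale, Nat.cast_add, Nat.cast_one]
    exact (pow_nonneg (Nat.cast_nonneg n) j).trans (pow_le_fwdDiff_pow j n)

theorem log_succ_sub_log_bounds {n : ℕ} (hn : 1 ≤ n) :
    1 / 2 * (n : ℝ)⁻¹ ≤ Real.log ((n : ℝ) + 1) - Real.log n ∧
      Real.log ((n : ℝ) + 1) - Real.log n ≤ (n : ℝ)⁻¹ := by
  have h1 : (1 : ℝ) ≤ n := Nat.one_le_cast.2 hn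
  have h0 : (0 : ℝ) < n := by linarith
  rw [← Real.log_div (by linarith) h0.ne']
  constructor
  · refine le_trans ?_ (Real.one_sub_inv_le_log_of_pos (by positivity))
    rw [inv_div, one_sub_div (by linarith : (n : ℝ) + 1 ≠ 0), ← div_eq_mul_inv, div_div,
      div_le_div_iff₀ (by linarith) (by linarith)]
    linarith
  · refine (Real.log_le_sub_one_of_pos (by positivity)).trans (le_of_eq ?_)
    field_simp
    ring

/-- The discrete product rule gives a main term of size n^j log n and a term of size n^j; for n ≥ 3
one has log n ≥ 1 and the second is absorbed by the first. -/
theorem fwdDiff_logScale_bounds (j : ℕ) {n : ℕ} (hn : 3 ≤ n) :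
    (n : ℝ) ^ j * Real.log n ≤ fwdDiff 1 (logScale (j + 2)) n ∧
      fwdDiff 1 (logScale (j + 2)) n ≤ (2 ^ (j + 2) + 1) * ((n : ℝ) ^ j * Real.log n) := by
  have h1 : (3 : ℝ) ≤ n := by exact_mod_cast hn
  have h0 : (0 : ℝ) < n := by linarith
  have hl : 1 ≤ Real.log n := by
    rw [Real.le_log_iff_exp_le h0]
    exact Real.exp_one_lt_d9.le.trans (by linarith)
  obtain ⟨l1, l2⟩ := log_succ_sub_log_bounds (n := n) (by omega)
  have hn' : (n : ℝ)⁻¹ ≤ 1 := inv_le_one_of_one_le₀ (by linarith)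
  have p1 := pow_le_fwdDiff_pow j n
  have p2 := fwdDiff_pow_le j (n := n) (by omega)
  have hp : (0 : ℝ) < (n : ℝ) ^ j := pow_pos h0 j
  have hi : 0 < (n : ℝ)⁻¹ := inv_pos.2 h0
  have hexp : fwdDiff 1 (logScale (j + 2)) n =
      (((n : ℝ) + 1) ^ (j + 1) - (n : ℝ) ^ (j + 1)) * Real.log ((n : ℝ) + 1) +
        (n : ℝ) ^ (j + 1) * (Real.log ((n : ℝ) + 1) - Real.log n) := by
    simp only [fwdDiff_one_apply, logScale, Nat.cast_add, Nat.cast_one]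
    ring
  rw [hexp]
  constructor
  · have : (n : ℝ) ^ j * Real.log n ≤
        (((n : ℝ) + 1) ^ (j + 1) - (n : ℝ) ^ (j + 1)) * Real.log ((n : ℝ) + 1) :=
      mul_le_mul p1 (by linarith) (by linarith) (hp.le.trans p1)
    have h3 : 0 ≤ (n : ℝ) ^ (j + 1) * (Real.log ((n : ℝ) + 1) - Real.log n) :=
      mul_nonneg (by positivity) (by linarith)
    linarith
  · have h2 : (((n : ℝ) + 1) ^ (j + 1) - (n : ℝ) ^ (j + 1)) * Real.log ((n : ℝ) + 1) ≤
        2 ^ (j + 1) * (n : ℝ) ^ j * (2 * Real.log n) :=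
      mul_le_mul p2 (by linarith) (by linarith) (by positivity)
    have h3 : (n : ℝ) ^ (j + 1) * (Real.log ((n : ℝ) + 1) - Real.log n) ≤
        (n : ℝ) ^ (j + 1) * (n : ℝ)⁻¹ := mul_le_mul_of_nonneg_left l2 (by positivity)
    have h4 : (n : ℝ) ^ (j + 1) * (n : ℝ)⁻¹ = (n : ℝ) ^ j := by
      rw [pow_succ, mul_assoc, mul_inv_cancel₀ h0.ne', mul_one]
    have h5 : (n : ℝ) ^ j ≤ (n : ℝ) ^ j * Real.log n := le_mul_of_one_le_right hp.le hl
    calc _ ≤ 2 ^ (j + 1) * (n : ℝ) ^ j * (2 * Real.log n) + (n : ℝ) ^ j * Real.log n := by linarith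
      _ = _ := by ring

theorem isGrowthScale_logScale : IsGrowthScale logScale where
  tendsto j := (tendsto_pow_mul_log j).comp tendsto_natCast_atTop_atTop
  isTheta j := by
    rcases j with _ | j
    · constructor
      · refine IsBigO.of_bound 1 ?_
        filter_upwards [eventually_ge_atTop 1] with n hn
        obtain ⟨l1, l2⟩ := log_succ_sub_log_bounds hn
        have hi : 0 ≤ (n : ℝ)⁻¹ := by positivity
        simp only [fwdDiff_one_apply, logScale, Nat.cast_add, Nat.cast_one, Real.norm_eq_abs,
          pow_zero, one_mul]
        rw [abs_of_nonneg (by linarith), abs_of_nonneg hi]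
        exact l2
      · refine IsBigO.of_bound 2 ?_
        filter_upwards [eventually_ge_atTop 1] with n hn
        obtain ⟨l1, l2⟩ := log_succ_sub_log_bounds hn
        have hi : 0 ≤ (n : ℝ)⁻¹ := by positivity
        simp only [fwdDiff_one_apply, logScale, Nat.cast_add, Nat.cast_one, Real.norm_eq_abs,
          pow_zero, one_mul]
        rw [abs_of_nonneg (a := _ - _) (by linarith), abs_of_nonneg hi]
        linarith
    · constructor
      · refine IsBigO.of_bound (2 ^ (j + 2) + 1) ?_
        filter_upwards [eventually_ge_atTop 3] with n hn
        obtain ⟨l1, l2⟩ := fwdDiff_logScale_bounds j hn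
        have h0 : 0 ≤ (n : ℝ) ^ j * Real.log n := by positivity
        rw [Real.norm_eq_abs, abs_of_nonneg (h0.trans l1), logScale, Real.norm_eq_abs,
          abs_of_nonneg h0]
        exact l2
      · refine IsBigO.of_bound 1 ?_
        filter_upwards [eventually_ge_atTop 3] with n hn
        obtain ⟨l1, l2⟩ := fwdDiff_logScale_bounds j hn
        have h0 : 0 ≤ (n : ℝ) ^ j * Real.log n := by positivity
        rw [Real.norm_eq_abs, Real.norm_eq_abs, abs_of_nonneg (h0.trans l1), logScale,
          abs_of_nonneg h0, one_mul]
        exact l1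
  nonneg j := by
    rcases j with _ | j
    · filter_upwards [eventually_ge_atTop 1] with n hn
      obtain ⟨l1, l2⟩ := log_succ_sub_log_bounds hn
      have hi : 0 ≤ (n : ℝ)⁻¹ := by positivity
      simp only [fwdDiff_one_apply, logScale, Nat.cast_add, Nat.cast_one, pow_zero, one_mul]
      linarith
    · filter_upwards [eventually_ge_atTop 3] with n hn
      obtain ⟨l1, l2⟩ := fwdDiff_logScale_bounds j hn
      have h0 : 0 ≤ (n : ℝ) ^ j * Real.log n := by positivity
      exact h0.trans l1

/-! ### Differences of sequences in the growth regimes -/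

section Regimes

variable {R : Subring (ℕ → ℝ)} {s : ℕ → ℝ} {d : ℕ}

theorem one_isBigO_of_tendsto {f : ℕ → ℝ} (h : (∃ L, L ≠ 0 ∧ Tendsto f atTop (𝓝 L)) ∨
    Tendsto f atTop atTop ∨ Tendsto f atTop atBot) :
    powScale 0 =O[atTop] f := by
  have key : ∀ c > 0, (∀ᶠ n in atTop, c ≤ ‖f n‖) → powScale 0 =O[atTop] f := by
    intro c hc h
    refine IsBigO.of_bound c⁻¹ ?_
    filter_upwards [h] with n hn
    simp only [powScale, pow_zero, norm_one]
    rw [inv_mul_eq_div, le_div_iff₀ hc]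
    linarith
  rcases h with ⟨L, hL, h⟩ | h | h
  · refine key (‖L‖ / 2) (by positivity) ?_
    have := h.norm.eventually (lt_mem_nhds (half_lt_self (norm_pos_iff.2 hL)))
    exact this.mono fun n hn => hn.le
  · exact key 1 one_pos ((tendsto_abs_atTop_atTop.comp h).eventually_ge_atTop 1)
  · exact key 1 one_pos ((tendsto_abs_atBot_atTop.comp h).eventually_ge_atTop 1)

/-- The difference has a limit in [-∞, ∞]. A limit other than zero keeps it away from zero, and
summing d times would give n^d = O(s). -/
theorem tendsto_fwdDiff_iter_of_isLittleO (hR : IsHardySequenceRing R) (hs : s ∈ R)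
    (h : s =o[atTop] powScale d) : Tendsto ((fwdDiff 1)^[d] s) atTop (𝓝 0) := by
  by_contra hcon
  have h1 : powScale 0 =O[atTop] (fwdDiff 1)^[d] s := by
    refine one_isBigO_of_tendsto ?_
    rcases hR.tendsto (hR.fwdDiff_iter_mem hs d) with ⟨L, hL⟩ | h2
    · refine Or.inl ⟨L, ?_, hL⟩
      rintro rfl
      exact hcon hL
    · exact Or.inr h2
  have h2 := isGrowthScale_powScale.isBigO_right hR hs d 0 h1
  rw [zero_add] at h2
  refine isLittleO_irrefl ?_ (h2.trans_isLittleO h)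
  refine Eventually.frequently ?_
  filter_upwards [eventually_ge_atTop 1] with n hn
  exact pow_ne_zero _ (Nat.cast_ne_zero.2 (by omega))

/-- A finite limit of Δ^d s would give s = O(n^d) after summing d times. -/
theorem tendsto_fwdDiff_iter_of_pow_isLittleO (hR : IsHardySequenceRing R) (hs : s ∈ R)
    (h : powScale d =o[atTop] s) : Tendsto ((fwdDiff 1)^[d] s) atTop atTop ∨
      Tendsto ((fwdDiff 1)^[d] s) atTop atBot := by
  refine (hR.tendsto (hR.fwdDiff_iter_mem hs d)).resolve_left ?_
  rintro ⟨L, hL⟩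
  have h1 : (fwdDiff 1)^[d] s =O[atTop] powScale 0 := by
    have := hL.isBigO_one ℝ
    refine this.trans (isBigO_of_le _ fun n => ?_)
    simp [powScale]
  have h2 := isGrowthScale_powScale.isBigO d 0 h1
  rw [zero_add] at h2
  refine isLittleO_irrefl ?_ (h.trans_isBigO h2)
  refine Eventually.frequently ?_
  filter_upwards [eventually_ge_atTop 1] with n hn
  exact pow_ne_zero _ (Nat.cast_ne_zero.2 (by omega))

theorem inv_isBigO_iff {f : ℕ → ℝ} : logScale 0 =O[atTop] f ↔
    powScale 0 =O[atTop] fun n => n * f n := by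
  rw [isBigO_iff, isBigO_iff]
  refine exists_congr fun c => eventually_congr ?_
  filter_upwards [eventually_ge_atTop 1] with n hn
  have h0 : (0 : ℝ) < n := Nat.cast_pos.2 (by omega)
  simp only [logScale, powScale, pow_zero, norm_one, norm_mul, norm_inv, RCLike.norm_natCast]
  rw [inv_le_iff_one_le_mul₀' h0]
  ring_nf

theorem isBigO_inv_iff {f : ℕ → ℝ} : f =O[atTop] logScale 0 ↔
    (fun n => n * f n) =O[atTop] powScale 0 := by
  rw [isBigO_iff, isBigO_iff]
  refine exists_congr fun c => eventually_congr ?_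
  filter_upwards [eventually_ge_atTop 1] with n hn
  have h0 : (0 : ℝ) < n := Nat.cast_pos.2 (by omega)
  simp only [logScale, powScale, pow_zero, norm_one, norm_mul, norm_inv, RCLike.norm_natCast]
  rw [← div_eq_mul_inv, le_div_iff₀ h0, mul_one, mul_comm]

theorem isLittleO_inv_iff {f : ℕ → ℝ} : f =o[atTop] logScale 0 ↔
    Tendsto (fun n : ℕ => n * f n) atTop (𝓝 0) := by
  have : ∀ᶠ n : ℕ in atTop, logScale 0 n = 0 → f n = 0 := by
    filter_upwards [eventually_ge_atTop 1] with n hn h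
    have h0 : (0 : ℝ) < n := Nat.cast_pos.2 (by omega)
    exact absurd h (inv_pos.2 h0).ne'
  rw [isLittleO_iff_tendsto' this]
  refine tendsto_congr fun n => ?_
  simp [logScale, mul_comm]

theorem inv_isLittleO_of_tendsto {f : ℕ → ℝ} (h : Tendsto (fun n : ℕ => (n : ℝ) * f n) atTop atTop ∨
    Tendsto (fun n : ℕ => (n : ℝ) * f n) atTop atBot) : logScale 0 =o[atTop] f := by
  have h' : Tendsto (fun n : ℕ => ‖(n : ℝ) * f n‖) atTop atTop := by
    rcases h with h | h
    · exact tendsto_abs_atTop_atTop.comp h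
    · exact tendsto_abs_atBot_atTop.comp h
  rw [isLittleO_iff]
  intro c hc
  filter_upwards [h'.eventually_ge_atTop c⁻¹, eventually_ge_atTop 1] with n h1 hn
  have h0 : (0 : ℝ) < n := Nat.cast_pos.2 (by omega)
  simp only [logScale, norm_mul, norm_inv, RCLike.norm_natCast] at h1 ⊢
  rw [inv_le_iff_one_le_mul₀' h0]
  rw [inv_le_iff_one_le_mul₀' hc] at h1
  linarith

/-- If nΔ^(d+1) s had a finite limit, then Δ^(d+1) s = O(1/n), and summing d + 1 times would give s
= O(n^d log n). -/
theorem tendsto_mul_fwdDiff_of_log_isLittleO (hR : IsHardySequenceRing R) (hs : s ∈ R)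
    (h : logScale (d + 1) =o[atTop] s) :
    Tendsto (fun n : ℕ => (n : ℝ) * (fwdDiff 1)^[d + 1] s n) atTop atTop ∨
      Tendsto (fun n : ℕ => (n : ℝ) * (fwdDiff 1)^[d + 1] s n) atTop atBot := by
  refine (hR.tendsto (hR.natCast_mul_mem (hR.fwdDiff_iter_mem hs (d + 1)))).resolve_left ?_
  rintro ⟨L, hL⟩
  have h1 : (fwdDiff 1)^[d + 1] s =O[atTop] logScale 0 := by
    rw [isBigO_inv_iff]
    exact (hL.isBigO_one ℝ).trans (isBigO_of_le _ fun n => by simp [powScale])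
  have h2 := isGrowthScale_logScale.isBigO (d + 1) 0 h1
  rw [zero_add] at h2
  exact isGrowthScale_logScale.not_isLittleO_self d (h.trans_isBigO h2)

/-- The limit exists in [-∞, ∞]; zero would give s = o(n^d log n), and an infinite limit would give
n^d log n = o(s). The value of c is never needed, only that it is finite and non-zero. -/
theorem tendsto_mul_fwdDiff_of_isTheta_log (hR : IsHardySequenceRing R) (hs : s ∈ R)
    (h : s =Θ[atTop] logScale (d + 1)) :
    ∃ c, c ≠ 0 ∧ Tendsto (fun n : ℕ => (n : ℝ) * (fwdDiff 1)^[d + 1] s n) atTop (𝓝 c) := by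
  rcases hR.tendsto (hR.natCast_mul_mem (hR.fwdDiff_iter_mem hs (d + 1))) with ⟨L, hL⟩ | h2
  · refine ⟨L, ?_, hL⟩
    rintro rfl
    have h2 := isGrowthScale_logScale.isLittleO (d + 1) 0 (isLittleO_inv_iff.2 hL)
    rw [zero_add] at h2
    exact isGrowthScale_logScale.not_isLittleO_self d (h.2.trans_isLittleO h2)
  · have h3 := isGrowthScale_logScale.isLittleO_right hR hs (d + 1) 0
      (inv_isLittleO_of_tendsto h2)
    rw [zero_add] at h3
    exact absurd (h3.trans_isBigO h.1) (isGrowthScale_logScale.not_isLittleO_self d)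

theorem tendsto_mul_fwdDiff_of_isLittleO_log (hR : IsHardySequenceRing R) (hs : s ∈ R)
    (h : s =o[atTop] logScale (d + 1)) :
    Tendsto (fun n : ℕ => (n : ℝ) * (fwdDiff 1)^[d + 1] s n) atTop (𝓝 0) := by
  by_contra hcon
  have h1 : logScale 0 =O[atTop] (fwdDiff 1)^[d + 1] s := by
    rw [inv_isBigO_iff]
    refine one_isBigO_of_tendsto ?_
    rcases hR.tendsto (hR.natCast_mul_mem (hR.fwdDiff_iter_mem hs (d + 1))) with ⟨L, hL⟩ | h2
    · refine Or.inl ⟨L, ?_, hL⟩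
      rintro rfl
      exact hcon hL
    · exact Or.inr h2
  have h2 := isGrowthScale_logScale.isBigO_right hR hs (d + 1) 0 h1
  rw [zero_add] at h2
  exact isGrowthScale_logScale.not_isLittleO_self d (h2.trans_isLittleO h)

theorem fwdDiff_iter_comp_natCast {G : Type*} [AddCommGroup G] (f : ℝ → G) (k n : ℕ) :
    (fwdDiff 1)^[k] (fun m : ℕ => f m) n = (fwdDiff (1 : ℝ))^[k] f n := by
  induction k generalizing n with
  | zero => rfl
  | succ k ih =>
    rw [Function.iterate_succ_apply', Function.iterate_succ_apply', fwdDiff, fwdDiff, ih, ih]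
    push_cast
    rfl

/-- The d-th difference of α n^d is exactly d! α, and the remainder is again a Hardy sequence, so
its d-th difference tends to zero. -/
theorem tendsto_fwdDiff_iter_of_polynomial (hR : IsHardySequenceRing R) (hs : s ∈ R) {α : ℝ}
    (h : (fun n => s n - α * (n : ℝ) ^ d) =o[atTop] powScale d) :
    Tendsto ((fwdDiff 1)^[d] s) atTop (𝓝 (d.factorial * α)) := by
  have hmem : (fun n : ℕ => α * (n : ℝ) ^ d) ∈ R :=
    hR.const_mul_mem (R.pow_mem hR.natCast_mem d) α
  have h1 := tendsto_fwdDiff_iter_of_isLittleO hR (R.sub_mem hs hmem) h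
  have h2 : ∀ n, (fwdDiff 1)^[d] (fun n : ℕ => α * (n : ℝ) ^ d) n = d.factorial * α := by
    intro n
    rw [show (fun n : ℕ => α * (n : ℝ) ^ d) = α • (fun n : ℕ => (n : ℝ) ^ d) from rfl,
      fwdDiff_iter_const_smul, Pi.smul_apply,
      fwdDiff_iter_comp_natCast (fun x : ℝ => x ^ d), fwdDiff_iter_eq_factorial]
    simp [mul_comm]
  have h3 := h1.add_const (d.factorial * α)
  rw [zero_add] at h3
  refine h3.congr fun n => ?_
  rw [← h2 n, ← Pi.add_apply, ← fwdDiff_iter_add, sub_add_cancel]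

end Regimes

/-! ### The character of the circle and averages -/

/-- The character `x ↦ e(x)` of `ℝ / ℤ`. -/
noncomputable def circleChar (x : UnitAddCircle) : ℂ := AddCircle.toCircle x

theorem circleChar_coe (x : ℝ) : circleChar x = Complex.exp (2 * Real.pi * Complex.I * x) := by
  rw [circleChar, AddCircle.toCircle_apply_mk, Circle.coe_exp]
  congr 1
  push_cast
  ring

theorem circleChar_add (x y : UnitAddCircle) :
    circleChar (x + y) = circleChar x * circleChar y := by
  simp [circleChar, AddCircle.toCircle_add]

theorem circleChar_neg (x : UnitAddCircle) :
    circleChar (-x) = (starRingEnd ℂ) (circleChar x) := by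
  rw [circleChar, AddCircle.toCircle_neg, Circle.coe_inv_eq_conj, circleChar]

theorem circleChar_sub (x y : UnitAddCircle) :
    circleChar (x - y) = circleChar x * (starRingEnd ℂ) (circleChar y) := by
  rw [sub_eq_add_neg, circleChar_add, circleChar_neg]

@[simp] theorem circleChar_zero : circleChar 0 = 1 := by
  simp [circleChar, AddCircle.toCircle_zero]

@[simp] theorem norm_circleChar (x : UnitAddCircle) : ‖circleChar x‖ = 1 := Circle.norm_coe _

theorem continuous_circleChar : Continuous circleChar :=
  continuous_subtype_val.comp AddCircle.continuous_toCircle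

theorem injective_circleChar : Function.Injective circleChar :=
  Subtype.val_injective.comp (AddCircle.injective_toCircle one_ne_zero)

theorem circleChar_zsmul (l : ℤ) (x : UnitAddCircle) : circleChar (l • x) = fourier l x := by
  rw [fourier_apply, circleChar]

theorem circleChar_sum {ι : Type*} (s : Finset ι) (f : ι → UnitAddCircle) :
    circleChar (∑ i ∈ s, f i) = ∏ i ∈ s, circleChar (f i) := by
  induction s using Finset.cons_induction with
  | empty => simp
  | cons a s ha ih => rw [Finset.sum_cons, Finset.prod_cons, circleChar_add, ih]

/-! ### Cesàro averages and van der Corput's theorem -/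

/-- The average of `z` over `{1, …, N}`. -/
noncomputable def seqAverage (z : ℕ → ℂ) (N : ℕ) : ℂ := (∑ m ∈ Finset.Icc 1 N, z m) / N

theorem sum_Icc_one_eq {M : Type*} [AddCommMonoid M] (z : ℕ → M) (N : ℕ) :
    ∑ m ∈ Finset.Icc 1 N, z m = ∑ m ∈ Finset.range N, z (m + 1) := by
  rw [Finset.range_eq_Ico, Finset.sum_Ico_add' z 0 N 1]
  rfl

theorem seqAverage_add (z w : ℕ → ℂ) (N : ℕ) :
    seqAverage (fun n => z n + w n) N = seqAverage z N + seqAverage w N := by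
  simp [seqAverage, Finset.sum_add_distrib, add_div]

theorem seqAverage_sub (z w : ℕ → ℂ) (N : ℕ) :
    seqAverage (fun n => z n - w n) N = seqAverage z N - seqAverage w N := by
  simp [seqAverage, Finset.sum_sub_distrib, sub_div]

theorem seqAverage_const_mul (c : ℂ) (z : ℕ → ℂ) (N : ℕ) :
    seqAverage (fun n => c * z n) N = c * seqAverage z N := by
  simp [seqAverage, ← Finset.mul_sum, mul_div_assoc]

theorem seqAverage_sum {ι : Type*} (s : Finset ι) (z : ι → ℕ → ℂ) (N : ℕ) :
    seqAverage (fun n => ∑ i ∈ s, z i n) N = ∑ i ∈ s, seqAverage (z i) N := by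
  simp only [seqAverage]
  rw [Finset.sum_comm, Finset.sum_div]

theorem seqAverage_conj (z : ℕ → ℂ) (N : ℕ) :
    seqAverage (fun n => (starRingEnd ℂ) (z n)) N = (starRingEnd ℂ) (seqAverage z N) := by
  simp [seqAverage, map_div₀, map_sum]

theorem norm_seqAverage_le {z : ℕ → ℂ} (hz : ∀ n, ‖z n‖ ≤ 1) (N : ℕ) : ‖seqAverage z N‖ ≤ 1 := by
  rw [seqAverage, norm_div, RCLike.norm_natCast]
  refine div_le_one_of_le₀ ?_ (Nat.cast_nonneg N)
  refine (norm_sum_le _ _).trans ((Finset.sum_le_card_nsmul _ _ 1 fun n _ => hz n).trans ?_)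
  simp

theorem tendsto_seqAverage {z : ℕ → ℂ} {l : ℂ} (h : Tendsto z atTop (𝓝 l)) :
    Tendsto (seqAverage z) atTop (𝓝 l) := by
  have := ((tendsto_add_atTop_iff_nat 1).2 h).cesaro_smul
  refine this.congr fun N => ?_
  rw [seqAverage, sum_Icc_one_eq, div_eq_inv_mul, Complex.real_smul]
  push_cast
  rfl

/-- A shift by one changes the sum by two boundary terms, hence the average by at most 2/N. -/
theorem tendsto_seqAverage_shift_sub {z : ℕ → ℂ} (hz : ∀ n, ‖z n‖ ≤ 1) (h : ℕ) :
    Tendsto (fun N => seqAverage (fun n => z (n + h)) N - seqAverage z N) atTop (𝓝 0) := by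
  induction h with
  | zero => simp
  | succ h ih =>
    have h1 : Tendsto (fun N : ℕ => (2 : ℝ) / N) atTop (𝓝 0) :=
      tendsto_natCast_atTop_atTop.const_div_atTop 2
    have h2 : Tendsto (fun N => seqAverage (fun n => z (n + (h + 1))) N -
        seqAverage (fun n => z (n + h)) N) atTop (𝓝 0) := by
      refine squeeze_zero_norm (fun N => ?_) h1
      rw [← seqAverage_sub, seqAverage, norm_div, RCLike.norm_natCast, sum_Icc_one_eq]
      have : ∑ m ∈ Finset.range N, (z (m + 1 + (h + 1)) - z (m + 1 + h)) =
          z (N + 1 + h) - z (0 + 1 + h) := by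
        rw [← Finset.sum_range_sub (fun m => z (m + 1 + h))]
        refine Finset.sum_congr rfl fun m _ => ?_
        congr 2
        ring
      rw [this]
      gcongr
      exact (norm_sub_le _ _).trans (by linarith [hz (N + 1 + h), hz (0 + 1 + h)])
    simpa using h2.add ih

/-- Van der Corput's difference theorem. -/
theorem tendsto_seqAverage_of_differences {z : ℕ → ℂ} (hz : ∀ n, ‖z n‖ ≤ 1)
    (hd : ∀ h : ℕ, 1 ≤ h → Tendsto (seqAverage fun n => z (n + h) * (starRingEnd ℂ) (z n)) atTop
      (𝓝 0)) : Tendsto (seqAverage z) atTop (𝓝 0) := by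
  have hzz : ∀ i j n : ℕ, ‖z (n + i) * (starRingEnd ℂ) (z (n + j))‖ ≤ 1 := by
    intro i j n
    rw [norm_mul, RCLike.norm_conj]
    exact mul_le_one₀ (hz _) (norm_nonneg _) (hz _)
  have hlt : ∀ i j : ℕ, j < i → Tendsto (seqAverage fun n =>
      z (n + i) * (starRingEnd ℂ) (z (n + j))) atTop (𝓝 0) := by
    intro i j hij
    have h1 := tendsto_seqAverage_shift_sub (fun n => hzz (i - j) 0 n) j
    have h2 := h1.add (hd (i - j) (by omega))
    rw [zero_add] at h2
    refine h2.congr fun N => ?_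
    simp only [add_zero, sub_add_cancel]
    congr 1
    funext n
    rw [show n + j + (i - j) = n + i by omega]
  have hne : ∀ i j : ℕ, i ≠ j → Tendsto (seqAverage fun n =>
      z (n + i) * (starRingEnd ℂ) (z (n + j))) atTop (𝓝 0) := by
    intro i j hij
    rcases lt_or_gt_of_ne hij with h | h
    · have h1 := (Complex.continuous_conj.tendsto 0).comp (hlt j i h)
      rw [map_zero] at h1
      refine h1.congr fun N => ?_
      simp only [Function.comp]
      rw [← seqAverage_conj]
      congr 1
      ext n
      simp [mul_comm]
    · exact hlt i j h
  rw [tendsto_zero_iff_norm_tendsto_zero, Metric.tendsto_nhds]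
  intro ε hε
  -- The diagonal terms below contribute 1/H, which this choice makes at most ε²/8.
  obtain ⟨H, hH⟩ := exists_nat_gt (8 / ε ^ 2)
  have hH0 : (0 : ℝ) < H := lt_trans (by positivity) hH
  have hHne : (H : ℂ) ≠ 0 := by exact_mod_cast hH0.ne'
  -- Averaging over a window of fixed length H does not change the limit of the means. Expanding
  -- |w|² then leaves H diagonal terms, bounded by 1, and correlations of distinct shifts, which
  -- vanish in the limit.
  set w : ℕ → ℂ := fun n => (H : ℂ)⁻¹ * ∑ i ∈ Finset.range H, z (n + i) with hw
  have hwz : Tendsto (fun N => seqAverage w N - seqAverage z N) atTop (𝓝 0) := by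
    have h1 : Tendsto (fun N => ∑ i ∈ Finset.range H, (H : ℂ)⁻¹ *
        (seqAverage (fun n => z (n + i)) N - seqAverage z N)) atTop
        (𝓝 (∑ i ∈ Finset.range H, (H : ℂ)⁻¹ * 0)) :=
      tendsto_finsetSum _ fun i _ => (tendsto_seqAverage_shift_sub hz i).const_mul _
    simp only [mul_zero, Finset.sum_const_zero] at h1
    refine h1.congr fun N => ?_
    rw [hw, seqAverage_const_mul, seqAverage_sum, ← Finset.mul_sum, Finset.sum_sub_distrib,
      mul_sub, Finset.sum_const, Finset.card_range, nsmul_eq_mul, ← mul_assoc (H : ℂ)⁻¹,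
      inv_mul_cancel₀ hHne, one_mul]
  have hww : ∀ᶠ N in atTop, ‖seqAverage (fun n => w n * (starRingEnd ℂ) (w n)) N‖ ≤ ε ^ 2 / 4 := by
    have hb : ∀ i j : ℕ, ∀ᶠ N in atTop, ‖seqAverage (fun n =>
        z (n + i) * (starRingEnd ℂ) (z (n + j))) N‖ ≤ ε ^ 2 / 8 + if i = j then 1 else 0 := by
      intro i j
      by_cases hij : i = j
      · refine Eventually.of_forall fun N => (norm_seqAverage_le (hzz i j) N).trans ?_
        simp only [hij, if_true]
        linarith [sq_nonneg ε]
      · filter_upwards [(hne i j hij).norm.eventually_lt_const (u := ε ^ 2 / 8)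
          (by rw [norm_zero]; positivity)] with N hN
        simpa [hij] using hN.le
    have hb' : ∀ᶠ N in atTop, ∀ i ∈ Finset.range H, ∀ j ∈ Finset.range H, ‖seqAverage (fun n =>
        z (n + i) * (starRingEnd ℂ) (z (n + j))) N‖ ≤ ε ^ 2 / 8 + if i = j then 1 else 0 := by
      rw [Filter.eventually_all_finset]
      intro i _
      rw [Filter.eventually_all_finset]
      intro j _
      exact hb i j
    filter_upwards [hb'] with N hN
    have he : seqAverage (fun n => w n * (starRingEnd ℂ) (w n)) N = (H : ℂ)⁻¹ ^ 2 *
        ∑ i ∈ Finset.range H, ∑ j ∈ Finset.range H,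
          seqAverage (fun n => z (n + i) * (starRingEnd ℂ) (z (n + j))) N := by
      simp only [← seqAverage_sum]
      rw [← seqAverage_const_mul]
      congr 1
      ext n
      simp only [hw, map_mul, map_inv₀, map_natCast, map_sum]
      rw [← Finset.sum_mul_sum]
      ring
    rw [he, norm_mul, norm_pow, norm_inv, RCLike.norm_natCast]
    have hs : ‖∑ i ∈ Finset.range H, ∑ j ∈ Finset.range H,
        seqAverage (fun n => z (n + i) * (starRingEnd ℂ) (z (n + j))) N‖ ≤
        H * (H * (ε ^ 2 / 8)) + H := by
      refine (norm_sum_le _ _).trans ?_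
      have : ∀ i ∈ Finset.range H, ‖∑ j ∈ Finset.range H,
          seqAverage (fun n => z (n + i) * (starRingEnd ℂ) (z (n + j))) N‖ ≤
          H * (ε ^ 2 / 8) + 1 := by
        intro i hi
        refine (norm_sum_le _ _).trans ((Finset.sum_le_sum (hN i hi)).trans ?_)
        rw [Finset.sum_add_distrib, Finset.sum_ite_eq, if_pos hi]
        simp
      refine (Finset.sum_le_sum this).trans (le_of_eq ?_)
      rw [Finset.sum_const, Finset.card_range, nsmul_eq_mul]
      ring
    calc (H : ℝ)⁻¹ ^ 2 * _ ≤ (H : ℝ)⁻¹ ^ 2 * (H * (H * (ε ^ 2 / 8)) + H) := by gcongr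
      _ = ε ^ 2 / 8 + (H : ℝ)⁻¹ := by field_simp
      _ ≤ ε ^ 2 / 8 + ε ^ 2 / 8 := by
        gcongr
        rw [inv_le_comm₀ hH0 (by positivity), inv_div]
        exact hH.le
      _ = ε ^ 2 / 4 := by ring
  -- Cauchy–Schwarz.
  have hCS : ∀ N, ‖seqAverage w N‖ ^ 2 ≤ ‖seqAverage (fun n => w n * (starRingEnd ℂ) (w n)) N‖ := by
    intro N
    rcases Nat.eq_zero_or_pos N with rfl | hN
    · simp [seqAverage]
    have hN' : (0 : ℝ) < N := Nat.cast_pos.2 hN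
    have h1 : seqAverage (fun n => w n * (starRingEnd ℂ) (w n)) N =
        (((∑ m ∈ Finset.Icc 1 N, ‖w m‖ ^ 2) / N : ℝ) : ℂ) := by
      rw [seqAverage]
      push_cast
      congr 1
      refine Finset.sum_congr rfl fun m _ => ?_
      rw [Complex.mul_conj']
    rw [h1, Complex.norm_real, Real.norm_of_nonneg (by positivity), seqAverage, norm_div,
      RCLike.norm_natCast, div_pow]
    have h2 : ‖∑ m ∈ Finset.Icc 1 N, w m‖ ^ 2 ≤ N * ∑ m ∈ Finset.Icc 1 N, ‖w m‖ ^ 2 := by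
      calc ‖∑ m ∈ Finset.Icc 1 N, w m‖ ^ 2 ≤ (∑ m ∈ Finset.Icc 1 N, ‖w m‖) ^ 2 := by
            gcongr; exact norm_sum_le _ _
        _ ≤ _ := by
            have := sq_sum_le_card_mul_sum_sq (s := Finset.Icc 1 N) (f := fun m => ‖w m‖)
            simpa using this
    rw [div_le_div_iff₀ (by positivity) hN']
    nlinarith
  filter_upwards [hww, hwz.norm.eventually_lt_const (u := ε / 2) (by rw [norm_zero]; positivity)]
    with N h1 h2
  rw [dist_zero_right, norm_norm]
  have h3 : ‖seqAverage w N‖ ≤ ε / 2 := by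
    refine abs_le_of_sq_le_sq' ?_ (by positivity) |>.2
    calc ‖seqAverage w N‖ ^ 2 ≤ _ := hCS N
      _ ≤ _ := h1
      _ = (ε / 2) ^ 2 := by ring
  calc ‖seqAverage z N‖ = ‖seqAverage w N - (seqAverage w N - seqAverage z N)‖ := by ring_nf
    _ ≤ ‖seqAverage w N‖ + ‖seqAverage w N - seqAverage z N‖ := norm_sub_le _ _
    _ < ε := by linarith

theorem tendsto_seqAverage_zero_of_sum_Ico {z : ℕ → ℂ} (hz : ∀ n, ‖z n‖ ≤ 1) (n₀ : ℕ)
    (h : ∀ ε > 0, ∀ᶠ N : ℕ in atTop, ‖∑ n ∈ Finset.Ico n₀ N, z n‖ ≤ ε * N) :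
    Tendsto (seqAverage z) atTop (𝓝 0) := by
  rw [tendsto_zero_iff_norm_tendsto_zero, Metric.tendsto_nhds]
  intro ε hε
  filter_upwards [h (ε / 3) (by positivity), eventually_gt_atTop 0, eventually_ge_atTop (n₀ + 1),
    tendsto_natCast_atTop_atTop.eventually_ge_atTop (((n₀ : ℝ) + 2) / (ε / 3))] with N h1 h2 h3 h4
  have hN : (0 : ℝ) < N := Nat.cast_pos.2 h2
  rw [div_le_iff₀ (by positivity)] at h4
  have hsplit : ∑ m ∈ Finset.Icc 1 N, z m = ∑ m ∈ Finset.Ico 0 n₀, z m + ∑ m ∈ Finset.Ico n₀ N, z m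
      + z N - z 0 := by
    rw [Finset.sum_Ico_consecutive _ (Nat.zero_le _) (by omega), ← Finset.range_eq_Ico,
      ← Finset.sum_range_succ, Finset.sum_range_succ', sum_Icc_one_eq]
    ring
  have h5 : ‖∑ m ∈ Finset.Icc 1 N, z m‖ ≤ n₀ + ε / 3 * N + 1 + 1 := by
    rw [hsplit]
    refine (norm_sub_le _ _).trans (add_le_add ((norm_add_le _ _).trans (add_le_add
      ((norm_add_le _ _).trans (add_le_add ?_ h1)) (hz _))) (hz _))
    refine (norm_sum_le _ _).trans ((Finset.sum_le_card_nsmul _ _ 1 fun n _ => hz n).trans ?_)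
    simp
  rw [dist_zero_right, norm_norm, seqAverage, norm_div, RCLike.norm_natCast, div_lt_iff₀ hN]
  nlinarith

/-! ### The inequality of Kuzmin and Landau -/

/-- Jordan's inequality sin x ≥ 2x/π on [0, π/2], together with the symmetry θ ↦ 1 - θ. -/
theorem two_mul_le_sin_pi_mul {δ θ : ℝ} (hδ : 0 < δ) (h1 : δ ≤ θ) (h2 : θ ≤ 1 - δ) :
    2 * δ ≤ Real.sin (Real.pi * θ) := by
  have hpi := Real.pi_pos
  have key : ∀ x : ℝ, δ ≤ x → x ≤ 1 / 2 → 2 * δ ≤ Real.sin (Real.pi * x) := by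
    intro x hx1 hx2
    have := Real.mul_le_sin (x := Real.pi * x) (by positivity [hδ.trans_le hx1]) (by nlinarith)
    rw [← mul_assoc, div_mul_cancel₀ _ hpi.ne'] at this
    linarith
  rcases le_total θ (1 / 2) with h | h
  · exact key θ h1 h
  · have := key (1 - θ) (by linarith) (by linarith)
    rwa [show Real.pi * (1 - θ) = Real.pi - Real.pi * θ by ring, Real.sin_pi_sub] at this

theorem cot_sub_cot_nonneg {x y : ℝ} (hx : 0 < x) (hxy : x ≤ y) (hy : y < Real.pi) :
    Real.cos y / Real.sin y ≤ Real.cos x / Real.sin x := by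
  have hsx := Real.sin_pos_of_pos_of_lt_pi hx (hxy.trans_lt hy)
  have hsy := Real.sin_pos_of_pos_of_lt_pi (hx.trans_le hxy) hy
  rw [div_le_div_iff₀ hsy hsx]
  have := Real.sin_nonneg_of_nonneg_of_le_pi (sub_nonneg.2 hxy) (by linarith)
  rw [Real.sin_sub] at this
  linarith

/-- This is 1/(1 - e(θ)) = 1/2 + (i/2) cot(πθ). The constant real part is what makes the variation
of this kernel a variation of the cotangent alone. -/
theorem circleChar_kernel_identity {θ : ℝ} (hs : Real.sin (Real.pi * θ) ≠ 0) :
    (1 / 2 + (Real.cos (Real.pi * θ) / Real.sin (Real.pi * θ) : ℝ) / 2 * Complex.I) *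
      (1 - circleChar θ) = 1 := by
  have h1 : circleChar θ = (Real.cos (Real.pi * θ) + Real.sin (Real.pi * θ) * Complex.I) ^ 2 := by
    rw [circleChar_coe, Complex.ofReal_cos, Complex.ofReal_sin, ← Complex.exp_mul_I, ← Complex.exp_nat_mul]
    congr 1
    push_cast
    ring
  have h2 : (Real.cos (Real.pi * θ) : ℂ) ^ 2 = 1 - (Real.sin (Real.pi * θ) : ℂ) ^ 2 := by
    have := Real.sin_sq_add_cos_sq (Real.pi * θ)
    rw [eq_sub_iff_add_eq, add_comm]
    exact_mod_cast this
  rw [h1]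
  have hs' : (Real.sin (Real.pi * θ) : ℂ) ≠ 0 := by exact_mod_cast hs
  generalize Real.sin (Real.pi * θ) = s at *
  generalize Real.cos (Real.pi * θ) = c at *
  push_cast
  field_simp
  linear_combination ((s : ℂ) - c * Complex.I) * h2 +
    (-(s : ℂ) ^ 3 - 2 * s * c ^ 2 - c * s ^ 2 * Complex.I) * Complex.I_sq

/-- With θ_n the increment of f minus k, each term is ζ_n (e(f(n)) - e(f(n+1))), where ζ_n = 1/(1 -
e(θ_n)). Sum by parts: the ζ_n lie on a vertical line and move monotonically along it, because the
increments decrease, so their total variation telescopes and is controlled by the end points. These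
are O(1/δ), as θ_n stays at distance δ from the integers. -/
theorem norm_sum_circleChar_le {f : ℕ → ℝ} {m : ℕ} {δ : ℝ} (hδ : 0 < δ) (k : ℤ)
    (h1 : ∀ n < m, k + δ ≤ f (n + 1) - f n) (h2 : ∀ n < m, f (n + 1) - f n ≤ k + 1 - δ)
    (h3 : ∀ n, n + 1 < m → f (n + 2) - f (n + 1) ≤ f (n + 1) - f n) :
    ‖∑ n ∈ Finset.range m, circleChar (f n)‖ ≤ 2 / δ := by
  rcases m with _ | m
  · simp; positivity
  have hδ2 : δ ≤ 1 / 2 := by linarith [h1 0 (Nat.succ_pos m), h2 0 (Nat.succ_pos m)]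
  have hpi := Real.pi_pos
  set θ : ℕ → ℝ := fun n => f (n + 1) - f n - k with hθ
  set κ : ℕ → ℝ := fun n => Real.cos (Real.pi * θ n) / Real.sin (Real.pi * θ n) with hκ
  set ζ : ℕ → ℂ := fun n => 1 / 2 + (κ n : ℝ) / 2 * Complex.I with hζ
  set E : ℕ → ℂ := fun n => circleChar (f n) with hE
  have hsin : ∀ n ≤ m, 2 * δ ≤ Real.sin (Real.pi * θ n) := fun n hn =>
    two_mul_le_sin_pi_mul hδ (by linarith [h1 n (by omega)]) (by linarith [h2 n (by omega)])
  have hκb : ∀ n ≤ m, |κ n| ≤ 1 / (2 * δ) := by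
    intro n hn
    have := hsin n hn
    rw [hκ, abs_div, abs_of_pos (a := Real.sin _) (by linarith)]
    exact div_le_div₀ zero_le_one (Real.abs_cos_le_one _) (by linarith) this
  have hζb : ∀ n ≤ m, ‖ζ n‖ ≤ 1 / (2 * δ) := by
    intro n hn
    have h4 : ‖ζ n‖ ≤ 1 / 2 + |κ n| / 2 := by
      refine (norm_add_le _ _).trans (le_of_eq ?_)
      simp
    have h5 : (1 : ℝ) ≤ 1 / (2 * δ) := by
      rw [le_div_iff₀ (by positivity)]; linarith
    linarith [hκb n hn]
  have hid : ∀ n ≤ m, E n = ζ n * (E n - E (n + 1)) := by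
    intro n hn
    have h4 := circleChar_kernel_identity (θ := θ n) (by linarith [hsin n hn])
    have h5 : E (n + 1) = E n * circleChar (θ n) := by
      simp only [hE, hθ]
      rw [← circleChar_add]
      congr 1
      rw [← AddCircle.coe_add, show f n + (f (n + 1) - f n - k) = f (n + 1) - k by ring,
        AddCircle.coe_sub]
      have : ((k : ℝ) : UnitAddCircle) = 0 := by
        rw [AddCircle.coe_eq_zero_iff]
        exact ⟨k, by simp⟩
      rw [this, sub_zero]
    rw [h5]
    linear_combination (-E n) * h4
  have hmono : ∀ n, n + 1 ≤ m → κ n ≤ κ (n + 1) := by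
    intro n hn
    refine cot_sub_cot_nonneg ?_ ?_ ?_
    · have := h1 (n + 1) (by omega)
      have : 0 < θ (n + 1) := by simp only [hθ]; linarith
      positivity
    · have := h3 n (by omega)
      have : θ (n + 1) ≤ θ n := by simp only [hθ]; linarith
      gcongr
    · have := h2 n (by omega)
      have : θ n < 1 := by simp only [hθ]; linarith
      nlinarith
  -- Summation by parts in inductive form: with the boundary term ζ_n E(n+1) included, passing from
  -- n to n + 1 adds only (ζ_(n+1) - ζ_n) E(n+1).
  have key : ∀ n ≤ m, ‖∑ i ∈ Finset.range (n + 1), E i + ζ n * E (n + 1)‖ ≤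
      1 / (2 * δ) + (κ n - κ 0) / 2 := by
    intro n hn
    induction n with
    | zero =>
      have : ∑ i ∈ Finset.range (0 + 1), E i + ζ 0 * E (0 + 1) = ζ 0 * E 0 := by
        rw [Finset.sum_range_one]
        linear_combination hid 0 hn
      rw [this, norm_mul, hE, norm_circleChar]
      simpa using hζb 0 hn
    | succ n ih =>
      have e1 : ∑ i ∈ Finset.range (n + 1 + 1), E i + ζ (n + 1) * E (n + 1 + 1) =
          (∑ i ∈ Finset.range (n + 1), E i + ζ n * E (n + 1)) + (ζ (n + 1) - ζ n) * E (n + 1) := by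
        rw [Finset.sum_range_succ _ (n + 1)]
        linear_combination hid (n + 1) hn
      have e2 : ‖ζ (n + 1) - ζ n‖ = (κ (n + 1) - κ n) / 2 := by
        have : ζ (n + 1) - ζ n = ((κ (n + 1) - κ n) / 2 : ℝ) * Complex.I := by
          simp only [hζ]; push_cast; ring
        rw [this, norm_mul, Complex.norm_I, mul_one, Complex.norm_real,
          Real.norm_of_nonneg (by linarith [hmono n hn])]
      rw [e1]
      refine (norm_add_le _ _).trans ?_
      rw [norm_mul, e2, hE, norm_circleChar, mul_one]
      linarith [ih (by omega)]
  have hfin := key m le_rfl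
  have e3 : ∑ i ∈ Finset.range (m + 1), E i =
      (∑ i ∈ Finset.range (m + 1), E i + ζ m * E (m + 1)) - ζ m * E (m + 1) := by ring
  have e4 : ‖ζ m * E (m + 1)‖ ≤ 1 / (2 * δ) := by
    rw [norm_mul, hE, norm_circleChar, mul_one]; exact hζb m le_rfl
  have e5 : κ m - κ 0 ≤ 1 / (2 * δ) + 1 / (2 * δ) :=
    (le_abs_self _).trans ((abs_sub _ _).trans (add_le_add (hκb m le_rfl) (hκb 0 (Nat.zero_le m))))
  have e6 : 2 / δ = 4 * (1 / (2 * δ)) := by field_simp; ring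
  rw [e3, e6]
  have e7 : 0 ≤ 1 / (2 * δ) := by positivity
  refine (norm_sub_le _ _).trans ?_
  linarith

theorem exists_eq_Ico_of_ordConnected (s : Finset ℕ)
    (h : ∀ a ∈ s, ∀ b ∈ s, ∀ x, a ≤ x → x ≤ b → x ∈ s) : ∃ p m, s = Finset.Ico p (p + m) := by
  rcases s.eq_empty_or_nonempty with rfl | hs
  · exact ⟨0, 0, by simp⟩
  · refine ⟨s.min' hs, s.max' hs + 1 - s.min' hs, ?_⟩
    have hle := s.min'_le_max' hs
    ext x
    rw [Finset.mem_Ico]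
    constructor
    · intro hx
      have h1 := s.min'_le x hx
      have h2 := s.le_max' x hx
      omega
    · rintro ⟨h1, h2⟩
      exact h _ (s.min'_mem hs) _ (s.max'_mem hs) x h1 (by omega)

/-- A second derivative test. -/
theorem norm_sum_circleChar_le_of_second_difference {f : ℕ → ℝ} {m : ℕ} {l : ℝ} (hl : 0 < l)
    (hl4 : l ≤ 1)
    (h : ∀ n < m, l ≤ (f (n + 1) - f n) - (f (n + 2) - f (n + 1))) :
    ‖∑ n ∈ Finset.range m, circleChar (f n)‖ ≤
      ((f 1 - f 0) - (f (m + 1) - f m) + 2) * (6 / Real.sqrt l) := by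
  set g : ℕ → ℝ := fun n => f (n + 1) - f n with hg
  have hη : 0 < Real.sqrt l := Real.sqrt_pos.2 hl
  have hηl : Real.sqrt l * Real.sqrt l = l := Real.mul_self_sqrt hl.le
  have hη1 : Real.sqrt l ≤ 1 := Real.sqrt_le_one.2 hl4
  set η := Real.sqrt l with hηdef
  have hdec : ∀ n k, n + k ≤ m → l * k ≤ g n - g (n + k) := by
    intro n k hk
    induction k with
    | zero => simp
    | succ k ih =>
      have h1 := ih (by omega)
      have h2 : l ≤ g (n + k) - g (n + (k + 1)) := h (n + k) (by omega)
      push_cast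
      linarith
  -- The increments g decrease by at least l = η² per step, so at most 1/η + 1 of them fit into an
  -- interval of length η; those terms are bounded trivially.
  have hcard : ∀ (s : Finset ℕ) (x : ℝ), s ⊆ Finset.range m → (∀ n ∈ s, x ≤ g n ∧ g n ≤ x + η) →
      ‖∑ n ∈ s, circleChar (f n)‖ ≤ 1 / η + 1 := by
    intro s x hs hx
    rcases s.eq_empty_or_nonempty with rfl | hne
    · simp; positivity
    refine (norm_sum_le _ _).trans ?_
    simp only [norm_circleChar, Finset.sum_const, nsmul_eq_mul, mul_one]
    have hle := s.min'_le_max' hne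
    have h1 : s ⊆ Finset.Icc (s.min' hne) (s.max' hne) := fun n hn =>
      Finset.mem_Icc.2 ⟨s.min'_le n hn, s.le_max' n hn⟩
    have h2 := Finset.card_le_card h1
    rw [Nat.card_Icc] at h2
    have hmax := Finset.mem_range.1 (hs (s.max'_mem hne))
    have h3 := hdec (s.min' hne) (s.max' hne - s.min' hne) (by omega)
    rw [Nat.add_sub_cancel' hle] at h3
    have h4 := (hx _ (s.min'_mem hne)).2
    have h5 := (hx _ (s.max'_mem hne)).1
    have h6 : l * ((s.max' hne - s.min' hne : ℕ) : ℝ) ≤ η := by linarith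
    have h7 : ((s.max' hne - s.min' hne : ℕ) : ℝ) ≤ 1 / η := by
      rw [le_div_iff₀ hη]
      rw [← hηl] at h6
      nlinarith
    have h8 : (s.card : ℝ) ≤ ((s.max' hne - s.min' hne : ℕ) : ℝ) + 1 := by
      have : s.card ≤ (s.max' hne - s.min' hne) + 1 := by omega
      exact_mod_cast this
    linarith
  have hanti : ∀ a b, a ≤ b → b ≤ m → g b ≤ g a := by
    intro a b hab hb
    have := hdec a (b - a) (by omega)
    rw [Nat.add_sub_cancel' hab] at this
    have h0 : 0 ≤ l * ((b - a : ℕ) : ℝ) := by positivity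
    linarith
  -- Terms with increment in [k, k+1): those within η of either end are counted, and the middle
  -- ones, consecutive by monotonicity of g, are handled by Kuzmin–Landau with δ = η. The sum 2(1/η
  -- + 1) + 2/η is at most 6/η because η ≤ 1.
  have hblock : ∀ k : ℤ, ‖∑ n ∈ Finset.range m with ⌊g n⌋ = k, circleChar (f n)‖ ≤ 6 / η := by
    intro k
    set s := {n ∈ Finset.range m | ⌊g n⌋ = k} with hs
    have hmem : ∀ n ∈ s, n < m ∧ (k : ℝ) ≤ g n ∧ g n < k + 1 := by
      intro n hn
      rw [hs, Finset.mem_filter, Finset.mem_range, Int.floor_eq_iff] at hn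
      exact hn
    have hmem' : ∀ n, n < m → (k : ℝ) ≤ g n → g n < k + 1 → n ∈ s := by
      intro n h1 h2 h3
      rw [hs, Finset.mem_filter, Finset.mem_range, Int.floor_eq_iff]
      exact ⟨h1, h2, h3⟩
    rw [← Finset.sum_filter_add_sum_filter_not s (fun n => g n < k + η),
      ← Finset.sum_filter_add_sum_filter_not (s.filter fun n => ¬ g n < k + η)
        (fun n => g n ≤ k + 1 - η)]
    have b1 : ‖∑ n ∈ s with g n < k + η, circleChar (f n)‖ ≤ 1 / η + 1 := by
      refine hcard _ k (fun n hn => ?_) fun n hn => ?_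
      · exact Finset.mem_range.2 (hmem n (Finset.mem_filter.1 hn).1).1
      · rw [Finset.mem_filter] at hn
        exact ⟨(hmem n hn.1).2.1, hn.2.le⟩
    have b3 : ‖∑ n ∈ (s.filter fun n => ¬ g n < k + η) with ¬ g n ≤ k + 1 - η,
        circleChar (f n)‖ ≤ 1 / η + 1 := by
      refine hcard _ (k + 1 - η) (fun n hn => ?_) fun n hn => ?_
      · exact Finset.mem_range.2 (hmem n (Finset.mem_filter.1 (Finset.mem_filter.1 hn).1).1).1
      · rw [Finset.mem_filter, Finset.mem_filter] at hn
        exact ⟨(not_le.1 hn.2).le, by linarith [(hmem n hn.1.1).2.2]⟩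
    have b2 : ‖∑ n ∈ (s.filter fun n => ¬ g n < k + η) with g n ≤ k + 1 - η,
        circleChar (f n)‖ ≤ 2 / η := by
      have hm2 : ∀ n, n ∈ (s.filter fun n => ¬ g n < k + η).filter (fun n => g n ≤ k + 1 - η) ↔
          n < m ∧ k + η ≤ g n ∧ g n ≤ k + 1 - η := by
        intro n
        rw [Finset.mem_filter, Finset.mem_filter, not_lt]
        constructor
        · rintro ⟨⟨h1, h2⟩, h3⟩
          exact ⟨(hmem n h1).1, h2, h3⟩
        · rintro ⟨h1, h2, h3⟩
          exact ⟨⟨hmem' n h1 (by linarith) (by linarith), h2⟩, h3⟩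
      obtain ⟨p, q, hpq⟩ := exists_eq_Ico_of_ordConnected
        ((s.filter fun n => ¬ g n < k + η).filter (fun n => g n ≤ k + 1 - η)) (by
          intro a ha b hb x hax hxb
          rw [hm2] at ha hb ⊢
          exact ⟨by omega, hb.2.1.trans (hanti x b hxb hb.1.le),
            (hanti a x hax (by omega)).trans ha.2.2⟩)
      rw [hpq] at hm2 ⊢
      rw [Finset.sum_Ico_eq_sum_range, Nat.add_sub_cancel_left]
      have hm3 : ∀ n < q, p + n < m ∧ k + η ≤ g (p + n) ∧ g (p + n) ≤ k + 1 - η := fun n hn =>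
        (hm2 (p + n)).1 (Finset.mem_Ico.2 ⟨by omega, by omega⟩)
      refine norm_sum_circleChar_le (f := fun n => f (p + n)) hη k (fun n hn => (hm3 n hn).2.1)
        (fun n hn => (hm3 n hn).2.2) (fun n hn => ?_)
      exact hanti (p + n) (p + (n + 1)) (by omega) (hm3 (n + 1) hn).1.le
    have h1η : 1 ≤ 1 / η := by rw [le_div_iff₀ hη]; linarith
    have e2 : 2 / η = 2 * (1 / η) := by ring
    have e6 : 6 / η = 6 * (1 / η) := by ring
    refine (norm_add_le _ _).trans ((add_le_add b1 ((norm_add_le _ _).trans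
      (add_le_add b2 b3))).trans ?_)
    rw [e2, e6]
    linarith
  have hmaps : ∀ n ∈ Finset.range m, ⌊g n⌋ ∈ Finset.Icc ⌊g m⌋ ⌊g 0⌋ := by
    intro n hn
    rw [Finset.mem_range] at hn
    exact Finset.mem_Icc.2 ⟨Int.floor_le_floor (hanti n m hn.le le_rfl),
      Int.floor_le_floor (hanti 0 n (Nat.zero_le n) hn.le)⟩
  -- It remains to multiply by the number of integer parts met by g, at most g(0) - g(m) + 2.
  rw [← Finset.sum_fiberwise_of_maps_to hmaps]
  refine (norm_sum_le _ _).trans ((Finset.sum_le_card_nsmul _ _ _ fun k _ => hblock k).trans ?_)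
  rw [nsmul_eq_mul, Int.card_Icc]
  have hfl : ⌊g m⌋ ≤ ⌊g 0⌋ := Int.floor_le_floor (hanti 0 m (Nat.zero_le m) le_rfl)
  have : ((⌊g 0⌋ + 1 - ⌊g m⌋).toNat : ℝ) ≤ (f 1 - f 0) - (f (m + 1) - f m) + 2 := by
    have e : (((⌊g 0⌋ + 1 - ⌊g m⌋).toNat : ℤ) : ℝ) = ((⌊g 0⌋ + 1 - ⌊g m⌋ : ℤ) : ℝ) := by
      rw [Int.toNat_of_nonneg (by omega)]
    rw [Int.cast_natCast] at e
    rw [e]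
    push_cast
    have h1 := Int.floor_le (g 0)
    have h2 := Int.lt_floor_add_one (g m)
    simp only [hg] at h1 h2
    linarith
  gcongr

/-! ### Exponential sums along Hardy sequences -/

section ExponentialSums

variable {R : Subring (ℕ → ℝ)} {c : ℕ → ℝ}

theorem tendsto_seqAverage_circleChar_neg
    (h : Tendsto (seqAverage fun n => circleChar ((-c n : ℝ) : UnitAddCircle)) atTop (𝓝 0)) :
    Tendsto (seqAverage fun n => circleChar (c n)) atTop (𝓝 0) := by
  have h1 := (Complex.continuous_conj.tendsto 0).comp h
  rw [map_zero] at h1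
  refine h1.congr fun N => ?_
  simp only [Function.comp]
  rw [← seqAverage_conj]
  congr 1
  ext n
  rw [← circleChar_neg, AddCircle.coe_neg, neg_neg]

/-- A positive sequence that is eventually increasing cannot tend to zero, and in a Hardy ring the
only alternative is that it is eventually decreasing. -/
theorem IsHardySequenceRing.eventually_fwdDiff_nonpos (hR : IsHardySequenceRing R) {w : ℕ → ℝ}
    (hw : w ∈ R) (hpos : ∀ᶠ n in atTop, 0 < w n) (h : Tendsto w atTop (𝓝 0)) :
    ∀ᶠ n in atTop, fwdDiff 1 w n ≤ 0 := by
  refine (hR.nonneg_or_nonpos (hR.fwdDiff_mem hw)).resolve_left fun hn => ?_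
  obtain ⟨N, hN⟩ := eventually_atTop.1 (hpos.and hn)
  have hmono : ∀ n ≥ N, w N ≤ w n := by
    intro n hn
    induction n, hn using Nat.le_induction with
    | base => exact le_rfl
    | succ n hn ih => exact ih.trans (sub_nonneg.1 (hN n hn).2)
  have h1 : w N ≤ 0 := ge_of_tendsto h ((eventually_ge_atTop N).mono hmono)
  linarith [(hN N le_rfl).1]

/-- Fejér's theorem for Hardy sequences. -/
theorem tendsto_seqAverage_of_tendsto_mul_fwdDiff (hR : IsHardySequenceRing R) (hc : c ∈ R)
    (h0 : Tendsto (fwdDiff 1 c) atTop (𝓝 0))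
    (h : Tendsto (fun n : ℕ => (n : ℝ) * fwdDiff 1 c n) atTop atTop ∨
      Tendsto (fun n : ℕ => (n : ℝ) * fwdDiff 1 c n) atTop atBot) :
    Tendsto (seqAverage fun n => circleChar (c n)) atTop (𝓝 0) := by
  wlog htop : Tendsto (fun n : ℕ => (n : ℝ) * fwdDiff 1 c n) atTop atTop generalizing c
  · have hbot := h.resolve_left htop
    refine tendsto_seqAverage_circleChar_neg ?_
    have hd : fwdDiff 1 (fun n => -c n) = -fwdDiff 1 c := fwdDiff_neg_fun c
    have hneg : Tendsto (fun n : ℕ => (n : ℝ) * fwdDiff 1 (fun n => -c n) n) atTop atTop := by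
      rw [hd]
      refine (tendsto_neg_atBot_atTop.comp hbot).congr fun n => ?_
      simp
    refine this (R.neg_mem hc) ?_ (Or.inl hneg) hneg
    rw [hd]
    exact neg_zero (G := ℝ) ▸ h0.neg
  have hpos : ∀ᶠ n in atTop, 0 < fwdDiff 1 c n := by
    filter_upwards [htop.eventually_gt_atTop 0] with n hn
    exact pos_of_mul_pos_right hn (Nat.cast_nonneg n)
  obtain ⟨N₀, hN₀⟩ := eventually_atTop.1 ((hpos.and
    (hR.eventually_fwdDiff_nonpos (hR.fwdDiff_mem hc) hpos h0)).and
    (h0.eventually_le_const (u := 1 / 2) (by norm_num)))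
  have hanti : ∀ a b, N₀ ≤ a → a ≤ b → fwdDiff 1 c b ≤ fwdDiff 1 c a := by
    intro a b ha hab
    induction b, hab using Nat.le_induction with
    | base => exact le_rfl
    | succ b hb ih => exact (sub_nonpos.1 (hN₀ b (ha.trans hb)).1.2).trans ih
  refine tendsto_seqAverage_zero_of_sum_Ico (fun n => (norm_circleChar _).le) N₀
    fun ε hε => ?_
  -- The increments decrease, so up to N they are at least Δc(N). Kuzmin–Landau with δ = Δc(N)
  -- bounds the sum by 2/Δc(N), which is at most εN once NΔc(N) ≥ 2/ε.
  filter_upwards [htop.eventually_ge_atTop (2 / ε), eventually_ge_atTop N₀] with N hN hNN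
  rw [Finset.sum_Ico_eq_sum_range]
  have hw := (hN₀ N hNN).1.1
  refine (norm_sum_circleChar_le (f := fun i => c (N₀ + i)) hw 0 (fun n hn => ?_) (fun n hn => ?_)
    (fun n hn => ?_)).trans ?_
  · rw [Int.cast_zero, zero_add]
    exact hanti (N₀ + n) N (by omega) (by omega)
  · have h1 := (hN₀ (N₀ + n) (by omega)).2
    have h2 := (hN₀ N hNN).2
    rw [fwdDiff_one_apply] at h1
    simp only [← add_assoc, Int.cast_zero]
    linarith
  · exact hanti (N₀ + n) (N₀ + (n + 1)) (by omega) (by omega)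
  · rw [div_le_iff₀ hw]
    rw [div_le_iff₀ hε] at hN
    linarith

/-- If `G → ∞` has differences at most `C G(n) ^ 2 / n ^ 2` then `G` grows at least linearly. -/
theorem not_isLittleO_of_fwdDiff_le {G : ℕ → ℝ} (hG : Tendsto G atTop atTop)
    (hmono : ∀ᶠ n in atTop, 0 ≤ fwdDiff 1 G n) {C : ℝ} (hC : 0 < C)
    (h : ∀ᶠ n : ℕ in atTop, (n : ℝ) ^ 2 * fwdDiff 1 G n ≤ C * G n ^ 2) :
    ¬ G =o[atTop] powScale 1 := by
  intro ho
  obtain ⟨N, hN⟩ := eventually_atTop.1 (((hmono.and h).and (hG.eventually_gt_atTop 0)).and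
    (eventually_ge_atTop 2))
  -- The hypothesis bounds 1/G(n) - 1/G(n+1) by C/n², which is at most C/(n-1) - C/n. So 1/G(n) -
  -- C/(n-1) increases, and as it tends to zero it is nonpositive, that is, n - 1 ≤ C G(n).
  have hstep : ∀ n ≥ N, (G n)⁻¹ - C / ((n : ℝ) - 1) ≤ (G (n + 1))⁻¹ - C / (((n + 1 : ℕ) : ℝ) - 1) := by
    intro n hn
    obtain ⟨⟨⟨h1, h2⟩, h3⟩, h4⟩ := hN n hn
    have h5 := (hN (n + 1) (by omega)).1.2
    rw [fwdDiff_one_apply] at h1 h2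
    have h6 : (2 : ℝ) ≤ n := by exact_mod_cast h4
    have e1 : (G n)⁻¹ - (G (n + 1))⁻¹ = (G (n + 1) - G n) / (G n * G (n + 1)) := by
      field_simp
    have e2 : (G (n + 1) - G n) / (G n * G (n + 1)) ≤ (G (n + 1) - G n) / (G n * G n) := by
      gcongr; linarith
    have e3 : (G (n + 1) - G n) / (G n * G n) ≤ C / (n : ℝ) ^ 2 := by
      rw [div_le_div_iff₀ (by positivity) (by positivity)]
      nlinarith
    have e4 : C / (n : ℝ) ^ 2 ≤ C / ((n : ℝ) - 1) - C / n := by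
      have : C / ((n : ℝ) - 1) - C / n = C / (((n : ℝ) - 1) * n) := by
        have : (n : ℝ) - 1 ≠ 0 := by linarith
        field_simp
        ring
      rw [this]
      exact div_le_div_of_nonneg_left hC.le (by nlinarith) (by nlinarith)
    push_cast
    rw [add_sub_cancel_right]
    linarith
  have hmono2 : ∀ a b, N ≤ a → a ≤ b → (G a)⁻¹ - C / ((a : ℝ) - 1) ≤ (G b)⁻¹ - C / ((b : ℝ) - 1) := by
    intro a b ha hab
    induction b, hab using Nat.le_induction with
    | base => exact le_rfl
    | succ b hb ih => exact ih.trans (hstep b (ha.trans hb))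
  have hlim : Tendsto (fun n : ℕ => (G n)⁻¹ - C / ((n : ℝ) - 1)) atTop (𝓝 0) := by
    have h1 : Tendsto (fun n : ℕ => C / ((n : ℝ) - 1)) atTop (𝓝 0) :=
      (tendsto_atTop_add_const_right _ (-1) tendsto_natCast_atTop_atTop).const_div_atTop C
    simpa using hG.inv_tendsto_atTop.sub h1
  have hle : ∀ n ≥ N, (n : ℝ) - 1 ≤ C * G n := by
    intro n hn
    have h1 : (G n)⁻¹ - C / ((n : ℝ) - 1) ≤ 0 :=
      ge_of_tendsto hlim ((eventually_ge_atTop n).mono fun b hb => hmono2 n b hn hb)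
    obtain ⟨⟨-, h3⟩, h4⟩ := hN n hn
    have h6 : (2 : ℝ) ≤ n := by exact_mod_cast h4
    rw [sub_nonpos, inv_eq_one_div, div_le_div_iff₀ h3 (by linarith)] at h1
    linarith
  obtain ⟨n, h1, h2⟩ := ((isLittleO_iff.1 ho (c := 1 / (4 * C)) (by positivity)).and
    (eventually_ge_atTop N)).exists
  obtain ⟨⟨-, h3⟩, h4⟩ := hN n h2
  have h6 : (2 : ℝ) ≤ n := by exact_mod_cast h4
  have h5 := hle n h2
  simp only [powScale, pow_one, Real.norm_eq_abs, abs_of_pos h3, Nat.abs_cast] at h1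
  rw [div_mul_eq_mul_div, one_mul, le_div_iff₀ (by positivity)] at h1
  linarith

/-- With G = -Δc → ∞, the second derivative test bounds the sum up to N by a multiple of
G(N)/√(ΔG(N)). This is o(N) exactly when n²ΔG/G² → ∞. The sign dichotomy for n²ΔG - C G² leaves only
one other possibility, linear growth of G, which ΔG → 0 excludes. -/
theorem tendsto_seqAverage_of_tendsto_fwdDiff (hR : IsHardySequenceRing R) (hc : c ∈ R)
    (h : Tendsto (fwdDiff 1 c) atTop atTop ∨ Tendsto (fwdDiff 1 c) atTop atBot)
    (h0 : Tendsto (fwdDiff 1 (fwdDiff 1 c)) atTop (𝓝 0)) :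
    Tendsto (seqAverage fun n => circleChar (c n)) atTop (𝓝 0) := by
  wlog hbot : Tendsto (fwdDiff 1 c) atTop atBot generalizing c
  · have htop := h.resolve_right hbot
    refine tendsto_seqAverage_circleChar_neg ?_
    have hd : fwdDiff 1 (fun n => -c n) = -fwdDiff 1 c := fwdDiff_neg_fun c
    have hneg : Tendsto (fwdDiff 1 (fun n => -c n)) atTop atBot := by
      rw [hd]; exact tendsto_neg_atTop_atBot.comp htop
    refine this (R.neg_mem hc) (Or.inr hneg) ?_ hneg
    rw [hd, fwdDiff_neg_fun]
    exact neg_zero (G := ℝ) ▸ h0.neg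
  have hgR := hR.fwdDiff_mem hc
  set G : ℕ → ℝ := -fwdDiff 1 c with hGdef
  have hGR : G ∈ R := R.neg_mem hgR
  have hG : Tendsto G atTop atTop := tendsto_neg_atBot_atTop.comp hbot
  have hw0 : Tendsto (fwdDiff 1 G) atTop (𝓝 0) := by
    rw [hGdef, fwdDiff_neg_fun]; exact neg_zero (G := ℝ) ▸ h0.neg
  have hwR : fwdDiff 1 G ∈ R := hR.fwdDiff_mem hGR
  have hwpos : ∀ᶠ n in atTop, 0 < fwdDiff 1 G n := by
    rcases hR.nonneg_or_nonpos (R.neg_mem hwR) with hs | hs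
    · exfalso
      obtain ⟨N, hN⟩ := eventually_atTop.1 hs
      have hmono : ∀ n ≥ N, G n ≤ G N := by
        intro n hn
        induction n, hn using Nat.le_induction with
        | base => exact le_rfl
        | succ n hn ih =>
          have := hN n hn
          simp only [Pi.neg_apply, fwdDiff_one_apply] at this
          linarith
      obtain ⟨n, h1, h2⟩ := ((hG.eventually_gt_atTop (G N)).and (eventually_ge_atTop N)).exists
      linarith [hmono n h2]
    · rcases hR.eventually_sign _ hwR with h1 | h1 | h1
      · exact h1
      · exfalso
        obtain ⟨N, hN⟩ := eventually_atTop.1 h1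
        have hmono : ∀ n ≥ N, G n = G N := by
          intro n hn
          induction n, hn using Nat.le_induction with
          | base => rfl
          | succ n hn ih => rw [← ih]; exact sub_eq_zero.1 (hN n hn)
        obtain ⟨n, h1, h2⟩ := ((hG.eventually_gt_atTop (G N)).and (eventually_ge_atTop N)).exists
        exact h1.ne' (hmono n h2)
      · obtain ⟨n, h2, h3⟩ := (hs.and h1).exists
        simp only [Pi.neg_apply] at h2
        linarith
  have hGo : G =o[atTop] powScale 1 := by
    refine isLittleO_of_fwdDiff (isGrowthScale_powScale.tendsto 0)
      (isGrowthScale_powScale.nonneg 0) ?_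
    have : fwdDiff 1 (powScale 1) = fun _ => (1 : ℝ) := by
      ext n; simp [fwdDiff_one_apply, powScale]
    rw [this, isLittleO_one_iff]
    exact hw0
  have hbig : ∀ C > 0, ∀ᶠ n : ℕ in atTop, C * G n ^ 2 < (n : ℝ) ^ 2 * fwdDiff 1 G n := by
    intro C hC
    have hmem : (fun n : ℕ => (n : ℝ) ^ 2 * fwdDiff 1 G n - C * G n ^ 2) ∈ R :=
      R.sub_mem (R.mul_mem (R.pow_mem hR.natCast_mem 2) hwR)
        (hR.const_mul_mem (R.pow_mem hGR 2) C)
    have hnot := not_isLittleO_of_fwdDiff_le hG (hwpos.mono fun n hn => hn.le) hC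
    rcases hR.eventually_sign _ hmem with h1 | h1 | h1
    · filter_upwards [h1] with n hn using sub_pos.1 hn
    · exact absurd hGo (hnot (h1.mono fun n hn => (sub_eq_zero.1 hn).le))
    · exact absurd hGo (hnot (h1.mono fun n hn => (sub_neg.1 hn).le))
  obtain ⟨N₀, hN₀⟩ := eventually_atTop.1 ((hwpos.and
    (hR.eventually_fwdDiff_nonpos hwR hwpos hw0)).and
    ((hw0.eventually_le_const (u := 1) one_pos).and (hG.eventually_ge_atTop 1)))
  have hanti : ∀ a b, N₀ ≤ a → a ≤ b → fwdDiff 1 G b ≤ fwdDiff 1 G a := by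
    intro a b ha hab
    induction b, hab using Nat.le_induction with
    | base => exact le_rfl
    | succ b hb ih => exact (sub_nonpos.1 (hN₀ b (ha.trans hb)).1.2).trans ih
  refine tendsto_seqAverage_zero_of_sum_Ico (fun n => (norm_circleChar _).le) N₀
    fun ε hε => ?_
  -- The second derivative test gives at most 3 G(N) · 6/√(ΔG(N)), whence the constant 18 = 3 · 6.
  filter_upwards [hbig ((18 / ε) ^ 2) (by positivity), eventually_ge_atTop N₀] with N hN hNN
  rw [Finset.sum_Ico_eq_sum_range]
  obtain ⟨⟨hw, -⟩, hw1, hG1⟩ := hN₀ N hNN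
  have hsq := Real.sqrt_pos.2 hw
  have hval : ∀ n, G n = -(c (n + 1) - c n) := fun n => rfl
  have hvalw : ∀ n, fwdDiff 1 G n = (c (n + 1) - c n) - (c (n + 2) - c (n + 1)) := by
    intro n; rw [fwdDiff_one_apply, hval, hval]; ring
  refine (norm_sum_circleChar_le_of_second_difference (f := fun i => c (N₀ + i)) hw hw1
    fun n hn => ?_).trans ?_
  · have h1 := hanti (N₀ + n) N (by omega) (by omega)
    rw [hvalw (N₀ + n)] at h1
    exact h1
  · have e1 : c (N₀ + 1) - c (N₀ + 0) ≤ 0 := by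
      have := hval N₀
      have := (hN₀ N₀ le_rfl).2.2
      simp only [add_zero]
      linarith
    have e2 : c (N₀ + (N - N₀ + 1)) - c (N₀ + (N - N₀)) = -G N := by
      rw [hval, neg_neg, ← add_assoc, Nat.add_sub_cancel' hNN]
    rw [e2]
    calc (c (N₀ + 1) - c (N₀ + 0) - -G N + 2) * (6 / Real.sqrt (fwdDiff 1 G N))
        ≤ (3 * G N) * (6 / Real.sqrt (fwdDiff 1 G N)) := by gcongr; linarith
      _ = 18 * G N / Real.sqrt (fwdDiff 1 G N) := by ring
      _ ≤ ε * N := by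
        rw [div_le_iff₀ hsq]
        have h2 : 18 / ε * G N ≤ N * Real.sqrt (fwdDiff 1 G N) := by
          refine le_of_lt (abs_lt_of_sq_lt_sq ?_ (by positivity) |> lt_of_abs_lt)
          rw [mul_pow, mul_pow, Real.sq_sqrt hw.le]
          exact hN
        have h3 : ε * (18 / ε * G N) ≤ ε * (N * Real.sqrt (fwdDiff 1 G N)) := by gcongr
        calc 18 * G N = ε * (18 / ε * G N) := by field_simp
          _ ≤ _ := h3
          _ = _ := by ring

/-! ### Van der Corput differences and iteration -/

section Differences

variable {A : Type*} [AddCommGroup A]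

theorem fwdDiff_iter_shift (c : ℕ → A) (k h n : ℕ) :
    (fwdDiff 1)^[k] (fun m => c (m + h)) n = (fwdDiff 1)^[k] c (n + h) := by
  induction k generalizing n with
  | zero => rfl
  | succ k ih =>
    rw [Function.iterate_succ_apply', Function.iterate_succ_apply', fwdDiff_one_apply,
      fwdDiff_one_apply, ih, ih, add_right_comm]

/-- The difference c(m + h) - c(m) telescopes into h consecutive first differences; van der Corput's
step therefore lowers the order of differencing by one. -/
theorem fwdDiff_iter_difference (c : ℕ → A) (k h n : ℕ) :
    (fwdDiff 1)^[k] (fun m => c (m + h) - c m) n =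
      ∑ j ∈ Finset.range h, (fwdDiff 1)^[k + 1] c (n + j) := by
  have h1 : (fwdDiff 1)^[k] (fun m => c (m + h) - c m) n =
      (fwdDiff 1)^[k] c (n + h) - (fwdDiff 1)^[k] c n := by
    rw [← fwdDiff_iter_shift c k h n]
    induction k generalizing n with
    | zero => rfl
    | succ k ih =>
      simp only [Function.iterate_succ_apply', fwdDiff_one_apply, ih]
      abel
  rw [h1]
  have h2 := Finset.sum_range_sub (fun j => (fwdDiff 1)^[k] c (n + j)) h
  simp only [add_zero] at h2
  rw [← h2]
  refine Finset.sum_congr rfl fun j _ => ?_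
  rw [Function.iterate_succ_apply', fwdDiff_one_apply, add_assoc]

end Differences

theorem tendsto_sum_shift_atTop {F : ℕ → ℝ} (hF : Tendsto F atTop atTop) {h : ℕ} (hh : 1 ≤ h) :
    Tendsto (fun n => ∑ j ∈ Finset.range h, F (n + j)) atTop atTop := by
  induction h, hh using Nat.le_induction with
  | base => simpa using hF
  | succ h _ ih =>
    simp only [Finset.sum_range_succ]
    exact ih.atTop_add_atTop (hF.comp (tendsto_add_atTop_nat h))

theorem tendsto_sum_shift {A : Type*} [AddCommGroup A] [TopologicalSpace A]
    [IsTopologicalAddGroup A] {F : ℕ → A} {x : A} (hF : Tendsto F atTop (𝓝 x)) (h : ℕ) :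
    Tendsto (fun n => ∑ j ∈ Finset.range h, F (n + j)) atTop (𝓝 (h • x)) := by
  have : Tendsto (fun n => ∑ j ∈ Finset.range h, F (n + j)) atTop
      (𝓝 (∑ _j ∈ Finset.range h, x)) :=
    tendsto_finsetSum _ fun j _ => hF.comp (tendsto_add_atTop_nat j)
  simpa using this

/-- If `Δ ^ J c → ± ∞` and `Δ ^ (J + 1) c → 0` for some `J ≥ 1`, then the averages of `e(c(n))`
converge to zero. -/
theorem tendsto_seqAverage_of_fwdDiff_iter (hR : IsHardySequenceRing R) (J : ℕ) (hc : c ∈ R)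
    (h : Tendsto ((fwdDiff 1)^[J + 1] c) atTop atTop ∨
      Tendsto ((fwdDiff 1)^[J + 1] c) atTop atBot)
    (h0 : Tendsto ((fwdDiff 1)^[J + 2] c) atTop (𝓝 0)) :
    Tendsto (seqAverage fun n => circleChar (c n)) atTop (𝓝 0) := by
  induction J generalizing c with
  | zero => exact tendsto_seqAverage_of_tendsto_fwdDiff hR hc h h0
  | succ J ih =>
    refine tendsto_seqAverage_of_differences (fun n => (norm_circleChar _).le) fun k hk => ?_
    have hmem : (fun n => c (n + k) - c n) ∈ R := by
      refine R.sub_mem ?_ hc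
      clear hk
      induction k with
      | zero => exact hc
      | succ k ihk =>
        have e : (fun n => c (n + (k + 1))) = fun n => c (n + 1 + k) := by
          funext n
          rw [add_assoc, add_comm 1 k]
        rw [e]
        exact hR.shift_mem _ ihk
    have hsum := ih hmem ?_ ?_
    · refine hsum.congr fun N => ?_
      congr 1
      ext n
      rw [AddCircle.coe_sub, circleChar_sub]
    · rw [show (fwdDiff 1)^[J + 1] (fun n => c (n + k) - c n) =
        fun n => ∑ j ∈ Finset.range k, (fwdDiff 1)^[J + 2] c (n + j) from
          funext fun n => fwdDiff_iter_difference c (J + 1) k n]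
      rcases h with h | h
      · exact Or.inl (tendsto_sum_shift_atTop h hk)
      · right
        have := tendsto_neg_atTop_atBot.comp
          (tendsto_sum_shift_atTop (tendsto_neg_atBot_atTop.comp h) hk)
        refine this.congr fun n => ?_
        simp
    · rw [show (fwdDiff 1)^[J + 2] (fun n => c (n + k) - c n) =
        fun n => ∑ j ∈ Finset.range k, (fwdDiff 1)^[J + 3] c (n + j) from
          funext fun n => fwdDiff_iter_difference c (J + 2) k n]
      simpa using tendsto_sum_shift h0 k

/-- Weyl's equidistribution theorem: if `Δ ^ J x` converges, for some `J ≥ 1`, to an element of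
infinite order, then the averages of `e(x(n))` converge to zero. -/
theorem tendsto_seqAverage_of_fwdDiff_iter_tendsto (J : ℕ) {x : ℕ → UnitAddCircle}
    {θ : UnitAddCircle} (hθ : ∀ n : ℕ, 0 < n → n • θ ≠ 0)
    (h : Tendsto ((fwdDiff 1)^[J + 1] x) atTop (𝓝 θ)) :
    Tendsto (seqAverage fun n => circleChar (x n)) atTop (𝓝 0) := by
  induction J generalizing x θ with
  | zero =>
    have h : Tendsto (fwdDiff 1 x) atTop (𝓝 θ) := h
    set z : ℕ → ℂ := fun n => circleChar (x n) with hz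
    have hθ1 : 1 - circleChar θ ≠ 0 := by
      intro h1
      apply hθ 1 one_pos
      rw [one_nsmul]
      apply injective_circleChar
      rw [circleChar_zero]
      exact (sub_eq_zero.1 h1).symm
    -- Asymptotically z(n+1) = e(θ) z(n), while shifting does not change averages; so (1 - e(θ))
    -- times the average tends to zero.
    have h1 : Tendsto (fun n => z (n + 1) - circleChar θ * z n) atTop (𝓝 0) := by
      have h2 : Tendsto (fun n => circleChar (fwdDiff 1 x n) - circleChar θ) atTop (𝓝 0) := by
        simpa using ((continuous_circleChar.tendsto θ).comp h).sub_const (circleChar θ)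
      rw [tendsto_zero_iff_norm_tendsto_zero] at h2 ⊢
      refine h2.congr fun n => ?_
      have : z (n + 1) = circleChar (fwdDiff 1 x n) * z n := by
        rw [hz, ← circleChar_add, fwdDiff_one_apply, sub_add_cancel]
      rw [this, ← sub_mul, norm_mul, hz, norm_circleChar, mul_one]
    have h2 := tendsto_seqAverage h1
    have h3 := tendsto_seqAverage_shift_sub (z := z) (fun n => (norm_circleChar _).le) 1
    have h4 : Tendsto (fun N => (1 - circleChar θ) * seqAverage z N) atTop (𝓝 0) := by
      have := h2.sub h3
      rw [sub_zero] at this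
      refine this.congr fun N => ?_
      rw [seqAverage_sub, seqAverage_const_mul]
      ring
    have h5 := h4.const_mul (1 - circleChar θ)⁻¹
    rw [mul_zero] at h5
    refine h5.congr fun N => ?_
    rw [← mul_assoc, inv_mul_cancel₀ hθ1, one_mul]
  | succ J ih =>
    refine tendsto_seqAverage_of_differences (fun n => (norm_circleChar _).le) fun k hk => ?_
    -- Infinite order, rather than θ ≠ 0, is the hypothesis that survives the replacement of θ by
    -- kθ.
    have hk' : ∀ n : ℕ, 0 < n → n • k • θ ≠ 0 := by
      intro n hn
      rw [← mul_nsmul']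
      exact hθ _ (Nat.mul_pos hn hk)
    have := ih (x := fun n => x (n + k) - x n) hk' (by
      rw [show (fwdDiff 1)^[J + 1] (fun n => x (n + k) - x n) =
        fun n => ∑ j ∈ Finset.range k, (fwdDiff 1)^[J + 2] x (n + j) from
          funext fun n => fwdDiff_iter_difference x (J + 1) k n]
      exact tendsto_sum_shift h k)
    refine this.congr fun N => ?_
    congr 1
    ext n
    rw [circleChar_sub]

/-! ### Slowly varying phases -/

/-- If `n Δu(n) → c` then the averages of `e(u(n))` are asymptotic to `e(u(N)) / (1 + 2 π i c)`. -/
theorem tendsto_seqAverage_sub_of_tendsto_mul_fwdDiff {u : ℕ → ℝ} {c : ℝ}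
    (h : Tendsto (fun n : ℕ => (n : ℝ) * fwdDiff 1 u n) atTop (𝓝 c)) :
    Tendsto (fun N => seqAverage (fun n => circleChar (u n)) N -
      circleChar (u N) / (1 + 2 * Real.pi * Complex.I * c)) atTop (𝓝 0) := by
  have hden : (1 + 2 * Real.pi * Complex.I * c : ℂ) ≠ 0 := by
    intro h0
    have := congrArg Complex.re h0
    simp at this
  set D : ℂ := 1 + 2 * Real.pi * Complex.I * c with hD
  set z : ℕ → ℂ := fun n => circleChar (u n) with hz
  have hΔ : Tendsto (fwdDiff 1 u) atTop (𝓝 0) := by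
    have := h.mul (tendsto_inv_atTop_zero.comp (tendsto_natCast_atTop_atTop (R := ℝ)))
    rw [mul_zero] at this
    refine this.congr' ?_
    filter_upwards [eventually_ge_atTop 1] with n hn
    have : (n : ℝ) ≠ 0 := Nat.cast_ne_zero.2 (by omega)
    simp only [Function.comp]
    field_simp
  have hzs : ∀ n, z (n + 1) = circleChar (fwdDiff 1 u n : ℝ) * z n := by
    intro n
    rw [hz, ← circleChar_add, ← AddCircle.coe_add, fwdDiff_one_apply, sub_add_cancel]
  -- First order expansion of the exponential; the error n O(|Δu|²) vanishes because nΔu is bounded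
  -- and Δu → 0.
  have hexp : Tendsto (fun n : ℕ => (n : ℂ) * (circleChar (fwdDiff 1 u n : ℝ) - 1)) atTop
      (𝓝 (2 * Real.pi * Complex.I * c)) := by
    have h1 : Tendsto (fun n : ℕ => 2 * Real.pi * Complex.I * (((n : ℝ) * fwdDiff 1 u n : ℝ) : ℂ))
        atTop (𝓝 (2 * Real.pi * Complex.I * c)) :=
      ((Complex.continuous_ofReal.tendsto c).comp h).const_mul _
    have h2 : Tendsto (fun n : ℕ => (n : ℂ) * (circleChar (fwdDiff 1 u n : ℝ) - 1 -
        2 * Real.pi * Complex.I * (fwdDiff 1 u n : ℝ))) atTop (𝓝 0) := by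
      have h3 : Tendsto (fun n : ℕ => (2 * Real.pi) ^ 2 * |(n : ℝ) * fwdDiff 1 u n| *
          |fwdDiff 1 u n|) atTop (𝓝 0) := by
        have := (h.abs.const_mul ((2 * Real.pi) ^ 2)).mul hΔ.abs
        simpa using this
      refine squeeze_zero_norm' ?_ h3
      have h4 : ∀ᶠ n in atTop, 2 * Real.pi * |fwdDiff 1 u n| ≤ 1 := by
        have := (hΔ.abs.const_mul (2 * Real.pi)).eventually_le_const (u := 1) (by simp)
        exact this
      filter_upwards [h4] with n hn
      have h5 : ‖(2 * Real.pi * Complex.I * (fwdDiff 1 u n : ℝ) : ℂ)‖ =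
          2 * Real.pi * |fwdDiff 1 u n| := by
        simp [abs_of_pos Real.pi_pos]
      have h6 := Complex.norm_exp_sub_one_sub_id_le (h5.le.trans hn)
      rw [h5] at h6
      rw [norm_mul, circleChar_coe, RCLike.norm_natCast]
      calc _ ≤ (n : ℝ) * (2 * Real.pi * |fwdDiff 1 u n|) ^ 2 := by gcongr
        _ = _ := by rw [abs_mul, Nat.abs_cast]; ring
    have := h1.add h2
    rw [add_zero] at this
    refine this.congr fun n => ?_
    push_cast
    ring
  have hdiff : Tendsto (fun n => z (n + 1) - z n) atTop (𝓝 0) := by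
    have h1 : Tendsto (fun n => circleChar (fwdDiff 1 u n : ℝ) - 1) atTop (𝓝 0) := by
      have : Tendsto (fun n => circleChar (fwdDiff 1 u n : ℝ)) atTop (𝓝 (circleChar (0 : ℝ))) :=
        ((continuous_circleChar.comp (AddCircle.continuous_mk' 1)).tendsto 0).comp hΔ
      simpa using this.sub_const 1
    rw [tendsto_zero_iff_norm_tendsto_zero] at h1 ⊢
    refine h1.congr fun n => ?_
    rw [hzs n, ← sub_one_mul, norm_mul, hz, norm_circleChar, mul_one]
  -- The increment of n z(n) is D z(n) + o(1). Averaged over n ≤ N, the left side telescopes to z(N)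
  -- + o(1), which identifies the average of z.
  have hv : Tendsto (fun n : ℕ => ((n + 1 : ℕ) : ℂ) * z (n + 1) - n * z n - D * z n) atTop (𝓝 0) := by
    have h1 : Tendsto (fun n : ℕ => (n : ℂ) * (circleChar (fwdDiff 1 u n : ℝ) - 1) -
        2 * Real.pi * Complex.I * c) atTop (𝓝 0) := by
      simpa using hexp.sub_const (2 * Real.pi * Complex.I * c)
    have h2 : Tendsto (fun n : ℕ => ((n : ℂ) * (circleChar (fwdDiff 1 u n : ℝ) - 1) -
        2 * Real.pi * Complex.I * c) * z n) atTop (𝓝 0) := by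
      rw [tendsto_zero_iff_norm_tendsto_zero] at h1 ⊢
      refine h1.congr fun n => ?_
      rw [norm_mul, hz, norm_circleChar, mul_one]
    have := hdiff.add h2
    rw [add_zero] at this
    refine this.congr fun n => ?_
    rw [hzs n, hD]
    push_cast
    ring
  have havg := tendsto_seqAverage hv
  have hinv : Tendsto (fun N : ℕ => (N : ℂ)⁻¹) atTop (𝓝 0) := by
    have := (Complex.continuous_ofReal.tendsto 0).comp
      (tendsto_inv_atTop_zero.comp (tendsto_natCast_atTop_atTop (R := ℝ)))
    rw [Complex.ofReal_zero] at this
    refine this.congr fun n => ?_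
    simp
  have hbd : ∀ k : ℕ → ℕ, Tendsto (fun N : ℕ => (N : ℂ)⁻¹ * z (k N)) atTop (𝓝 0) := by
    intro k
    rw [tendsto_zero_iff_norm_tendsto_zero] at hinv ⊢
    refine hinv.congr fun n => ?_
    rw [norm_mul, hz, norm_circleChar, mul_one]
  have h7 : Tendsto (fun N => z N - D * seqAverage z N) atTop (𝓝 0) := by
    have := ((havg.sub (hbd fun N => N + 1)).add (hbd fun _ => 1)).sub hdiff
    simp only [sub_zero, add_zero] at this
    refine this.congr' ?_
    filter_upwards [eventually_ge_atTop 1] with N hN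
    have hN0 : (N : ℂ) ≠ 0 := Nat.cast_ne_zero.2 (by omega)
    have htel : seqAverage (fun n : ℕ => ((n + 1 : ℕ) : ℂ) * z (n + 1) - n * z n) N =
        (((N + 1 : ℕ) : ℂ) * z (N + 1) - z 1) / N := by
      rw [seqAverage, sum_Icc_one_eq,
        Finset.sum_range_sub (fun n : ℕ => ((n + 1 : ℕ) : ℂ) * z (n + 1))]
      simp
    rw [seqAverage_sub, seqAverage_const_mul, htel]
    push_cast
    field_simp
    ring
  have h8 := h7.const_mul (-D⁻¹)
  rw [mul_zero] at h8
  refine h8.congr fun N => ?_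
  field_simp
  ring

end ExponentialSums

/-! ### Fourier analysis of measures on compact spaces -/

section Dense

variable {X : Type*} [TopologicalSpace X] [CompactSpace X]

/-- Convergence of uniformly bounded functionals may be tested on a set with dense span. -/
theorem tendsto_of_span_dense {ι : Type*} {l : Filter ι} (L : ι → C(X, ℂ) →ₗ[ℂ] ℂ)
    (L₀ : C(X, ℂ) →ₗ[ℂ] ℂ) {C : ℝ} (hC : 0 < C) (hL : ∀ k f, ‖L k f‖ ≤ C * ‖f‖)
    (hL₀ : ∀ f, ‖L₀ f‖ ≤ C * ‖f‖) {S : Set C(X, ℂ)}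
    (hS : (Submodule.span ℂ S).topologicalClosure = ⊤)
    (h : ∀ f ∈ S, Tendsto (fun k => L k f) l (𝓝 (L₀ f))) (f : C(X, ℂ)) :
    Tendsto (fun k => L k f) l (𝓝 (L₀ f)) := by
  have hspan : ∀ g ∈ Submodule.span ℂ S, Tendsto (fun k => L k g) l (𝓝 (L₀ g)) := by
    intro g hg
    induction hg using Submodule.span_induction with
    | mem g hg => exact h g hg
    | zero => simpa using tendsto_const_nhds
    | add g g' _ _ h1 h2 => simpa using h1.add h2
    | smul c g _ h1 => simpa using h1.const_mul c
  rw [Metric.tendsto_nhds]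
  intro ε hε
  have hf : f ∈ closure (Submodule.span ℂ S : Set C(X, ℂ)) := by
    rw [← Submodule.topologicalClosure_coe, hS]
    trivial
  obtain ⟨g, hg, hfg⟩ := Metric.mem_closure_iff.1 hf (ε / (3 * C)) (by positivity)
  filter_upwards [Metric.tendsto_nhds.1 (hspan g hg) (ε / 3) (by positivity)] with k hk
  rw [dist_eq_norm] at hk hfg ⊢
  have h1 : C * ‖f - g‖ < ε / 3 := by
    calc C * ‖f - g‖ < C * (ε / (3 * C)) := by gcongr
      _ = ε / 3 := by field_simp
  calc ‖L k f - L₀ f‖ = ‖L k (f - g) + (L k g - L₀ g) - L₀ (f - g)‖ := by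
        congr 1; simp only [map_sub]; ring
    _ ≤ ‖L k (f - g)‖ + ‖L k g - L₀ g‖ + ‖L₀ (f - g)‖ :=
        (norm_sub_le _ _).trans (by gcongr; exact norm_add_le _ _)
    _ < ε := by linarith [hL k (f - g), hL₀ (f - g)]

/-- Averages along a sequence as a linear functional. -/
noncomputable def averageFunctional (y : ℕ → X) (N : ℕ) : C(X, ℂ) →ₗ[ℂ] ℂ where
  toFun f := seqAverage (fun n => f (y n)) N
  map_add' f g := seqAverage_add (fun n => f (y n)) (fun n => g (y n)) N
  map_smul' c f := seqAverage_const_mul c (fun n => f (y n)) N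

theorem norm_averageFunctional_le (y : ℕ → X) (N : ℕ) (f : C(X, ℂ)) :
    ‖averageFunctional y N f‖ ≤ ‖f‖ := by
  change ‖seqAverage (fun n => f (y n)) N‖ ≤ ‖f‖
  rw [seqAverage, norm_div, RCLike.norm_natCast]
  refine div_le_of_le_mul₀ (Nat.cast_nonneg N) (norm_nonneg _) ?_
  refine (norm_sum_le _ _).trans ((Finset.sum_le_card_nsmul _ _ ‖f‖ fun n _ =>
    f.norm_coe_le_norm _).trans (le_of_eq ?_))
  simp [mul_comm]

variable [MeasurableSpace X] [BorelSpace X]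

theorem ContinuousMap.integrable_of_compact (μ : Measure X) [IsFiniteMeasure μ] (f : C(X, ℂ)) :
    Integrable f μ :=
  (BoundedContinuousFunction.mkOfCompact f).integrable μ

/-- Integration as a linear functional. -/
noncomputable def integralFunctional (μ : Measure X) [IsFiniteMeasure μ] : C(X, ℂ) →ₗ[ℂ] ℂ where
  toFun f := ∫ x, f x ∂μ
  map_add' f g := integral_add (f.integrable_of_compact μ) (g.integrable_of_compact μ)
  map_smul' c f := integral_const_mul c f

theorem norm_integralFunctional_le (μ : Measure X) [IsFiniteMeasure μ] (f : C(X, ℂ)) :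
    ‖integralFunctional μ f‖ ≤ μ.real Set.univ * ‖f‖ := by
  rw [mul_comm]
  exact norm_integral_le_of_norm_le_const (Eventually.of_forall fun x => f.norm_coe_le_norm x)

/-- Convergence on a set with dense span, applied to constant families of functionals, gives
equality of the integrals of all continuous functions. -/
theorem measure_eq_of_span_dense [HasOuterApproxClosed X] {μ ν : Measure X} [IsFiniteMeasure μ]
    [IsFiniteMeasure ν] {S : Set C(X, ℂ)} (hS : (Submodule.span ℂ S).topologicalClosure = ⊤)
    (h : ∀ f ∈ S, ∫ x, f x ∂μ = ∫ x, f x ∂ν) : μ = ν := by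
  refine ext_of_forall_integral_eq_of_IsFiniteMeasure fun f => ?_
  set fC : C(X, ℂ) := ⟨fun x => (f x : ℂ), Complex.continuous_ofReal.comp f.continuous⟩ with hfC
  have key := tendsto_of_span_dense (l := (atTop : Filter ℕ)) (fun _ => integralFunctional μ)
    (integralFunctional ν) (C := μ.real Set.univ + ν.real Set.univ + 1) (by positivity)
    (fun _ f => (norm_integralFunctional_le μ f).trans (by
      gcongr; linarith [measureReal_nonneg (μ := ν) (s := Set.univ)]))
    (fun f => (norm_integralFunctional_le ν f).trans (by
      gcongr; linarith [measureReal_nonneg (μ := μ) (s := Set.univ)])) hS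
    (fun f hf => by
      change Tendsto (fun _ : ℕ => ∫ x, f x ∂μ) atTop (𝓝 (∫ x, f x ∂ν))
      rw [h f hf]; exact tendsto_const_nhds) fC
  have h2 : ∫ x, fC x ∂μ = ∫ x, fC x ∂ν := tendsto_nhds_unique tendsto_const_nhds key
  have h3 : ∀ ρ : Measure X, ∫ x, fC x ∂ρ = ((∫ x, f x ∂ρ : ℝ) : ℂ) := fun ρ =>
    integral_ofReal (f := fun x => f x)
  rw [h3, h3] at h2
  exact_mod_cast h2

/-- Weyl's criterion. -/
theorem tendsto_seqAverage_of_span_dense {S : Set C(X, ℂ)}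
    (hS : (Submodule.span ℂ S).topologicalClosure = ⊤) {ν : Measure X} [IsProbabilityMeasure ν]
    {y : ℕ → X} {M : ℕ → ℕ}
    (h : ∀ f ∈ S, Tendsto (fun k => seqAverage (fun n => f (y n)) (M k)) atTop (𝓝 (∫ x, f x ∂ν)))
    (f : C(X, ℂ)) :
    Tendsto (fun k => seqAverage (fun n => f (y n)) (M k)) atTop (𝓝 (∫ x, f x ∂ν)) :=
  tendsto_of_span_dense (fun k => averageFunctional y (M k)) (integralFunctional ν) one_pos
    (fun k f => by rw [one_mul]; exact norm_averageFunctional_le y (M k) f)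
    (fun f => by simpa using norm_integralFunctional_le ν f) hS h f

end Dense

/-! ### The unipotent systems -/

section Unipotent

local notation "𝕋" => UnitAddCircle

instance isProbabilityMeasure_volume_unitAddCircle :
    IsProbabilityMeasure (volume : Measure 𝕋) := ⟨UnitAddCircle.measure_univ⟩

theorem circleMeasure_ext {μ ν : Measure 𝕋} [IsFiniteMeasure μ] [IsFiniteMeasure ν]
    (h : ∀ l : ℤ, ∫ x, fourier l x ∂μ = ∫ x, fourier l x ∂ν) : μ = ν :=
  measure_eq_of_span_dense span_fourier_closure_eq_top (by rintro _ ⟨l, rfl⟩; exact h l)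

theorem torusMeasure_ext {ι : Type*} [Fintype ι] {μ ν : Measure (ι → 𝕋)} [IsFiniteMeasure μ]
    [IsFiniteMeasure ν]
    (h : ∀ k : ι → ℤ, ∫ x, UnitAddTorus.mFourier k x ∂μ = ∫ x, UnitAddTorus.mFourier k x ∂ν) :
    μ = ν :=
  measure_eq_of_span_dense (X := ι → 𝕋) UnitAddTorus.span_mFourier_closure_eq_top
    (by rintro _ ⟨l, rfl⟩; exact h l)

theorem mFourier_apply_eq {ι : Type*} [Fintype ι] (k : ι → ℤ) (x : ι → 𝕋) :
    UnitAddTorus.mFourier k x = circleChar (∑ i, k i • x i) := by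
  rw [circleChar_sum]
  exact Finset.prod_congr rfl fun i _ => (circleChar_zsmul _ _).symm

/-- The point 1/(2l) is sent to e(1/2). -/
theorem exists_fourier_ne_one {l : ℤ} (hl : l ≠ 0) : ∃ a : 𝕋, fourier l a ≠ 1 := by
  refine ⟨((1 / (2 * l) : ℝ) : 𝕋), ?_⟩
  rw [← circleChar_zsmul, ← circleChar_zero]
  refine injective_circleChar.ne ?_
  rw [← AddCircle.coe_zsmul, Ne, AddCircle.coe_eq_zero_iff]
  rintro ⟨n, hn⟩
  have hl' : (l : ℝ) ≠ 0 := Int.cast_ne_zero.2 hl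
  simp only [zsmul_eq_mul, mul_one] at hn
  field_simp at hn
  have : n * 2 = 1 := by exact_mod_cast hn
  omega

theorem integral_fourier_volume (l : ℤ) :
    ∫ x : 𝕋, fourier l x = if l = 0 then 1 else 0 := by
  split_ifs with h
  · simp [h]
  · obtain ⟨a, ha⟩ := exists_fourier_ne_one h
    have h1 : ∫ x : 𝕋, fourier l (x + a) = ∫ x : 𝕋, fourier l x :=
      integral_add_right_eq_self (fun x => (fourier l x : ℂ)) a
    have h2 : ∀ x : 𝕋, (fourier l (x + a) : ℂ) = fourier l a * fourier l x := by
      intro x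
      rw [← circleChar_zsmul, smul_add, circleChar_add, circleChar_zsmul, circleChar_zsmul,
        mul_comm]
    simp only [h2] at h1
    rw [integral_const_mul] at h1
    have h3 : (fourier l a - 1) * ∫ x : 𝕋, fourier l x = 0 := by
      rw [sub_mul, one_mul, h1, sub_self]
    exact (mul_eq_zero.1 h3).resolve_left (sub_ne_zero.2 ha)

variable {d : ℕ}

instance isProbabilityMeasure_finCases (lam : Measure 𝕋) [IsProbabilityMeasure lam]
    (i : Fin (d + 1)) :
    IsProbabilityMeasure (Fin.cases (motive := fun _ => Measure 𝕋) lam (fun _ => volume) i) := by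
  induction i using Fin.cases with
  | zero => assumption
  | succ j => simp only [Fin.cases_succ]; infer_instance

instance isProbabilityMeasure_unipotentMeasure (lam : Measure 𝕋) [IsProbabilityMeasure lam] :
    IsProbabilityMeasure (unipotentMeasure d lam) := by
  rw [unipotentMeasure]; infer_instance

/-- Characters factor over the product measure, and each Haar factor annihilates every non-trivial
character. -/
theorem integral_mFourier_unipotentMeasure (lam : Measure 𝕋) [IsProbabilityMeasure lam]
    (k : Fin (d + 1) → ℤ) :
    ∫ x, UnitAddTorus.mFourier k x ∂(unipotentMeasure d lam) =
      if ∀ j : Fin d, k j.succ = 0 then ∫ x, fourier (k 0) x ∂lam else 0 := by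
  have h : ∫ x, UnitAddTorus.mFourier k x ∂(unipotentMeasure d lam) =
      ∏ i, ∫ x : 𝕋, fourier (k i) x
        ∂(Fin.cases (motive := fun _ => Measure 𝕋) lam (fun _ => volume) i) := by
    exact integral_fintype_prod_eq_prod (fun i (x : 𝕋) => (fourier (k i) x : ℂ))
  rw [h, Fin.prod_univ_succ]
  simp only [Fin.cases_zero, Fin.cases_succ, integral_fourier_volume]
  split_ifs with h1
  · simp [h1]
  · push Not at h1
    obtain ⟨j, hj⟩ := h1
    rw [Finset.prod_eq_zero (Finset.mem_univ j) (by rw [if_neg hj]), mul_zero]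

@[simp] theorem unipotentMap_zero (y : Fin (d + 1) → 𝕋) : unipotentMap d y 0 = y 0 := rfl

@[simp] theorem unipotentMap_succ (y : Fin (d + 1) → 𝕋) (j : Fin d) :
    unipotentMap d y j.succ = y j.succ + y j.castSucc := rfl

theorem unipotentMap_add (x y : Fin (d + 1) → 𝕋) :
    unipotentMap d (x + y) = unipotentMap d x + unipotentMap d y := by
  ext i
  induction i using Fin.cases with
  | zero => rfl
  | succ j => simp only [unipotentMap_succ, Pi.add_apply]; abel

theorem continuous_unipotentMap : Continuous (unipotentMap d) := by
  refine continuous_pi fun i => ?_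
  induction i using Fin.cases with
  | zero => exact continuous_apply 0
  | succ j => exact (continuous_apply _).add (continuous_apply _)

/-- The inverse of `unipotentMap`. -/
noncomputable def unipotentInv (d : ℕ) (y : Fin (d + 1) → 𝕋) : Fin (d + 1) → 𝕋 :=
  Fin.induction (y 0) (fun j x => y j.succ - x)

@[simp] theorem unipotentInv_succ (y : Fin (d + 1) → 𝕋) (j : Fin d) :
    unipotentInv d y j.succ = y j.succ - unipotentInv d y j.castSucc := rfl

theorem continuous_unipotentInv : Continuous (unipotentInv d) := by
  refine continuous_pi fun i => ?_
  induction i using Fin.induction with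
  | zero => exact continuous_apply 0
  | succ j ih => exact (continuous_apply _).sub ih

/-- `unipotentMap` as an automorphism of the torus. -/
noncomputable def unipotentAut (d : ℕ) : AddAut (Fin (d + 1) → 𝕋) where
  toFun := unipotentMap d
  invFun := unipotentInv d
  left_inv y := by
    ext i
    induction i using Fin.induction with
    | zero => rfl
    | succ j ih => rw [unipotentInv_succ, ih, unipotentMap_succ, add_sub_cancel_right]
  right_inv y := by
    ext i
    induction i using Fin.cases with
    | zero => rfl
    | succ j => rw [unipotentMap_succ, unipotentInv_succ, sub_add_cancel]
  map_add' := unipotentMap_add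

theorem unipotentAut_apply (y : Fin (d + 1) → 𝕋) : unipotentAut d y = unipotentMap d y := rfl

/-- Composition of automorphisms is written additively here, so that `m • unipotentAut d` is the
m-th iterate, negative m included. -/
theorem unipotentAut_zsmul_add_one (m : ℤ) (y : Fin (d + 1) → 𝕋) :
    ((m + 1) • unipotentAut d) y = unipotentMap d ((m • unipotentAut d) y) := by
  rw [add_comm m 1, add_zsmul, one_zsmul]; rfl

theorem continuous_unipotentAut_zsmul (m : ℤ) :
    Continuous fun y => (m • unipotentAut d) y := by
  induction m using Int.induction_on with
  | zero => exact continuous_id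
  | succ m ih =>
    simp only [unipotentAut_zsmul_add_one]
    exact continuous_unipotentMap.comp ih
  | pred m ih =>
    have : ∀ y, ((-(m : ℤ) - 1) • unipotentAut d) y =
        unipotentInv d (((-(m : ℤ)) • unipotentAut d) y) := by
      intro y
      rw [sub_eq_neg_add, add_zsmul, neg_one_zsmul]; rfl
    simp only [this]
    exact continuous_unipotentInv.comp ih

/-- The sequence of last coordinates along the orbit of a point under `unipotentMap`. -/
noncomputable def unipotentOrbit (d : ℕ) (y : Fin (d + 1) → 𝕋) (m : ℤ) : 𝕋 :=
  (m • unipotentAut d) y (Fin.last d)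

theorem continuous_unipotentOrbit : Continuous (unipotentOrbit d) :=
  continuous_pi fun m => (continuous_apply _).comp (continuous_unipotentAut_zsmul m)

theorem unipotentOrbit_unipotentMap (y : Fin (d + 1) → 𝕋) :
    unipotentOrbit d (unipotentMap d y) = seqShift (unipotentOrbit d y) := by
  ext m
  rw [seqShift, unipotentOrbit, unipotentOrbit, add_zsmul, one_zsmul]
  rfl

/-- The coordinates `(Δ ^ d x(0), …, Δ x(0), x(0))`. -/
def differenceCoords (d : ℕ) (x : ℤ → 𝕋) (i : Fin (d + 1)) : 𝕋 :=
  (fwdDiff 1)^[d - i] x 0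

/-- Under S_d each coordinate increases by the preceding one, so every difference along an orbit
moves one coordinate to the left. -/
theorem fwdDiff_iter_unipotentOrbit (y : Fin (d + 1) → 𝕋) (k : ℕ) (hk : k ≤ d) (m : ℤ) :
    (fwdDiff 1)^[k] (unipotentOrbit d y) m =
      (m • unipotentAut d) y ⟨d - k, by omega⟩ := by
  induction k generalizing m with
  | zero => rfl
  | succ k ih =>
    rw [Function.iterate_succ_apply', fwdDiff, ih (by omega), ih (by omega),
      unipotentAut_zsmul_add_one]
    have h1 : (⟨d - k, by omega⟩ : Fin (d + 1)) = Fin.succ ⟨d - (k + 1), by omega⟩ := by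
      ext; simp; omega
    rw [h1, unipotentMap_succ, add_sub_cancel_left]
    rfl

theorem differenceCoords_unipotentOrbit (y : Fin (d + 1) → 𝕋) :
    differenceCoords d (unipotentOrbit d y) = y := by
  ext i
  rw [differenceCoords, fwdDiff_iter_unipotentOrbit y _ (Nat.sub_le _ _), zero_zsmul]
  change y _ = y i
  congr 1
  ext
  simp only
  omega

theorem continuous_fwdDiff_iter_apply (k : ℕ) (m : ℤ) :
    Continuous fun x : ℤ → 𝕋 => (fwdDiff 1)^[k] x m := by
  induction k generalizing m with
  | zero => exact continuous_apply m
  | succ k ih =>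
    simp only [Function.iterate_succ_apply', fwdDiff]
    exact (ih _).sub (ih _)

theorem continuous_differenceCoords : Continuous (differenceCoords d) :=
  continuous_pi fun _ => continuous_fwdDiff_iter_apply _ 0

/-- On characters S_d acts by the transposed matrix, and this action preserves both the set of
frequencies supported on the zeroth coordinate and the zeroth frequency of each of them. -/
theorem measurePreserving_unipotentMap (lam : Measure 𝕋) [IsProbabilityMeasure lam] :
    MeasurePreserving (unipotentMap d) (unipotentMeasure d lam) (unipotentMeasure d lam) := by
  refine ⟨continuous_unipotentMap.measurable, ?_⟩
  have := Measure.isProbabilityMeasure_map (μ := unipotentMeasure d lam)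
    (continuous_unipotentMap (d := d)).measurable.aemeasurable
  refine torusMeasure_ext fun k => ?_
  rw [integral_map continuous_unipotentMap.measurable.aemeasurable
    (UnitAddTorus.mFourier k).continuous.aestronglyMeasurable]
  set k' : Fin (d + 1) → ℤ := Fin.lastCases (k (Fin.last d)) (fun j => k j.castSucc + k j.succ)
    with hk'
  have hk'c : ∀ j : Fin d, k' j.castSucc = k j.castSucc + k j.succ := fun j => by simp [hk']
  have hk'l : k' (Fin.last d) = k (Fin.last d) := by simp [hk']
  have h1 : ∀ y, UnitAddTorus.mFourier k (unipotentMap d y) = UnitAddTorus.mFourier k' y := by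
    intro y
    rw [mFourier_apply_eq, mFourier_apply_eq]
    congr 1
    rw [Fin.sum_univ_succ, Fin.sum_univ_castSucc (f := fun i => k' i • y i)]
    simp only [unipotentMap_zero, unipotentMap_succ, hk'c, hk'l, smul_add, add_smul,
      Finset.sum_add_distrib]
    have e1 := Fin.sum_univ_succ (f := fun i => k i • y i)
    have e2 := Fin.sum_univ_castSucc (f := fun i => k i • y i)
    rw [← add_assoc, ← e1, e2]
    abel
  simp only [h1]
  rw [integral_mFourier_unipotentMeasure, integral_mFourier_unipotentMeasure]
  -- The transposed matrix is triangular: the last entry is unchanged, and the others are recovered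
  -- from the top downwards.
  have hiff : (∀ j : Fin d, k' j.succ = 0) ↔ ∀ j : Fin d, k j.succ = 0 := by
    constructor
    · intro h
      have : ∀ i : Fin (d + 1), i ≠ 0 → k i = 0 := by
        intro i
        induction i using Fin.reverseInduction with
        | last =>
          intro hi
          rw [← hk'l, ← Fin.succ_pred _ hi]
          exact h _
        | cast j ih =>
          intro hi
          have e1 := h (Fin.pred j.castSucc hi)
          rw [Fin.succ_pred, hk'c, ih (Fin.succ_ne_zero j), add_zero] at e1
          exact e1
      exact fun j => this _ (Fin.succ_ne_zero j)
    · intro h j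
      by_cases hj : j.succ = Fin.last d
      · rw [hj, hk'l, ← hj, h j]
      · have e1 : j.succ = (Fin.castPred j.succ hj).castSucc := (Fin.castSucc_castPred _ hj).symm
        rw [e1, hk'c, ← e1, h j, h, add_zero]
  by_cases h : ∀ j : Fin d, k j.succ = 0
  · rw [if_pos h, if_pos (hiff.2 h)]
    have : k' 0 = k 0 := by
      rcases d with _ | d
      · exact hk'l
      · have := hk'c 0
        rw [h 0, add_zero] at this
        exact this
    rw [this]
  · rw [if_neg h, if_neg (mt hiff.1 h)]

end Unipotent

/-! ### Furstenberg systems of asymptotically unipotent sequences -/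

section Furstenberg

local notation "𝕋" => UnitAddCircle

variable {d : ℕ} {x : ℕ → 𝕋}

/-- The points `(Δ ^ d x(n), …, Δ x(n), x(n))`. -/
def differencePoint (d : ℕ) (x : ℕ → 𝕋) (n : ℕ) (i : Fin (d + 1)) : 𝕋 :=
  (fwdDiff 1)^[d - i] x n

/-- All coordinates but the zeroth follow S_d exactly; the error in the zeroth is Δ^(d+1) x(n). -/
theorem tendsto_differencePoint_succ_sub (h : Tendsto ((fwdDiff 1)^[d + 1] x) atTop (𝓝 0)) :
    Tendsto (fun n => differencePoint d x (n + 1) - unipotentMap d (differencePoint d x n)) atTop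
      (𝓝 0) := by
  rw [tendsto_pi_nhds]
  intro i
  induction i using Fin.cases with
  | zero =>
    refine h.congr fun n => ?_
    rw [Function.iterate_succ_apply']
    rfl
  | succ j =>
    refine tendsto_const_nhds.congr fun n => ?_
    simp only [Pi.sub_apply, Pi.zero_apply, unipotentMap_succ, differencePoint, Fin.val_succ,
      Fin.val_castSucc]
    have : d - (j : ℕ) = (d - (j + 1)) + 1 := by omega
    rw [this, Function.iterate_succ_apply', fwdDiff_one_apply]
    abel

theorem tendsto_differencePoint_add_sub (h : Tendsto ((fwdDiff 1)^[d + 1] x) atTop (𝓝 0)) (m : ℕ) :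
    Tendsto (fun n => differencePoint d x (n + m) -
      ((m : ℤ) • unipotentAut d) (differencePoint d x n)) atTop (𝓝 0) := by
  induction m with
  | zero =>
    refine tendsto_const_nhds.congr fun n => ?_
    rw [Nat.cast_zero, zero_zsmul]
    exact (sub_self _).symm
  | succ m ih =>
    have h1 := (tendsto_differencePoint_succ_sub h).comp (tendsto_add_atTop_nat m)
    have h2 := ((continuous_unipotentMap (d := d)).tendsto 0).comp ih
    have h0 : unipotentMap d 0 = 0 := map_zero (unipotentAut d)
    rw [h0] at h2
    have h3 := h1.add h2
    rw [add_zero] at h3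
    refine h3.congr fun n => ?_
    simp only [Function.comp, Nat.cast_add, Nat.cast_one]
    rw [unipotentAut_zsmul_add_one, ← unipotentAut_apply (_ - _), map_sub, unipotentAut_apply,
      unipotentAut_apply, add_assoc]
    abel

theorem tendsto_apply_sub_unipotentOrbit (h : Tendsto ((fwdDiff 1)^[d + 1] x) atTop (𝓝 0))
    {b : ℤ → 𝕋} (hb : ∀ n : ℕ, 0 < n → b n = x n) (m : ℤ) :
    Tendsto (fun n : ℕ => b (m + n) - unipotentOrbit d (differencePoint d x n) m) atTop (𝓝 0) := by
  have hlast : ∀ n, differencePoint d x n (Fin.last d) = x n := by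
    intro n
    simp [differencePoint]
  obtain ⟨k, rfl | rfl⟩ := m.eq_nat_or_neg
  · have h1 := (tendsto_pi_nhds.1 (tendsto_differencePoint_add_sub h k)) (Fin.last d)
    refine h1.congr' ?_
    filter_upwards [eventually_gt_atTop 0] with n hn
    have h2 := hb (n + k) (by omega)
    rw [Pi.sub_apply, hlast, ← h2, unipotentOrbit]
    push_cast
    rw [add_comm]
  -- For a negative time -k the forward statement starting from n is pulled back by the inverse
  -- automorphism and reindexed by n + k, so that only values of b at positive integers occur.
  · rw [← tendsto_add_atTop_iff_nat k]
    have h1 := ((continuous_unipotentAut_zsmul (d := d) (-(k : ℤ))).tendsto 0).comp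
      (tendsto_differencePoint_add_sub h k)
    simp only [Function.comp_def, map_sub, map_zero] at h1
    have h2 := (tendsto_pi_nhds.1 h1) (Fin.last d)
    have h3 := h2.neg
    simp only [Pi.sub_apply, Pi.zero_apply, neg_zero, neg_sub] at h3
    refine h3.congr' ?_
    filter_upwards [eventually_gt_atTop 0] with n hn
    have h4 : ((-(k : ℤ)) • unipotentAut d) (((k : ℤ) • unipotentAut d) (differencePoint d x n)) =
        differencePoint d x n := by
      have : ((-(k : ℤ)) • unipotentAut d + (k : ℤ) • unipotentAut d) (differencePoint d x n) =
          differencePoint d x n := by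
        rw [← add_zsmul, neg_add_cancel, zero_zsmul]; rfl
      exact this
    have h5 : -(k : ℤ) + ((n + k : ℕ) : ℤ) = n := by push_cast; ring
    rw [h4, hlast, h5, hb n hn, unipotentOrbit]

theorem seqShift_iterate {Y : Type*} (b : ℤ → Y) (n : ℕ) (m : ℤ) :
    seqShift^[n] b m = b (m + n) := by
  induction n generalizing m with
  | zero => simp
  | succ n ih =>
    rw [Function.iterate_succ_apply', seqShift, ih]
    congr 1
    push_cast
    ring

/-- Convergence in the product is coordinatewise, and f is uniformly continuous because the product
is compact. In particular the values of b at nonpositive integers are irrelevant. -/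
theorem tendsto_apply_shift_sub (h : Tendsto ((fwdDiff 1)^[d + 1] x) atTop (𝓝 0))
    {b : ℤ → 𝕋} (hb : ∀ n : ℕ, 0 < n → b n = x n) (f : C(ℤ → 𝕋, ℝ)) :
    Tendsto (fun n : ℕ => f (seqShift^[n] b) - f (unipotentOrbit d (differencePoint d x n))) atTop
      (𝓝 0) := by
  have hf := CompactSpace.uniformContinuous_of_continuous f.continuous
  have h1 : Tendsto (fun n : ℕ => (unipotentOrbit d (differencePoint d x n), seqShift^[n] b)) atTop
      (uniformity (ℤ → 𝕋)) := by
    rw [uniformity_eq_comap_nhds_zero, tendsto_comap_iff, tendsto_pi_nhds]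
    intro m
    refine (tendsto_apply_sub_unipotentOrbit h hb m).congr fun n => ?_
    simp only [Function.comp, Pi.sub_apply, seqShift_iterate]
  have h2 := Tendsto.comp hf h1
  rw [uniformity_eq_comap_nhds_zero, tendsto_comap_iff] at h2
  exact h2

/-! ### The coding of torus points by sequences, and the Furstenberg limits -/

variable {Y : Type*} [TopologicalSpace Y] (e : 𝕋 ≃ₜ Y)

/-- The point of `Y ^ ℤ` corresponding to a point of the torus. -/
noncomputable def unipotentCode (d : ℕ) (y : Fin (d + 1) → 𝕋) (m : ℤ) : Y :=
  e (unipotentOrbit d y m)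

theorem continuous_unipotentCode : Continuous (unipotentCode e d) :=
  continuous_pi fun m => e.continuous.comp ((continuous_apply m).comp continuous_unipotentOrbit)

theorem unipotentCode_unipotentMap (y : Fin (d + 1) → 𝕋) :
    unipotentCode e d (unipotentMap d y) = seqShift (unipotentCode e d y) := by
  funext m
  rw [unipotentCode, unipotentOrbit_unipotentMap]
  rfl

/-- A left inverse of `unipotentCode`. -/
def unipotentDecode (d : ℕ) (z : ℤ → Y) : Fin (d + 1) → 𝕋 :=
  differenceCoords d fun m => e.symm (z m)

theorem continuous_unipotentDecode : Continuous (unipotentDecode e d) :=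
  continuous_differenceCoords.comp
    (continuous_pi fun m => e.symm.continuous.comp (continuous_apply m))

theorem unipotentDecode_unipotentCode (y : Fin (d + 1) → 𝕋) :
    unipotentDecode e d (unipotentCode e d y) = y := by
  rw [unipotentDecode]
  simp only [unipotentCode, Homeomorph.symm_apply_apply]
  exact differenceCoords_unipotentOrbit y

/-- A sequence in the circle with `Δ ^ (d + 1) x → 0` whose differences are equidistributed in all
directions but that of `Δ ^ d x`. -/
structure IsAsymptoticallyUnipotent (d : ℕ) (x : ℕ → 𝕋) : Prop where
  tendsto_fwdDiff : Tendsto ((fwdDiff 1)^[d + 1] x) atTop (𝓝 0)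
  tendsto_average : ∀ k : Fin (d + 1) → ℤ, (¬ ∀ j : Fin d, k j.succ = 0) →
    Tendsto (seqAverage fun n => UnitAddTorus.mFourier k (differencePoint d x n)) atTop (𝓝 0)

variable [MeasurableSpace Y]

/-- `λ` is the limit distribution of `Δ ^ d x` along the intervals `[M k]`. -/
def IsLimitDistribution (u : ℕ → 𝕋) (M : ℕ → ℕ) (lam : Measure 𝕋) : Prop :=
  ∀ l : ℤ, Tendsto (fun k => seqAverage (fun n => fourier l (u n)) (M k)) atTop
    (𝓝 (∫ x, fourier l x ∂lam))

theorem fourier_differencePoint_zero (k : Fin (d + 1) → ℤ) (hk : ∀ j : Fin d, k j.succ = 0)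
    (n : ℕ) : UnitAddTorus.mFourier k (differencePoint d x n) =
      fourier (k 0) ((fwdDiff 1)^[d] x n) := by
  rw [mFourier_apply_eq, Fin.sum_univ_succ, Finset.sum_eq_zero (fun j _ => by rw [hk j, zero_smul]),
    add_zero, circleChar_zsmul]
  rfl

variable [SecondCountableTopology Y] [BorelSpace Y]

/-- The shifted sequence may be replaced by the code of its difference point, and Weyl's criterion
applies on the torus: frequencies supported on the zeroth coordinate are governed by λ, and the
averages of all others tend to zero, as do their integrals. -/
theorem isFurstenbergLimit_map (hx : IsAsymptoticallyUnipotent d x) {b : ℤ → Y}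
    (hb : ∀ n : ℕ, 0 < n → b n = e (x n)) {M : ℕ → ℕ} (hM : Tendsto M atTop atTop)
    {lam : Measure 𝕋} [IsProbabilityMeasure lam]
    (hlam : IsLimitDistribution ((fwdDiff 1)^[d] x) M lam) :
    IsFurstenbergLimit b M ((unipotentMeasure d lam).map (unipotentCode e d)) := by
  have hmeas : Measurable (unipotentCode e d) := (continuous_unipotentCode e).measurable
  refine ⟨Measure.isProbabilityMeasure_map hmeas.aemeasurable, fun f => ?_⟩
  set f' : C(ℤ → 𝕋, ℝ) := ⟨fun z => f fun m => e (z m), f.continuous.comp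
    (continuous_pi fun m => e.continuous.comp (continuous_apply m))⟩ with hf'
  set b' : ℤ → 𝕋 := fun m => e.symm (b m) with hb'
  have hb'x : ∀ n : ℕ, 0 < n → b' n = x n := fun n hn => by simp [hb', hb n hn]
  have hfb : ∀ n : ℕ, f (seqShift^[n] b) = f' (seqShift^[n] b') := by
    intro n
    simp only [hf', ContinuousMap.coe_mk]
    congr 1
    ext m
    simp [seqShift_iterate, hb']
  set gC : C(Fin (d + 1) → 𝕋, ℂ) := ⟨fun y => (f (unipotentCode e d y) : ℂ),
    Complex.continuous_ofReal.comp (f.continuous.comp (continuous_unipotentCode e))⟩ with hgC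
  have h1 : Tendsto (fun n : ℕ => ((f (seqShift^[n] b) : ℝ) : ℂ) - gC (differencePoint d x n)) atTop
      (𝓝 0) := by
    have := (Complex.continuous_ofReal.tendsto 0).comp
      (tendsto_apply_shift_sub hx.tendsto_fwdDiff hb'x f')
    rw [Complex.ofReal_zero] at this
    refine this.congr fun n => ?_
    rw [hfb]
    simp only [Function.comp, Complex.ofReal_sub]
    rfl
  have h2 : Tendsto (fun k => seqAverage (fun n => gC (differencePoint d x n)) (M k)) atTop
      (𝓝 (∫ y, gC y ∂(unipotentMeasure d lam))) := by
    refine tendsto_seqAverage_of_span_dense UnitAddTorus.span_mFourier_closure_eq_top ?_ gC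
    rintro _ ⟨k, rfl⟩
    rw [integral_mFourier_unipotentMeasure]
    split_ifs with hk
    · refine (hlam (k 0)).congr fun N => ?_
      simp only [fourier_differencePoint_zero k hk]
    · exact (hx.tendsto_average k hk).comp hM
  have h3 := ((tendsto_seqAverage h1).comp hM).add h2
  rw [zero_add] at h3
  have h4 : ∫ y, gC y ∂(unipotentMeasure d lam) =
      ((∫ z, f z ∂((unipotentMeasure d lam).map (unipotentCode e d)) : ℝ) : ℂ) := by
    rw [integral_map hmeas.aemeasurable f.continuous.aestronglyMeasurable]
    exact integral_ofReal (f := fun y => f (unipotentCode e d y))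
  rw [h4] at h3
  have h5 := (Complex.continuous_re.tendsto _).comp h3
  rw [Complex.ofReal_re] at h5
  refine h5.congr fun k => ?_
  simp only [Function.comp]
  rw [← seqAverage_add]
  simp only [sub_add_cancel, seqAverage]
  norm_cast

theorem IsFurstenbergLimit.tendsto_seqAverage {b : ℤ → Y} {M : ℕ → ℕ} {μ : Measure (ℤ → Y)}
    [CompactSpace Y]
    (h : IsFurstenbergLimit b M μ) (g : C(ℤ → Y, ℂ)) :
    Tendsto (fun k => seqAverage (fun n => g (seqShift^[n] b)) (M k)) atTop (𝓝 (∫ z, g z ∂μ)) := by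
  have := h.1
  have hre := h.2 ⟨fun z => (g z).re, Complex.continuous_re.comp g.continuous⟩
  have him := h.2 ⟨fun z => (g z).im, Complex.continuous_im.comp g.continuous⟩
  have h1 := ((Complex.continuous_ofReal.tendsto _).comp hre).add
    (((Complex.continuous_ofReal.tendsto _).comp him).mul_const Complex.I)
  have h2 := integral_re_add_im (𝕜 := ℂ) (g.integrable_of_compact μ)
  simp only [RCLike.re_eq_complex_re, RCLike.im_eq_complex_im, RCLike.I_to_complex] at h2
  rw [← h2]
  refine h1.congr fun k => ?_
  simp only [Function.comp, ContinuousMap.coe_mk, seqAverage]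
  push_cast
  rw [div_mul_eq_mul_div, ← add_div, Finset.sum_mul, ← Finset.sum_add_distrib]
  simp only [Complex.re_add_im]

theorem fwdDiff_iter_shift_apply {b : ℤ → 𝕋} (hb : ∀ n : ℕ, 0 < n → b n = x n) (k : ℕ) {n : ℕ}
    (hn : 0 < n) : (fwdDiff 1)^[k] (seqShift^[n] b) 0 = (fwdDiff 1)^[k] x n := by
  have key : ∀ m : ℕ, (fwdDiff 1)^[k] (seqShift^[n] b) m = (fwdDiff 1)^[k] x (n + m) := by
    induction k with
    | zero =>
      intro m
      simp only [Function.iterate_zero, id, seqShift_iterate]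
      rw [← hb (n + m) (by omega)]
      push_cast
      rw [add_comm]
    | succ k ih =>
      intro m
      have e : (m : ℤ) + 1 = ((m + 1 : ℕ) : ℤ) := by push_cast; rfl
      rw [Function.iterate_succ_apply', Function.iterate_succ_apply', fwdDiff, fwdDiff, ih, e, ih]
      rfl
  simpa using key 0

theorem seqAverage_congr {z w : ℕ → ℂ} (h : ∀ n, 0 < n → z n = w n) (N : ℕ) :
    seqAverage z N = seqAverage w N := by
  rw [seqAverage, seqAverage, Finset.sum_congr rfl fun n hn => h n (Finset.mem_Icc.1 hn).1]

/-- The law of Δ^d at 0 under μ serves as λ: this is a continuous function of the sequence, so its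
distribution converges along the same M, without passing to a subsequence. -/
theorem IsFurstenbergLimit.exists_limitDistribution {b : ℤ → Y}
    (hb : ∀ n : ℕ, 0 < n → b n = e (x n)) {M : ℕ → ℕ} {μ : Measure (ℤ → Y)} (d : ℕ)
    (h : IsFurstenbergLimit b M μ) : ∃ lam : Measure 𝕋, IsProbabilityMeasure lam ∧
      IsLimitDistribution ((fwdDiff 1)^[d] x) M lam := by
  have : CompactSpace Y := e.compactSpace
  have := h.1
  set D : (ℤ → Y) → 𝕋 := fun z => (fwdDiff 1)^[d] (fun m => e.symm (z m)) 0 with hD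
  have hDc : Continuous D := (continuous_fwdDiff_iter_apply d 0).comp
    (continuous_pi fun m => e.symm.continuous.comp (continuous_apply m))
  refine ⟨μ.map D, Measure.isProbabilityMeasure_map hDc.measurable.aemeasurable, fun l => ?_⟩
  rw [integral_map hDc.measurable.aemeasurable (fourier l).continuous.aestronglyMeasurable]
  refine (h.tendsto_seqAverage ((fourier l).comp ⟨D, hDc⟩)).congr fun k => ?_
  refine seqAverage_congr (fun n hn => ?_) _
  simp only [ContinuousMap.comp_apply, ContinuousMap.coe_mk, hD]
  congr 1
  rw [← fwdDiff_iter_shift_apply (b := fun m => e.symm (b m)) (fun n hn => by simp [hb n hn]) d hn]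
  have hcomm : (seqShift^[n] fun m => e.symm (b m)) = fun m => e.symm (seqShift^[n] b m) := by
    funext m
    simp only [seqShift_iterate]
  rw [hcomm]

theorem isFurstenbergLimit_unique [HasOuterApproxClosed (ℤ → Y)] {b : ℤ → Y} {M : ℕ → ℕ}
    {μ ν : Measure (ℤ → Y)} (hμ : IsFurstenbergLimit b M μ) (hν : IsFurstenbergLimit b M ν) :
    μ = ν := by
  have := hμ.1
  have := hν.1
  exact ext_of_forall_integral_eq_of_IsFiniteMeasure fun f =>
    tendsto_nhds_unique (hμ.2 f.toContinuousMap) (hν.2 f.toContinuousMap)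

theorem IsFurstenbergLimit.eq_map [HasOuterApproxClosed (ℤ → Y)] (hx : IsAsymptoticallyUnipotent d x) {b : ℤ → Y}
    (hb : ∀ n : ℕ, 0 < n → b n = e (x n)) {M : ℕ → ℕ} (hM : Tendsto M atTop atTop)
    {μ : Measure (ℤ → Y)} (h : IsFurstenbergLimit b M μ) :
    ∃ lam : Measure 𝕋, IsProbabilityMeasure lam ∧
      IsLimitDistribution ((fwdDiff 1)^[d] x) M lam ∧
      μ = (unipotentMeasure d lam).map (unipotentCode e d) := by
  obtain ⟨lam, hp, hlam⟩ := h.exists_limitDistribution e hb d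
  exact ⟨lam, hp, hlam, isFurstenbergLimit_unique h (isFurstenbergLimit_map e hx hb hM hlam)⟩

variable [T2Space Y]

/-- The identity G ∘ P = id holds on the image of G, which carries the measure. -/
theorem systemsIsomorphic_of_leftInverse {X : Type*} [MeasurableSpace X] {ν : Measure X}
    {S : X → X} (hS : MeasurePreserving S ν ν) {G : X → (ℤ → Y)} (hG : Measurable G)
    {P : (ℤ → Y) → X} (hP : Measurable P) (hPG : ∀ y, P (G y) = y)
    (hGS : ∀ y, G (S y) = seqShift (G y)) : SystemsIsomorphic (ν.map G) seqShift ν S := by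
  have hshift : Measurable (seqShift : (ℤ → Y) → (ℤ → Y)) :=
    measurable_pi_lambda _ fun m => measurable_pi_apply _
  have hset : MeasurableSet {z : ℤ → Y | G (P z) = z} :=
    measurableSet_eq_fun (hG.comp hP) measurable_id
  have hae : ∀ᵐ z ∂(ν.map G), G (P z) = z := by
    rw [ae_map_iff hG.aemeasurable hset]
    exact Eventually.of_forall fun y => by rw [hPG]
  refine ⟨⟨hshift, ?_⟩, hS, P, G, ⟨hP, ?_⟩, ⟨hG, rfl⟩, hae, Eventually.of_forall hPG, ?_⟩
  · rw [Measure.map_map hshift hG]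
    have : seqShift ∘ G = G ∘ S := funext fun y => (hGS y).symm
    rw [this, ← Measure.map_map hG hS.measurable, hS.map_eq]
  · rw [Measure.map_map hP hG]
    have : P ∘ G = id := funext hPG
    rw [this, Measure.map_id]
  · filter_upwards [hae] with z hz
    rw [← hz, ← hGS, hPG, hPG]

theorem isoToUnipotent_map (lam : Measure 𝕋) [IsProbabilityMeasure lam] :
    IsoToUnipotent ((unipotentMeasure d lam).map (unipotentCode e d)) d lam :=
  systemsIsomorphic_of_leftInverse (measurePreserving_unipotentMap lam)
    (continuous_unipotentCode e).measurable (continuous_unipotentDecode e).measurable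
    (unipotentDecode_unipotentCode e) (unipotentCode_unipotentMap e)

end Furstenberg

/-! ### Asymptotically unipotent sequences from growth conditions -/

section Combination

local notation "𝕋" => UnitAddCircle

theorem fwdDiff_iter_coe (s : ℕ → ℝ) (k n : ℕ) :
    (fwdDiff 1)^[k] (fun n => (s n : 𝕋)) n = (((fwdDiff 1)^[k] s n : ℝ) : 𝕋) := by
  induction k generalizing n with
  | zero => rfl
  | succ k ih =>
    rw [Function.iterate_succ_apply', Function.iterate_succ_apply', fwdDiff, fwdDiff, ih, ih,
      AddCircle.coe_sub]

theorem fwdDiff_iter_sum_zsmul {G ι : Type*} [AddCommGroup G] (t : Finset ι) (k : ι → ℤ)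
    (f : ι → ℕ → G) (m n : ℕ) :
    (fwdDiff 1)^[m] (fun n => ∑ i ∈ t, k i • f i n) n = ∑ i ∈ t, k i • (fwdDiff 1)^[m] (f i) n := by
  induction m generalizing n with
  | zero => rfl
  | succ m ih =>
    simp only [Function.iterate_succ_apply', fwdDiff, ih, smul_sub, Finset.sum_sub_distrib]

variable {G : Type*} [AddCommGroup G] [TopologicalSpace G] [IsTopologicalAddGroup G]

theorem tendsto_fwdDiff_iter_zero {f : ℕ → G} (h : Tendsto f atTop (𝓝 0)) (r : ℕ) :
    Tendsto ((fwdDiff 1)^[r] f) atTop (𝓝 0) := by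
  induction r with
  | zero => exact h
  | succ r ih =>
    rw [Function.iterate_succ_apply']
    have h1 := (ih.comp (tendsto_add_atTop_nat 1)).sub ih
    rw [sub_zero] at h1
    exact h1

variable {d : ℕ} {x : ℕ → G}

/-- The i-th term of Δ^J of the combination is k_i Δ^(J+d-i) x. For i < J the order is at least d +
1 and the term tends to zero; for i > J the coefficient vanishes; only i = J is left. -/
theorem tendsto_fwdDiff_iter_combination (h : Tendsto ((fwdDiff 1)^[d + 1] x) atTop (𝓝 0))
    (k : Fin (d + 1) → ℤ) (J : Fin (d + 1)) (hJ : ∀ i, J < i → k i = 0) :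
    Tendsto (fun n => (fwdDiff 1)^[(J : ℕ)]
      (fun n => ∑ i : Fin (d + 1), k i • (fwdDiff 1)^[d - i] x n) n -
        k J • (fwdDiff 1)^[d] x n) atTop (𝓝 0) := by
  have h1 : Tendsto (fun n => ∑ i ∈ Finset.univ.erase J,
      k i • (fwdDiff 1)^[(J : ℕ)] ((fwdDiff 1)^[d - i] x) n) atTop (𝓝 0) := by
    have : (0 : G) = ∑ i ∈ Finset.univ.erase J, 0 := by simp
    rw [this]
    refine tendsto_finsetSum _ fun i hi => ?_
    rcases lt_or_gt_of_ne (Finset.ne_of_mem_erase hi) with hi | hi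
    · have h2 := ((tendsto_fwdDiff_iter_zero h (J + (d - i) - (d + 1))).const_smul (k i))
      rw [smul_zero, ← Function.iterate_add_apply] at h2
      have hi' : (i : ℕ) < J := hi
      have h3 : (J : ℕ) + (d - i) - (d + 1) + (d + 1) = J + (d - i) := by omega
      rw [h3] at h2
      refine h2.congr fun n => ?_
      rw [Function.iterate_add_apply]
    · simp only [hJ i hi, zero_zsmul]
      exact tendsto_const_nhds
  refine h1.congr fun n => ?_
  have h4 : ∀ n, (fwdDiff 1)^[(J : ℕ)] ((fwdDiff 1)^[d - J] x) n = (fwdDiff 1)^[d] x n := by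
    intro n
    rw [← Function.iterate_add_apply, Nat.add_sub_of_le (Nat.lt_succ_iff.1 J.2)]
  rw [fwdDiff_iter_sum_zsmul, Finset.sum_erase_eq_sub (Finset.mem_univ J), h4]

theorem tendsto_fwdDiff_iter_succ_combination (h : Tendsto ((fwdDiff 1)^[d + 1] x) atTop (𝓝 0))
    (k : Fin (d + 1) → ℤ) (J : Fin (d + 1)) (hJ : ∀ i, J < i → k i = 0) :
    Tendsto ((fwdDiff 1)^[(J : ℕ) + 1]
      (fun n => ∑ i : Fin (d + 1), k i • (fwdDiff 1)^[d - i] x n)) atTop (𝓝 0) := by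
  have h1 := tendsto_fwdDiff_iter_zero (tendsto_fwdDiff_iter_combination h k J hJ) 1
  have h2 := h1.add (h.const_smul (k J))
  rw [smul_zero, zero_add] at h2
  refine h2.congr fun n => ?_
  rw [Function.iterate_one, Function.iterate_succ_apply', Function.iterate_succ_apply']
  simp only [fwdDiff, smul_sub]
  abel

theorem exists_last_ne_zero {k : Fin (d + 1) → ℤ} (hk : ¬ ∀ j : Fin d, k j.succ = 0) :
    ∃ J : Fin d, k J.succ ≠ 0 ∧ ∀ i, J.succ < i → k i = 0 := by
  push Not at hk
  obtain ⟨j, hj⟩ := hk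
  obtain ⟨J, hJ, hmax⟩ := (Finset.univ.filter fun i : Fin d => k i.succ ≠ 0).exists_max_image id
    ⟨j, by simpa⟩
  refine ⟨J, (Finset.mem_filter.1 hJ).2, fun i hi => ?_⟩
  by_contra h
  obtain ⟨i', rfl⟩ := Fin.exists_succ_eq.2 (Fin.ne_zero_of_lt hi)
  exact absurd (hmax i' (by simpa)) (not_le.2 (Fin.succ_lt_succ_iff.1 hi))

theorem mFourier_differencePoint (k : Fin (d + 1) → ℤ) (x : ℕ → 𝕋) (n : ℕ) :
    UnitAddTorus.mFourier k (differencePoint d x n) =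
      circleChar (∑ i : Fin (d + 1), k i • (fwdDiff 1)^[d - i] x n) :=
  mFourier_apply_eq k _

theorem nsmul_zsmul_ne_zero {A : Type*} [AddCommGroup A] {θ : A} (hθ : ∀ n : ℕ, 0 < n → n • θ ≠ 0)
    {z : ℤ} (hz : z ≠ 0) {n : ℕ} (hn : 0 < n) : n • z • θ ≠ 0 := by
  intro h
  rw [← natCast_zsmul, ← mul_zsmul] at h
  have hnz : (n : ℤ) * z ≠ 0 := mul_ne_zero (by omega) hz
  refine hθ ((n : ℤ) * z).natAbs (Int.natAbs_pos.2 hnz) ?_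
  rw [← natCast_zsmul]
  rcases Int.natAbs_eq ((n : ℤ) * z) with h1 | h1
  · rwa [← h1]
  · rw [h1, neg_zsmul, neg_eq_zero] at h
    exact h

theorem isAsymptoticallyUnipotent_of_tendsto {x : ℕ → 𝕋} {θ : 𝕋}
    (hθ : (∀ n : ℕ, 0 < n → n • θ ≠ 0) ∨ d = 0) (h : Tendsto ((fwdDiff 1)^[d] x) atTop (𝓝 θ)) :
    IsAsymptoticallyUnipotent d x := by
  have h0 : Tendsto ((fwdDiff 1)^[d + 1] x) atTop (𝓝 0) := by
    rw [Function.iterate_succ_apply']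
    have h1 := (h.comp (tendsto_add_atTop_nat 1)).sub h
    rw [sub_self] at h1
    exact h1
  refine ⟨h0, fun k hk => ?_⟩
  obtain ⟨J, hkJ, hJ⟩ := exists_last_ne_zero hk
  have hθ' := hθ.resolve_right (by have := J.2; omega)
  simp only [mFourier_differencePoint]
  refine tendsto_seqAverage_of_fwdDiff_iter_tendsto J (θ := k J.succ • θ) ?_ ?_
  · exact fun n hn => nsmul_zsmul_ne_zero hθ' hkJ hn
  · have h1 := (tendsto_fwdDiff_iter_combination h0 k J.succ hJ).add (h.const_smul (k J.succ))
    rw [zero_add] at h1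
    refine h1.congr fun n => ?_
    rw [sub_add_cancel]
    rfl

/-- The phase of a character is lifted to the real sequence c, which belongs to the Hardy ring; its
difference of order J + 1 is asymptotic to a non-zero multiple of Δ^d s and diverges, while the next
one tends to zero. -/
theorem isAsymptoticallyUnipotent_of_tendsto_atTop {R : Subring (ℕ → ℝ)}
    (hR : IsHardySequenceRing R) {s : ℕ → ℝ} (hs : s ∈ R)
    (h : Tendsto ((fwdDiff 1)^[d] s) atTop atTop ∨ Tendsto ((fwdDiff 1)^[d] s) atTop atBot)
    (h0 : Tendsto ((fwdDiff 1)^[d + 1] s) atTop (𝓝 0)) :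
    IsAsymptoticallyUnipotent d (fun n => (s n : 𝕋)) := by
  constructor
  · have := ((AddCircle.continuous_mk' (1 : ℝ)).tendsto 0).comp h0
    exact this.congr fun n => (fwdDiff_iter_coe s _ n).symm
  intro k hk
  obtain ⟨J, hkJ, hJ⟩ := exists_last_ne_zero hk
  set c : ℕ → ℝ := fun n => ∑ i : Fin (d + 1), k i • (fwdDiff 1)^[d - i] s n with hc
  have hcR : c ∈ R := by
    have : c = ∑ i : Fin (d + 1), k i • (fwdDiff 1)^[d - i] s := by
      ext n
      simp [hc]
    rw [this]
    exact sum_mem fun i _ => zsmul_mem (hR.fwdDiff_iter_mem hs _) _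
  have hchar : ∀ n, UnitAddTorus.mFourier k (differencePoint d (fun n => (s n : 𝕋)) n) =
      circleChar (c n) := by
    intro n
    rw [mFourier_differencePoint]
    congr 1
    simp only [fwdDiff_iter_coe, hc]
    simp only [← AddCircle.coe_zsmul]
    exact (map_sum (QuotientAddGroup.mk' (AddSubgroup.zmultiples (1 : ℝ))) _ _).symm
  simp only [hchar]
  have h1 := tendsto_fwdDiff_iter_combination h0 k J.succ hJ
  have h2 := tendsto_fwdDiff_iter_succ_combination h0 k J.succ hJ
  refine tendsto_seqAverage_of_fwdDiff_iter hR J hcR ?_ h2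
  have h3 : ∀ n, (fwdDiff 1)^[(J : ℕ) + 1] c n =
      ((fwdDiff 1)^[(J.succ : ℕ)] c n - k J.succ • (fwdDiff 1)^[d] s n) +
        (k J.succ : ℝ) * (fwdDiff 1)^[d] s n := by
    intro n
    rw [zsmul_eq_mul, sub_add_cancel]
    rfl
  have h4 : Tendsto (fun n => (k J.succ : ℝ) * (fwdDiff 1)^[d] s n) atTop atTop ∨
      Tendsto (fun n => (k J.succ : ℝ) * (fwdDiff 1)^[d] s n) atTop atBot := by
    rcases lt_or_gt_of_ne hkJ with hk0 | hk0
    · have hk0' : (k J.succ : ℝ) < 0 := by exact_mod_cast hk0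
      exact h.symm.imp (fun h => h.const_mul_atBot_of_neg hk0')
        (fun h => h.const_mul_atTop_of_neg hk0')
    · have hk0' : (0 : ℝ) < k J.succ := by exact_mod_cast hk0
      exact h.imp (fun h => h.const_mul_atTop hk0') (fun h => h.const_mul_atBot hk0')
  exact h4.imp (fun h4 => (h1.add_atTop h4).congr fun n => (h3 n).symm)
    (fun h4 => (h1.add_atBot h4).congr fun n => (h3 n).symm)

end Combination

/-! ### Limit distributions -/

section Distribution

local notation "𝕋" => UnitAddCircle

variable {u : ℕ → ℝ} {M : ℕ → ℕ}

theorem isLimitDistribution_dirac {x : ℕ → 𝕋} {θ : 𝕋} (h : Tendsto x atTop (𝓝 θ))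
    (hM : Tendsto M atTop atTop) : IsLimitDistribution x M (Measure.dirac θ) := by
  intro l
  rw [integral_dirac]
  exact (tendsto_seqAverage (((fourier l).continuous.tendsto θ).comp h)).comp hM

theorem fourier_coe_eq_circleChar (l : ℤ) (t : ℝ) :
    fourier l (t : 𝕋) = circleChar ((l * t : ℝ) : 𝕋) := by
  rw [← circleChar_zsmul, ← AddCircle.coe_zsmul, zsmul_eq_mul]

/-- Fejér's theorem applied to l u for each frequency l ≠ 0. -/
theorem isLimitDistribution_volume {R : Subring (ℕ → ℝ)} (hR : IsHardySequenceRing R) (hu : u ∈ R)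
    (h0 : Tendsto (fwdDiff 1 u) atTop (𝓝 0))
    (h : Tendsto (fun n : ℕ => (n : ℝ) * fwdDiff 1 u n) atTop atTop ∨
      Tendsto (fun n : ℕ => (n : ℝ) * fwdDiff 1 u n) atTop atBot)
    (hM : Tendsto M atTop atTop) :
    IsLimitDistribution (fun n => (u n : 𝕋)) M volume := by
  intro l
  rw [integral_fourier_volume]
  by_cases hl : l = 0
  · simp only [hl, if_true, fourier_zero]
    exact (tendsto_seqAverage tendsto_const_nhds).comp hM
  rw [if_neg hl]
  simp only [fourier_coe_eq_circleChar]
  have hd : ∀ n, fwdDiff 1 (fun n => (l : ℝ) * u n) n = l * fwdDiff 1 u n := fun n => by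
    simp only [fwdDiff]; ring
  refine (tendsto_seqAverage_of_tendsto_mul_fwdDiff hR (hR.const_mul_mem hu l) ?_ ?_).comp hM
  · have := h0.const_mul (l : ℝ)
    rw [mul_zero] at this
    exact this.congr fun n => (hd n).symm
  · have hd' : ∀ n : ℕ, (n : ℝ) * fwdDiff 1 (fun n => (l : ℝ) * u n) n =
        l * (n * fwdDiff 1 u n) := fun n => by rw [hd]; ring
    simp only [hd']
    rcases lt_or_gt_of_ne hl with hk0 | hk0
    · have hk0' : (l : ℝ) < 0 := by exact_mod_cast hk0
      exact h.symm.imp (fun h => h.const_mul_atBot_of_neg hk0')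
        (fun h => h.const_mul_atTop_of_neg hk0')
    · have hk0' : (0 : ℝ) < l := by exact_mod_cast hk0
      exact h.imp (fun h => h.const_mul_atTop hk0') (fun h => h.const_mul_atBot hk0')

theorem IsLimitDistribution.unique {x : ℕ → 𝕋} {μ ν : Measure 𝕋} [IsFiniteMeasure μ]
    [IsFiniteMeasure ν] (hμ : IsLimitDistribution x M μ) (hν : IsLimitDistribution x M ν) :
    μ = ν :=
  circleMeasure_ext fun l => tendsto_nhds_unique (hμ l) (hν l)

theorem IsLimitDistribution.comp {x : ℕ → 𝕋} {μ : Measure 𝕋} (hμ : IsLimitDistribution x M μ)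
    {ψ : ℕ → ℕ} (hψ : Tendsto ψ atTop atTop) : IsLimitDistribution x (M ∘ ψ) μ :=
  fun l => (hμ l).comp hψ

/-! ### Wrapped exponential laws -/

/-- The exponential distribution on the half line. -/
noncomputable def halfLineExp : Measure ℝ :=
  (volume.restrict (Set.Ioi 0)).withDensity fun t => ENNReal.ofReal (Real.exp (-t))

theorem halfLineExp_absolutelyContinuous : halfLineExp ≪ volume :=
  (withDensity_absolutelyContinuous _ _).trans Measure.restrict_le_self.absolutelyContinuous

instance isProbabilityMeasure_halfLineExp : IsProbabilityMeasure halfLineExp := by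
  constructor
  rw [halfLineExp, withDensity_apply _ MeasurableSet.univ, Measure.restrict_univ,
    ← ofReal_integral_eq_lintegral_ofReal, integral_exp_neg_Ioi_zero, ENNReal.ofReal_one]
  · have h1 := integrableOn_exp_mul_Ioi (a := -1) (by norm_num) 0
    simp only [neg_one_mul] at h1
    exact h1
  · exact Eventually.of_forall fun t => (Real.exp_pos _).le

theorem integral_halfLineExp (f : ℝ → ℂ) :
    ∫ t, f t ∂halfLineExp = ∫ t in Set.Ioi (0 : ℝ), Complex.exp (-t) * f t := by
  rw [halfLineExp, integral_withDensity_eq_integral_toReal_smul (by fun_prop)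
    (Eventually.of_forall fun t => ENNReal.ofReal_lt_top)]
  refine integral_congr_ae (Eventually.of_forall fun t => ?_)
  simp only
  rw [ENNReal.toReal_ofReal (Real.exp_pos _).le, Complex.real_smul]
  push_cast
  rfl

/-- The law of `θ - c E mod 1`, where `E` is exponentially distributed. -/
noncomputable def wrappedExp (θ : 𝕋) (c : ℝ) : Measure 𝕋 :=
  halfLineExp.map fun t => θ - ((c * t : ℝ) : 𝕋)

theorem continuous_wrap (θ : 𝕋) (c : ℝ) : Continuous fun t : ℝ => θ - ((c * t : ℝ) : 𝕋) :=
  continuous_const.sub ((AddCircle.continuous_mk' (1 : ℝ)).comp (continuous_const.mul continuous_id))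

instance isProbabilityMeasure_wrappedExp (θ : 𝕋) (c : ℝ) : IsProbabilityMeasure (wrappedExp θ c) :=
  Measure.isProbabilityMeasure_map (continuous_wrap θ c).measurable.aemeasurable

/-- The factor 1/(1 + 2πi l c) is the Laplace transform of the exponential law; it is the one that
appears in the averages of e(l u(n)) when nΔu → c, which is why this law is introduced. -/
theorem integral_fourier_wrappedExp (θ : 𝕋) (c : ℝ) (l : ℤ) :
    ∫ x, fourier l x ∂(wrappedExp θ c) =
      fourier l θ / (1 + 2 * Real.pi * Complex.I * ((l * c : ℝ) : ℂ)) := by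
  rw [wrappedExp, integral_map (continuous_wrap θ c).measurable.aemeasurable
    (fourier l).continuous.aestronglyMeasurable, integral_halfLineExp]
  have h1 : ∀ t : ℝ, Complex.exp (-t) * fourier l (θ - ((c * t : ℝ) : 𝕋)) = fourier l θ *
      Complex.exp (-(1 + 2 * Real.pi * Complex.I * ((l * c : ℝ) : ℂ)) * t) := by
    intro t
    rw [← circleChar_zsmul, smul_sub, sub_eq_add_neg, ← smul_neg, ← AddCircle.coe_neg,
      ← AddCircle.coe_zsmul, circleChar_add, circleChar_zsmul, circleChar_coe, mul_left_comm,
      ← Complex.exp_add]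
    congr 2
    rw [zsmul_eq_mul]
    push_cast
    ring
  simp only [h1]
  rw [integral_const_mul, integral_exp_mul_complex_Ioi]
  · rw [Complex.ofReal_zero, mul_zero, Complex.exp_zero, neg_div_neg_eq, mul_one_div]
  · simp

/-- The preimage of a null set is a countable union of its lifts to unit intervals, each of which is
null. -/
theorem quasiMeasurePreserving_coe_unitAddCircle :
    Measure.QuasiMeasurePreserving (fun t : ℝ => (t : 𝕋)) := by
  refine ⟨AddCircle.measurable_mk', ?_⟩
  refine Measure.AbsolutelyContinuous.mk fun s hs h0 => ?_
  rw [Measure.map_apply AddCircle.measurable_mk' hs]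
  have h1 : (fun t : ℝ => (t : 𝕋)) ⁻¹' s =
      ⋃ n : ℤ, (fun t : ℝ => (t : 𝕋)) ⁻¹' s ∩ Set.Ioc (n : ℝ) (n + 1) := by
    rw [← Set.inter_iUnion, iUnion_Ioc_intCast, Set.inter_univ]
  rw [h1, measure_iUnion_null_iff]
  intro n
  have h2 := (UnitAddCircle.measurePreserving_mk n).measure_preimage hs.nullMeasurableSet
  rw [Measure.restrict_apply (AddCircle.measurable_mk' hs), h0] at h2
  exact h2

theorem wrappedExp_absolutelyContinuous (θ : 𝕋) {c : ℝ} (hc : c ≠ 0) :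
    wrappedExp θ c ≪ volume := by
  have h1 : Measure.QuasiMeasurePreserving (fun t : ℝ => c * t) := by
    refine ⟨measurable_const_mul c, ?_⟩
    rw [Real.map_volume_mul_left hc]
    exact Measure.smul_absolutelyContinuous
  have h2 : Measure.QuasiMeasurePreserving (fun x : 𝕋 => θ - x) :=
    quasiMeasurePreserving_sub_left_of_right_invariant volume θ
  have h3 := h2.comp (quasiMeasurePreserving_coe_unitAddCircle.comp h1)
  exact (halfLineExp_absolutelyContinuous.map h3.measurable).trans h3.absolutelyContinuous

theorem wrappedExp_zero (θ : 𝕋) : wrappedExp θ 0 = Measure.dirac θ :=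
  circleMeasure_ext fun l => by
    rw [integral_fourier_wrappedExp, integral_dirac]; simp

theorem tendsto_seqAverage_fourier_sub {c : ℝ}
    (h : Tendsto (fun n : ℕ => (n : ℝ) * fwdDiff 1 u n) atTop (𝓝 c)) (l : ℤ) :
    Tendsto (fun N => seqAverage (fun n => fourier l (u n : 𝕋)) N -
      fourier l (u N : 𝕋) / (1 + 2 * Real.pi * Complex.I * ((l * c : ℝ) : ℂ))) atTop (𝓝 0) := by
  simp only [fourier_coe_eq_circleChar]
  refine tendsto_seqAverage_sub_of_tendsto_mul_fwdDiff ?_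
  refine (h.const_mul (l : ℝ)).congr fun n => ?_
  simp only [fwdDiff]
  ring

theorem isLimitDistribution_wrappedExp {c : ℝ}
    (h : Tendsto (fun n : ℕ => (n : ℝ) * fwdDiff 1 u n) atTop (𝓝 c)) (hM : Tendsto M atTop atTop)
    {θ : 𝕋} (hθ : Tendsto (fun k => (u (M k) : 𝕋)) atTop (𝓝 θ)) :
    IsLimitDistribution (fun n => (u n : 𝕋)) M (wrappedExp θ c) := by
  intro l
  rw [integral_fourier_wrappedExp]
  have h1 := (tendsto_seqAverage_fourier_sub h l).comp hM
  have h2 := (((fourier l).continuous.tendsto θ).comp hθ).div_const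
    (1 + 2 * Real.pi * Complex.I * ((l * c : ℝ) : ℂ))
  have h3 := h1.add h2
  rw [zero_add] at h3
  exact h3.congr fun k => sub_add_cancel _ _

/-- By compactness u(M_k) mod 1 converges along a subsequence, and the limit distribution can be
computed there. -/
theorem IsLimitDistribution.eq_wrappedExp {c : ℝ}
    (h : Tendsto (fun n : ℕ => (n : ℝ) * fwdDiff 1 u n) atTop (𝓝 c)) (hM : Tendsto M atTop atTop)
    {lam : Measure 𝕋} [IsFiniteMeasure lam]
    (hlam : IsLimitDistribution (fun n => (u n : 𝕋)) M lam) : ∃ θ, lam = wrappedExp θ c := by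
  obtain ⟨θ, ψ, hψ, hθ⟩ := CompactSpace.tendsto_subseq fun k => (u (M k) : 𝕋)
  exact ⟨θ, (hlam.comp hψ.tendsto_atTop).unique
    (isLimitDistribution_wrappedExp h (hM.comp hψ.tendsto_atTop) hθ)⟩

/-! ### Cluster points of u modulo one, and non-uniqueness -/

/-- A sequence growing to infinity in steps smaller than ε overshoots the level t + z by less than ε
when it first passes it. -/
theorem mapClusterPt_coe_of_tendsto_atTop (h : Tendsto u atTop atTop)
    (h0 : Tendsto (fwdDiff 1 u) atTop (𝓝 0)) (θ : 𝕋) :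
    MapClusterPt θ atTop fun n => (u n : 𝕋) := by
  obtain ⟨t, rfl⟩ := QuotientAddGroup.mk_surjective θ
  rw [mapClusterPt_iff_frequently]
  intro U hU
  obtain ⟨ε, hε, hball⟩ := Metric.mem_nhds_iff.1
    ((AddCircle.continuous_mk' (1 : ℝ)).continuousAt.preimage_mem_nhds hU)
  rw [frequently_atTop]
  intro N
  obtain ⟨N', hN'⟩ := eventually_atTop.1 (h0.eventually (Metric.ball_mem_nhds 0 hε))
  set m₀ := max N N' with hm₀
  -- The level t + z lies above u(m₀), so the first passage occurs strictly after m₀ and has a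
  -- predecessor below the level.
  obtain ⟨z, hz⟩ := exists_int_gt (u m₀ - t)
  have hex : ∃ m, t + z ≤ u (m₀ + m) := by
    obtain ⟨m, hm⟩ := ((tendsto_atTop.1 h (t + z)).and (eventually_ge_atTop m₀)).exists
    exact ⟨m - m₀, by rw [Nat.add_sub_of_le hm.2]; exact hm.1⟩
  classical
  have hspec := Nat.find_spec hex
  set m := Nat.find hex with hm
  have hm0 : m ≠ 0 := by
    intro h1
    rw [h1, add_zero] at hspec
    linarith
  obtain ⟨m', hm'⟩ := Nat.exists_eq_succ_of_ne_zero hm0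
  have hmin : u (m₀ + m') < t + z := not_le.1 (Nat.find_min hex (by omega))
  have hstep := hN' (m₀ + m') (by omega)
  rw [dist_zero_right, Real.norm_eq_abs, fwdDiff, abs_lt] at hstep
  have hmm : m₀ + m' + 1 = m₀ + m := by omega
  rw [hmm] at hstep
  refine ⟨m₀ + m, by omega, ?_⟩
  have h2 : u (m₀ + m) - z ∈ Metric.ball t ε := by
    rw [Metric.mem_ball, Real.dist_eq, abs_lt]
    constructor <;> linarith
  have h3 := hball h2
  have h4 : ((u (m₀ + m) - z : ℝ) : 𝕋) = (u (m₀ + m) : 𝕋) := by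
    rw [AddCircle.coe_sub, sub_eq_self, AddCircle.coe_eq_zero_iff]
    exact ⟨z, by simp⟩
  rw [← h4]
  exact h3

theorem mapClusterPt_coe (h : Tendsto u atTop atTop ∨ Tendsto u atTop atBot)
    (h0 : Tendsto (fwdDiff 1 u) atTop (𝓝 0)) (θ : 𝕋) :
    MapClusterPt θ atTop fun n => (u n : 𝕋) := by
  rcases h with h | h
  · exact mapClusterPt_coe_of_tendsto_atTop h h0 θ
  · have h1 := mapClusterPt_coe_of_tendsto_atTop (u := -u) (tendsto_neg_atBot_atTop.comp h)
      (by rw [fwdDiff_neg_fun, ← neg_zero]; exact h0.neg) (-θ)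
    have h2 := h1.continuousAt_comp (continuous_neg (G := 𝕋)).continuousAt
    rw [neg_neg] at h2
    convert h2 using 2 with n
    simp

theorem exists_strictMono_tendsto_coe (h : Tendsto u atTop atTop ∨ Tendsto u atTop atBot)
    (h0 : Tendsto (fwdDiff 1 u) atTop (𝓝 0)) (θ : 𝕋) :
    ∃ M : ℕ → ℕ, StrictMono M ∧ (∀ k, 0 < M k) ∧
      Tendsto (fun k => (u (M k) : 𝕋)) atTop (𝓝 θ) := by
  obtain ⟨ψ, hψ, hθ⟩ := MapClusterPt.tendsto_subseq (mapClusterPt_coe h h0 θ)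
  exact ⟨fun k => ψ (k + 1), hψ.comp (strictMono_id.add_const 1), fun k =>
    (Nat.zero_le _).trans_lt (hψ (Nat.lt_succ_self k)), hθ.comp (tendsto_add_atTop_nat 1)⟩

/-- Every θ is a limit of u(M_k) for some (M_k), and the first Fourier coefficient of the
corresponding law is e(θ) divided by a constant; uniqueness would make e(θ) independent of θ. -/
theorem not_isLimitDistribution_id {c : ℝ}
    (h : Tendsto (fun n : ℕ => (n : ℝ) * fwdDiff 1 u n) atTop (𝓝 c))
    (hu : Tendsto u atTop atTop ∨ Tendsto u atTop atBot) (h0 : Tendsto (fwdDiff 1 u) atTop (𝓝 0))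
    (lam : Measure 𝕋) : ¬ IsLimitDistribution (fun n => (u n : 𝕋)) (fun N => N) lam := by
  intro hlam
  have key : ∀ θ : 𝕋, circleChar θ = (∫ x, fourier 1 x ∂lam) *
      (1 + 2 * Real.pi * Complex.I * ((((1 : ℤ) : ℝ) * c : ℝ) : ℂ)) := by
    intro θ
    obtain ⟨M, hM, -, hθ⟩ := exists_strictMono_tendsto_coe hu h0 θ
    have h1 := isLimitDistribution_wrappedExp h hM.tendsto_atTop hθ 1
    have h2 := tendsto_nhds_unique h1 ((hlam 1).comp hM.tendsto_atTop)
    have h3 : (1 + 2 * Real.pi * Complex.I * ((((1 : ℤ) : ℝ) * c : ℝ) : ℂ)) ≠ 0 := by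
      intro h4
      simpa using congrArg Complex.re h4
    rw [← h2, integral_fourier_wrappedExp, div_mul_cancel₀ _ h3, ← circleChar_zsmul, one_zsmul]
  obtain ⟨a, ha⟩ := exists_fourier_ne_one one_ne_zero
  rw [← circleChar_zsmul, one_zsmul, key, ← key 0, circleChar_zero] at ha
  exact ha rfl

end Distribution

/-! ### Unipotent affine transformations of the torus -/

section Affine

local notation "𝕋" => UnitAddCircle

variable {d : ℕ}

/-- The restriction of `unipotentMap` to the fibre over `β`. -/
noncomputable def unipotentFibreMap (d : ℕ) (β : 𝕋) (y : Fin d → 𝕋) : Fin d → 𝕋 :=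
  Fin.tail (unipotentMap d (Fin.cons β y : Fin (d + 1) → 𝕋))

theorem cons_unipotentFibreMap (β : 𝕋) (y : Fin d → 𝕋) :
    (Fin.cons β (unipotentFibreMap d β y) : Fin (d + 1) → 𝕋) = unipotentMap d (Fin.cons β y) :=
  Fin.cons_self_tail (unipotentMap d (Fin.cons β y : Fin (d + 1) → 𝕋))

theorem cons_iterate_unipotentFibreMap (β : 𝕋) (y : Fin d → 𝕋) (n : ℕ) :
    (Fin.cons β ((unipotentFibreMap d β)^[n] y) : Fin (d + 1) → 𝕋) =
      (unipotentMap d)^[n] (Fin.cons β y) := by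
  induction n with
  | zero => rfl
  | succ n ih =>
    rw [Function.iterate_succ_apply', Function.iterate_succ_apply', ← ih, cons_unipotentFibreMap]

theorem continuous_fin_cons (β : 𝕋) : Continuous fun y : Fin d → 𝕋 =>
    (Fin.cons β y : Fin (d + 1) → 𝕋) :=
  continuous_const.finCons continuous_id

theorem continuous_fin_tail : Continuous fun y : Fin (d + 1) → 𝕋 => (Fin.tail y : Fin d → 𝕋) :=
  continuous_pi fun j => continuous_apply j.succ

theorem continuous_unipotentFibreMap (β : 𝕋) : Continuous (unipotentFibreMap d β) :=
  continuous_fin_tail.comp (continuous_unipotentMap.comp (continuous_fin_cons β))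

theorem cons_tail_unipotentInv (y : Fin d → 𝕋) :
    (Fin.cons 0 (Fin.tail (unipotentInv d (Fin.cons 0 y : Fin (d + 1) → 𝕋))) : Fin (d + 1) → 𝕋) =
      unipotentInv d (Fin.cons 0 y) :=
  Fin.cons_self_tail (unipotentInv d (Fin.cons 0 y : Fin (d + 1) → 𝕋))

/-- The linear part of `unipotentFibreMap`. -/
noncomputable def unipotentFibreAut (d : ℕ) : (Fin d → 𝕋) ≃ₜ+ (Fin d → 𝕋) where
  toFun := unipotentFibreMap d 0
  invFun y := Fin.tail (unipotentInv d (Fin.cons 0 y : Fin (d + 1) → 𝕋))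
  left_inv y := by
    beta_reduce
    rw [cons_unipotentFibreMap]
    exact congrArg Fin.tail ((unipotentAut d).symm_apply_apply (Fin.cons 0 y : Fin (d + 1) → 𝕋))
  right_inv y := by
    rw [unipotentFibreMap, cons_tail_unipotentInv]
    exact congrArg Fin.tail ((unipotentAut d).apply_symm_apply (Fin.cons 0 y : Fin (d + 1) → 𝕋))
  map_add' x y := by
    have h : (Fin.cons 0 (x + y) : Fin (d + 1) → 𝕋) = Fin.cons 0 x + Fin.cons 0 y := by
      ext i
      induction i using Fin.cases <;> simp
    rw [unipotentFibreMap, h, unipotentMap_add]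
    rfl
  continuous_toFun := continuous_unipotentFibreMap 0
  continuous_invFun := continuous_fin_tail.comp (continuous_unipotentInv.comp
    (continuous_fin_cons 0))

theorem isTorusAffine_unipotentFibreMap (β : 𝕋) : IsTorusAffine (unipotentFibreMap d β) := by
  refine ⟨unipotentFibreAut d, unipotentFibreMap d β 0, fun y => ?_⟩
  have h : (Fin.cons β y : Fin (d + 1) → 𝕋) = Fin.cons 0 y + Fin.cons β (0 : Fin d → 𝕋) := by
    ext i
    induction i using Fin.cases <;> simp
  rw [unipotentFibreMap, h, unipotentMap_add]
  rfl

theorem integral_mFourier_volume (k : Fin d → ℤ) :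
    ∫ y : Fin d → 𝕋, UnitAddTorus.mFourier k y = if k = 0 then 1 else 0 := by
  have h : ∫ y : Fin d → 𝕋, UnitAddTorus.mFourier k y = ∏ i, ∫ x : 𝕋, fourier (k i) x :=
    integral_fintype_prod_volume_eq_prod (fun i (x : 𝕋) => (fourier (k i) x : ℂ))
  rw [h]
  simp only [integral_fourier_volume]
  split_ifs with h0
  · simp [h0]
  · obtain ⟨j, hj⟩ := Function.ne_iff.1 h0
    exact Finset.prod_eq_zero (Finset.mem_univ j) (if_neg hj)

theorem mFourier_cons (k : Fin (d + 1) → ℤ) (β : 𝕋) (y : Fin d → 𝕋) :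
    UnitAddTorus.mFourier k (Fin.cons β y : Fin (d + 1) → 𝕋) =
      fourier (k 0) β * UnitAddTorus.mFourier (Fin.tail k) y := by
  rw [mFourier_apply_eq, mFourier_apply_eq, Fin.sum_univ_succ, circleChar_add, Fin.cons_zero,
    circleChar_zsmul]
  simp only [Fin.cons_succ, Fin.tail]

/-- This identifies the system over a point mass at β with a system on 𝕋^d, by dropping the constant
zeroth coordinate. -/
theorem map_cons_volume (β : 𝕋) :
    (volume : Measure (Fin d → 𝕋)).map (fun y => (Fin.cons β y : Fin (d + 1) → 𝕋)) =
      unipotentMeasure d (Measure.dirac β) := by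
  have hm := (continuous_fin_cons (d := d) β).measurable.aemeasurable (μ := volume)
  have := Measure.isProbabilityMeasure_map hm
  refine torusMeasure_ext fun k => ?_
  rw [integral_map hm (UnitAddTorus.mFourier k).continuous.aestronglyMeasurable,
    integral_mFourier_unipotentMeasure, integral_dirac]
  simp only [mFourier_cons]
  rw [integral_const_mul, integral_mFourier_volume]
  have hiff : Fin.tail k = 0 ↔ ∀ j : Fin d, k j.succ = 0 := funext_iff
  simp only [hiff]
  split_ifs <;> simp

theorem measurePreserving_unipotentFibreMap (β : 𝕋) :
    MeasurePreserving (unipotentFibreMap d β) volume volume := by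
  have hc := (continuous_fin_cons (d := d) β).measurable
  have ht := (continuous_fin_tail (d := d)).measurable
  refine ⟨(continuous_unipotentFibreMap β).measurable, ?_⟩
  have h1 := (measurePreserving_unipotentMap (d := d) (Measure.dirac β)).map_eq
  have h2 := congrArg (Measure.map fun y => (Fin.tail y : Fin d → 𝕋)) h1
  rw [← map_cons_volume, Measure.map_map continuous_unipotentMap.measurable hc,
    Measure.map_map ht (continuous_unipotentMap.measurable.comp hc), Measure.map_map ht hc] at h2
  have h3 : (fun y => (Fin.tail y : Fin d → 𝕋)) ∘ (fun y => (Fin.cons β y : Fin (d + 1) → 𝕋)) =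
      id := funext fun y => Fin.tail_cons (α := fun _ => 𝕋) β y
  rw [h3, Measure.map_id] at h2
  exact h2

theorem systemsIsomorphic_unipotentFibreMap {Y : Type*} [TopologicalSpace Y] (e : 𝕋 ≃ₜ Y)
    [MeasurableSpace Y] [SecondCountableTopology Y] [BorelSpace Y] [T2Space Y] (β : 𝕋) :
    SystemsIsomorphic ((unipotentMeasure d (Measure.dirac β)).map (unipotentCode e d)) seqShift
      volume (unipotentFibreMap d β) := by
  rw [← map_cons_volume, Measure.map_map (continuous_unipotentCode e).measurable
    (continuous_fin_cons β).measurable]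
  refine systemsIsomorphic_of_leftInverse (measurePreserving_unipotentFibreMap β)
    ((continuous_unipotentCode e).comp (continuous_fin_cons β)).measurable
    (P := fun z => Fin.tail (unipotentDecode e d z))
    (continuous_fin_tail.comp (continuous_unipotentDecode e)).measurable (fun y => ?_) fun y => ?_
  · simp only [Function.comp, unipotentDecode_unipotentCode, Fin.tail_cons]
  · simp only [Function.comp, cons_unipotentFibreMap, unipotentCode_unipotentMap]

/-! ### Total ergodicity -/

/-- The first difference of j ↦ c(nj) is m ↦ c(m+n) - c(m) sampled along multiples of n, and this
telescopes into n differences; each order of differencing contributes a factor n. -/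
theorem tendsto_fwdDiff_iter_comp_mul {G : Type*} [AddCommGroup G] [TopologicalSpace G]
    [IsTopologicalAddGroup G] {c : ℕ → G} {θ : G} (J : ℕ) (h : Tendsto ((fwdDiff 1)^[J] c) atTop (𝓝 θ))
    {n : ℕ} (hn : 0 < n) :
    Tendsto ((fwdDiff 1)^[J] fun j => c (n * j)) atTop (𝓝 (n ^ J • θ)) := by
  induction J generalizing c θ with
  | zero =>
    rw [pow_zero, one_smul]
    exact h.comp (tendsto_id.const_mul_atTop' hn)
  | succ J ih =>
    have h1 : Tendsto ((fwdDiff 1)^[J] fun m => c (m + n) - c m) atTop (𝓝 (n • θ)) :=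
      (tendsto_sum_shift h n).congr fun m => (fwdDiff_iter_difference c J n m).symm
    have h2 := ih h1
    rw [← mul_smul, ← pow_succ] at h2
    exact h2

theorem fwdDiff_iter_iterate_unipotentMap (z : Fin (d + 1) → 𝕋) (k : ℕ) (hk : k ≤ d) (n : ℕ) :
    (fwdDiff 1)^[k] (fun n => (unipotentMap d)^[n] z (Fin.last d)) n =
      (unipotentMap d)^[n] z ⟨d - k, by omega⟩ := by
  induction k generalizing n with
  | zero => rfl
  | succ k ih =>
    have h1 : (⟨d - k, by omega⟩ : Fin (d + 1)) = Fin.succ ⟨d - (k + 1), by omega⟩ := by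
      ext; simp; omega
    rw [Function.iterate_succ_apply', fwdDiff, ih (by omega), ih (by omega),
      Function.iterate_succ_apply' (unipotentMap d), h1, unipotentMap_succ, add_sub_cancel_left]
    rfl

theorem differencePoint_iterate_unipotentMap (z : Fin (d + 1) → 𝕋) (n : ℕ) :
    differencePoint d (fun n => (unipotentMap d)^[n] z (Fin.last d)) n = (unipotentMap d)^[n] z := by
  funext i
  rw [differencePoint, fwdDiff_iter_iterate_unipotentMap z _ (Nat.sub_le _ _)]
  exact congrArg _ (Fin.ext (by simp only; omega))

theorem iterate_unipotentMap_zero (z : Fin (d + 1) → 𝕋) (n : ℕ) :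
    (unipotentMap d)^[n] z 0 = z 0 := by
  induction n with
  | zero => rfl
  | succ n ih => rw [Function.iterate_succ_apply', unipotentMap_zero, ih]

/-- Every orbit of the n-th power is equidistributed: along it the phase has a difference converging
to n^(J+1) k_J β, of infinite order, and Weyl's theorem applies. -/
theorem tendsto_seqAverage_mFourier_iterate {β : 𝕋} (hβ : (∀ n : ℕ, 0 < n → n • β ≠ 0) ∨ d = 0)
    {n : ℕ} (hn : 0 < n) {k : Fin d → ℤ} (hk : k ≠ 0) (y : Fin d → 𝕋) :
    Tendsto (seqAverage fun j => UnitAddTorus.mFourier k (((unipotentFibreMap d β)^[n])^[j] y)) atTop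
      (𝓝 0) := by
  set x : ℕ → 𝕋 := fun m => (unipotentMap d)^[m] (Fin.cons β y) (Fin.last d) with hx
  set k' : Fin (d + 1) → ℤ := Fin.cons 0 k with hk'
  have hk'0 : ¬ ∀ j : Fin d, k' j.succ = 0 := by
    intro h
    exact hk (funext fun j => by simpa [hk'] using h j)
  obtain ⟨J, hkJ, hJ⟩ := exists_last_ne_zero hk'0
  have hβ' := hβ.resolve_right (by have := J.2; omega)
  have hd : ∀ m, (fwdDiff 1)^[d] x m = β := by
    intro m
    rw [hx, fwdDiff_iter_iterate_unipotentMap _ _ le_rfl]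
    simp only [Nat.sub_self]
    exact iterate_unipotentMap_zero _ m
  have h0 : Tendsto ((fwdDiff 1)^[d + 1] x) atTop (𝓝 0) := by
    refine tendsto_const_nhds.congr fun m => ?_
    rw [Function.iterate_succ_apply', fwdDiff, hd, hd, sub_self]
  set c : ℕ → 𝕋 := fun m => ∑ i : Fin (d + 1), k' i • (fwdDiff 1)^[d - i] x m with hc
  have h1 : Tendsto ((fwdDiff 1)^[(J.succ : ℕ)] c) atTop (𝓝 (k' J.succ • β)) := by
    have := (tendsto_fwdDiff_iter_combination h0 k' J.succ hJ).add_const (k' J.succ • β)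
    rw [zero_add] at this
    refine this.congr fun m => ?_
    rw [hd, sub_add_cancel]
  have h2 := tendsto_fwdDiff_iter_comp_mul _ h1 hn
  refine (tendsto_seqAverage_of_fwdDiff_iter_tendsto J (fun m hm => ?_) h2).congr fun N => ?_
  · rw [← mul_smul]
    exact nsmul_zsmul_ne_zero hβ' hkJ (by positivity)
  · congr 1
    ext j
    rw [hc, ← mFourier_differencePoint, hx, differencePoint_iterate_unipotentMap,
      ← cons_iterate_unipotentFibreMap, mFourier_cons, ← Function.iterate_mul]
    simp [hk']

/-- For an invariant set s, the integral over s of a non-trivial character equals that of its orbit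
averages, which tend to zero. So the indicator of s has only a constant Fourier coefficient. -/
theorem totallyErgodic_unipotentFibreMap {β : 𝕋} (hβ : (∀ n : ℕ, 0 < n → n • β ≠ 0) ∨ d = 0) :
    TotallyErgodic volume (unipotentFibreMap d β) := by
  intro n hn
  set T := (unipotentFibreMap d β)^[n] with hT
  have hTp : MeasurePreserving T volume volume := (measurePreserving_unipotentFibreMap β).iterate n
  refine ⟨hTp, ⟨fun s hs hsT => ?_⟩⟩
  have hint : ∀ k : Fin d → ℤ, k ≠ 0 → ∫ y in s, UnitAddTorus.mFourier k y = 0 := by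
    intro k hk
    have hTs : MeasurePreserving T (volume.restrict s) (volume.restrict s) := by
      have := hTp.restrict_preimage hs
      rwa [hsT] at this
    have hinv : ∀ j : ℕ, ∫ y in s, UnitAddTorus.mFourier k (T^[j] y) =
        ∫ y in s, UnitAddTorus.mFourier k y := by
      intro j
      have h1 := hTs.iterate j
      rw [← integral_map (f := fun y => UnitAddTorus.mFourier k y) h1.measurable.aemeasurable
        (UnitAddTorus.mFourier k).continuous.aestronglyMeasurable, h1.map_eq]
    have hnorm : ∀ y, ‖(UnitAddTorus.mFourier k y : ℂ)‖ ≤ 1 := fun y => by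
      rw [mFourier_apply_eq, norm_circleChar]
    have hTc : ∀ j, Continuous (T^[j]) := fun j =>
      ((continuous_unipotentFibreMap β).iterate n).iterate j
    have hcont : ∀ j, Continuous fun y => (UnitAddTorus.mFourier k (T^[j] y) : ℂ) := fun j =>
      (UnitAddTorus.mFourier k).continuous.comp (hTc j)
    have hint : ∀ j, Integrable (fun y => (UnitAddTorus.mFourier k (T^[j] y) : ℂ))
        (volume.restrict s) := fun j =>
      Integrable.of_bound (hcont j).aestronglyMeasurable 1 (Eventually.of_forall fun y => hnorm _)
    have h2 : Tendsto (fun N => ∫ y in s, seqAverage (fun j => UnitAddTorus.mFourier k (T^[j] y)) N)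
        atTop (𝓝 (∫ y in s, (0 : ℂ))) := by
      refine tendsto_integral_of_dominated_convergence (fun _ => 1) (fun N => ?_)
        (integrable_const _) (fun N => Eventually.of_forall fun y => norm_seqAverage_le
          (fun j => hnorm _) N) (Eventually.of_forall fun y =>
          tendsto_seqAverage_mFourier_iterate hβ hn hk y)
      exact (Continuous.div_const (continuous_finsetSum _ fun j _ => hcont j)
        _).aestronglyMeasurable
    rw [integral_zero] at h2
    refine tendsto_nhds_unique (tendsto_const_nhds.congr' ?_) h2
    filter_upwards [eventually_gt_atTop 0] with N hN
    have hN' : (N : ℂ) ≠ 0 := Nat.cast_ne_zero.2 hN.ne'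
    simp only [seqAverage]
    rw [integral_div, integral_finsetSum _ fun j _ => hint j]
    simp only [hinv, Finset.sum_const, Nat.card_Icc, Nat.add_sub_cancel, nsmul_eq_mul]
    rw [mul_div_cancel_left₀ _ hN']
  have hmeas : (volume : Measure (Fin d → 𝕋)).restrict s =
      (volume s) • (volume : Measure (Fin d → 𝕋)) := by
    have : IsFiniteMeasure ((volume s) • (volume : Measure (Fin d → 𝕋))) :=
      Measure.smul_finite _ (measure_ne_top _ _)
    refine torusMeasure_ext fun k => ?_
    rw [integral_smul_measure, integral_mFourier_volume]
    by_cases hk : k = 0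
    · simp [hk, mFourier_apply_eq, circleChar_zero, Measure.real]
    · rw [hint k hk, if_neg hk, smul_zero]
  -- Evaluating at the complement gives m(s) m(sᶜ) = 0.
  have h3 := congrArg (fun μ => μ sᶜ) hmeas
  simp only [Measure.restrict_apply hs.compl, Set.compl_inter_self, measure_empty,
    Measure.smul_apply, smul_eq_mul] at h3
  rw [Filter.eventuallyConst_set']
  rcases mul_eq_zero.1 h3.symm with h | h
  · exact Or.inl (ae_eq_empty.2 h)
  · exact Or.inr (ae_eq_univ.2 h)

end Affine

/-! ### The description of the Furstenberg systems -/

section Description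

local notation "𝕋" => UnitAddCircle

theorem nsmul_coe_ne_zero_of_irrational {α : ℝ} (hα : Irrational α) {n : ℕ} (hn : 0 < n) :
    n • (α : 𝕋) ≠ 0 := by
  rw [← AddCircle.coe_nsmul, Ne, AddCircle.coe_eq_zero_iff]
  rintro ⟨z, hz⟩
  rw [zsmul_eq_mul, mul_one, nsmul_eq_mul] at hz
  exact (hα.natCast_mul hn.ne').ne_int z hz.symm

variable {Y : Type*} [TopologicalSpace Y] (e : 𝕋 ≃ₜ Y) [MeasurableSpace Y]
  [SecondCountableTopology Y] [BorelSpace Y]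
  {d : ℕ} {x : ℕ → 𝕋} {b : ℤ → Y}

theorem hasUniqueFurstenbergSystem_of_isLimitDistribution (hx : IsAsymptoticallyUnipotent d x)
    (hb : ∀ n : ℕ, 0 < n → b n = e (x n)) {lam : Measure 𝕋} [IsProbabilityMeasure lam]
    (hlam : IsLimitDistribution ((fwdDiff 1)^[d] x) (fun N => N) lam) :
    HasUniqueFurstenbergSystem b :=
  ⟨_, isFurstenbergLimit_map e hx hb tendsto_id hlam⟩

variable [T2Space Y] [HasOuterApproxClosed (ℤ → Y)]

theorem IsAsymptoticallyUnipotent.exists_isoToUnipotent (hx : IsAsymptoticallyUnipotent d x)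
    (hb : ∀ n : ℕ, 0 < n → b n = e (x n)) {μ : Measure (ℤ → Y)} (h : IsFurstenbergSystem b μ) :
    ∃ (M : ℕ → ℕ) (lam : Measure 𝕋), Tendsto M atTop atTop ∧ IsProbabilityMeasure lam ∧
      IsLimitDistribution ((fwdDiff 1)^[d] x) M lam ∧
      μ = (unipotentMeasure d lam).map (unipotentCode e d) ∧ IsoToUnipotent μ d lam := by
  obtain ⟨M, hM, -, hμ⟩ := h
  obtain ⟨lam, hp, hlam, rfl⟩ := hμ.eq_map e hx hb hM.tendsto_atTop
  exact ⟨M, lam, hM.tendsto_atTop, hp, hlam, rfl, isoToUnipotent_map e lam⟩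

variable {a : ℝ → ℝ} {R : Subring (ℕ → ℝ)}

theorem pow_isLittleO_pow_mul_log (d : ℕ) :
    (fun t : ℝ => t ^ d) =o[atTop] (fun t : ℝ => t ^ d * Real.log t) := by
  have h := (isBigO_refl (fun t : ℝ => t ^ d) atTop).mul_isLittleO
    (Real.isLittleO_const_log_atTop (c := 1))
  simpa using h

theorem fwdDiff_iter_coe_eq (s : ℕ → ℝ) (d : ℕ) :
    (fwdDiff 1)^[d] (fun n => (s n : 𝕋)) = fun n => (((fwdDiff 1)^[d] s n : ℝ) : 𝕋) :=
  funext (fwdDiff_iter_coe s d)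

/-- The behaviour of the differences of `a(n)` for `t ^ d ≺ a(t) ≺ t ^ (d + 1)`. -/
theorem isAsymptoticallyUnipotent_of_growth (hR : IsHardySequenceRing R)
    (ha : (fun n : ℕ => a n) ∈ R) (h1 : (fun t : ℝ => t ^ d) =o[atTop] a)
    (h2 : a =o[atTop] (fun t : ℝ => t ^ (d + 1))) :
    (Tendsto ((fwdDiff 1)^[d] fun n : ℕ => a n) atTop atTop ∨
      Tendsto ((fwdDiff 1)^[d] fun n : ℕ => a n) atTop atBot) ∧
    Tendsto (fwdDiff 1 ((fwdDiff 1)^[d] fun n : ℕ => a n)) atTop (𝓝 0) ∧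
    IsAsymptoticallyUnipotent d (fun n : ℕ => (a n : 𝕋)) := by
  have h3 := tendsto_fwdDiff_iter_of_pow_isLittleO hR ha
    (h1.comp_tendsto tendsto_natCast_atTop_atTop)
  have h4 := tendsto_fwdDiff_iter_of_isLittleO hR ha
    (h2.comp_tendsto tendsto_natCast_atTop_atTop)
  refine ⟨h3, ?_, isAsymptoticallyUnipotent_of_tendsto_atTop hR ha h3 h4⟩
  rwa [Function.iterate_succ_apply'] at h4

theorem furstenbergSystems_of_growthAboveLog (hR : IsHardySequenceRing R)
    (ha : (fun n : ℕ => a n) ∈ R) (hb : ∀ n : ℕ, 0 < n → b n = e (a n : 𝕋))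
    (h : GrowthAboveLog d a) : HasUniqueFurstenbergSystem b ∧
      ∀ μ, IsFurstenbergSystem b μ → IsoToUnipotent μ d volume := by
  obtain ⟨-, h0, hx⟩ := isAsymptoticallyUnipotent_of_growth hR ha
    ((pow_isLittleO_pow_mul_log d).trans h.1) h.2
  have hlog : logScale (d + 1) =o[atTop] fun n : ℕ => a n :=
    h.1.comp_tendsto tendsto_natCast_atTop_atTop
  have hmul := tendsto_mul_fwdDiff_of_log_isLittleO hR ha hlog
  simp only [Function.iterate_succ_apply'] at hmul
  have hlim : ∀ M : ℕ → ℕ, Tendsto M atTop atTop →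
      IsLimitDistribution ((fwdDiff 1)^[d] fun n : ℕ => (a n : 𝕋)) M volume := by
    intro M hM
    rw [fwdDiff_iter_coe_eq fun n : ℕ => a n]
    exact isLimitDistribution_volume hR (hR.fwdDiff_iter_mem ha d) h0 hmul hM
  refine ⟨hasUniqueFurstenbergSystem_of_isLimitDistribution e hx hb (hlim _ tendsto_id),
    fun μ hμ => ?_⟩
  obtain ⟨M, lam, hM, hp, hlam, -, hiso⟩ := hx.exists_isoToUnipotent e hb hμ
  rwa [← hlam.unique (hlim M hM)]

/-- Treats the regimes at and below t^d log t together: c ≠ 0 yields absolutely continuous laws, and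
c = 0 yields point masses. -/
theorem furstenbergSystems_of_tendsto_mul_fwdDiff (hR : IsHardySequenceRing R)
    (ha : (fun n : ℕ => a n) ∈ R) (hb : ∀ n : ℕ, 0 < n → b n = e (a n : 𝕋))
    (h1 : (fun t : ℝ => t ^ d) =o[atTop] a) (h2 : a =o[atTop] (fun t : ℝ => t ^ (d + 1))) {c : ℝ}
    (hc : Tendsto (fun n : ℕ => (n : ℝ) * (fwdDiff 1)^[d + 1] (fun n : ℕ => a n) n) atTop (𝓝 c)) :
    ¬ HasUniqueFurstenbergSystem b ∧
    (∀ μ, IsFurstenbergSystem b μ → ∃ θ, IsoToUnipotent μ d (wrappedExp θ c)) ∧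
    ∀ θ, ∃ μ, IsFurstenbergSystem b μ ∧ IsoToUnipotent μ d (wrappedExp θ c) := by
  obtain ⟨hu, h0, hx⟩ := isAsymptoticallyUnipotent_of_growth hR ha h1 h2
  simp only [Function.iterate_succ_apply'] at hc
  have hcoe := fwdDiff_iter_coe_eq (fun n : ℕ => a n) d
  refine ⟨fun hun => ?_, fun μ hμ => ?_, fun θ => ?_⟩
  · obtain ⟨μ, hμ⟩ := hun
    obtain ⟨lam, hp, hlam, -⟩ := hμ.eq_map e hx hb tendsto_id
    rw [hcoe] at hlam
    exact not_isLimitDistribution_id hc hu h0 lam hlam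
  · obtain ⟨M, lam, hM, hp, hlam, -, hiso⟩ := hx.exists_isoToUnipotent e hb hμ
    rw [hcoe] at hlam
    obtain ⟨θ, rfl⟩ := hlam.eq_wrappedExp hc hM
    exact ⟨θ, hiso⟩
  · obtain ⟨M, hM, hM0, hθ⟩ := exists_strictMono_tendsto_coe hu h0 θ
    have hlam := isLimitDistribution_wrappedExp hc hM.tendsto_atTop hθ
    rw [← hcoe] at hlam
    exact ⟨_, ⟨M, hM, hM0, isFurstenbergLimit_map e hx hb hM.tendsto_atTop hlam⟩,
      isoToUnipotent_map e _⟩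

theorem furstenbergSystems_of_growthPolynomial (hR : IsHardySequenceRing R)
    (ha : (fun n : ℕ => a n) ∈ R) (hb : ∀ n : ℕ, 0 < n → b n = e (a n : 𝕋)) {α : ℝ}
    (h : GrowthPolynomial d α a) : HasUniqueFurstenbergSystem b ∧
    ∀ μ, IsFurstenbergSystem b μ →
      IsoToUnipotent μ d (Measure.dirac (((d.factorial : ℝ) * α : ℝ) : 𝕋)) ∧
      ∃ R : (Fin d → 𝕋) → (Fin d → 𝕋),
        IsTorusAffine R ∧ TotallyErgodic volume R ∧ SystemsIsomorphic μ seqShift volume R := by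
  set β : 𝕋 := ((d.factorial * α : ℝ) : 𝕋) with hβ
  have h1 := tendsto_fwdDiff_iter_of_polynomial hR ha
    (h.2.comp_tendsto tendsto_natCast_atTop_atTop)
  have h2 : Tendsto ((fwdDiff 1)^[d] fun n : ℕ => (a n : 𝕋)) atTop (𝓝 β) := by
    rw [fwdDiff_iter_coe_eq fun n : ℕ => a n]
    exact ((AddCircle.continuous_mk' (1 : ℝ)).tendsto _).comp h1
  have h3 : (∀ n : ℕ, 0 < n → n • β ≠ 0) ∨ d = 0 := h.1.imp_left fun hα n hn =>
    nsmul_coe_ne_zero_of_irrational (hα.natCast_mul d.factorial_ne_zero) hn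
  have hx := isAsymptoticallyUnipotent_of_tendsto h3 h2
  refine ⟨hasUniqueFurstenbergSystem_of_isLimitDistribution e hx hb
    (isLimitDistribution_dirac h2 tendsto_id), fun μ hμ => ?_⟩
  obtain ⟨M, lam, hM, hp, hlam, hμ', hiso⟩ := hx.exists_isoToUnipotent e hb hμ
  obtain rfl := hlam.unique (isLimitDistribution_dirac h2 hM)
  refine ⟨hiso, _, isTorusAffine_unipotentFibreMap β, totallyErgodic_unipotentFibreMap h3, ?_⟩
  rw [hμ']
  exact systemsIsomorphic_unipotentFibreMap e β

/-- The values in 𝕋 and in the unit circle are handled at once through a homeomorphism `e`, since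
only the topology of the target matters for the coding. -/
theorem furstenbergDescription (φ : ℝ → Y) (hφ : ∀ t : ℝ, φ t = e (t : 𝕋))
    (ha : IsHardyFieldFunction a) (hpoly : AtMostPolynomialGrowth a)
    (hb : ∀ n : ℕ, 0 < n → b n = φ (a n)) : FurstenbergDescription φ a b := by
  obtain ⟨R, hR, haR⟩ := ha.exists_sequenceRing
  have hb' : ∀ n : ℕ, 0 < n → b n = e (a n : 𝕋) := fun n hn => by rw [hb n hn, hφ]
  constructor
  · exact fun d h => furstenbergSystems_of_growthAboveLog e hR haR hb' h
  · rintro d ⟨c, hc, h⟩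
    have hΘ := isTheta_of_tendsto_div hc h
    obtain ⟨c', hc', hmul⟩ := tendsto_mul_fwdDiff_of_isTheta_log (d := d) hR haR
      ⟨hΘ.1.comp_tendsto tendsto_natCast_atTop_atTop, hΘ.2.comp_tendsto tendsto_natCast_atTop_atTop⟩
    obtain ⟨h1, h2, -⟩ := furstenbergSystems_of_tendsto_mul_fwdDiff e hR haR hb'
      ((pow_isLittleO_pow_mul_log d).trans_isBigO hΘ.2)
      (hΘ.1.trans_isLittleO (pow_mul_log_isLittleO d)) hmul
    refine ⟨h1, fun μ hμ => ?_⟩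
    obtain ⟨θ, hθ⟩ := h2 μ hμ
    exact ⟨_, inferInstance, wrappedExp_absolutelyContinuous θ hc', hθ⟩
  · intro d h
    have hmul := tendsto_mul_fwdDiff_of_isLittleO_log (d := d) hR haR
      (h.2.comp_tendsto tendsto_natCast_atTop_atTop)
    have key := furstenbergSystems_of_tendsto_mul_fwdDiff e hR haR hb' h.1
      (h.2.trans (pow_mul_log_isLittleO d)) hmul
    simpa only [wrappedExp_zero] using key
  · exact fun d α h => furstenbergSystems_of_growthPolynomial e hR haR hb' h
  · intro _
    refine exists_covered_subsequences φ (fun t z => ?_) ha hpoly hb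
    rw [hφ, hφ, AddCircle.coe_add]
    have hz : ((z : ℝ) : 𝕋) = 0 := (AddCircle.coe_eq_zero_iff (1 : ℝ)).2 ⟨z, by simp⟩
    rw [hz, add_zero]

end Description

theorem theorem1p1 (a : ℝ → ℝ) (ha : IsHardyFieldFunction a) (hpoly : AtMostPolynomialGrowth a) :
    (∀ b : ℤ → UnitAddCircle,
      (∀ n : ℕ, 0 < n → b n = ((a n : ℝ) : UnitAddCircle)) →
      FurstenbergDescription (fun t : ℝ => (t : UnitAddCircle)) a b) ∧
    (∀ b : ℤ → Circle,
      (∀ n : ℕ, 0 < n → b n = Circle.exp (2 * Real.pi * a n)) →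
      FurstenbergDescription (fun t : ℝ => Circle.exp (2 * Real.pi * t)) a b) := by
  refine ⟨fun b hb => furstenbergDescription (Homeomorph.refl UnitAddCircle) _ (fun _ => rfl) ha
    hpoly hb, fun b hb => furstenbergDescription (AddCircle.homeomorphCircle one_ne_zero) _
    (fun t => ?_) ha hpoly hb⟩
  rw [AddCircle.homeomorphCircle_apply, AddCircle.toCircle_apply_mk, div_one]
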